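/- Let $n\ge 1$ be an integer, let $1<p\le 2$ and $1<q\le p-1+\frac pn$, and let $\mathbb S=(0,\infty)\times\mathbb R^n$ with points $(t,x)$. Consider the equation $$w_t-\operatorname{div}_x\left(|\nabla_x w|^{p-2}\nabla_x w\right)=|w|^{q-1}w \quad\text{in }\mathbb S. \qquad (1)$$ A measurable function $u$ on $\mathbb S$ is an entire weak super-solution of (1) if $u\in L_{q,\mathrm{loc}}(\mathbb S)$, it has weak derivatives with $u_t\in L_{1,\mathrm{loc}}(\mathbb S)$ and $|\nabla_x u|^p\in L_{1,\mathrm{loc}}(\mathbb S)$, and $$\int_{\mathbb S}\Big[u_t\varphi+\sum_{i=1}^n|\nabla_x u|^{p-2}u_{x_i}\varphi_{x_i}-|u|^{q-1}u\,\varphi\Big]\,dt\,dx\ \ge\ 0$$ for every non-negative $\varphi\in C^\infty(\mathbb S)$ with compact support in $\mathbb S$. It is an entire weak super-solution of the Cauchy problem for (1) with initial datum $u_0$, a distribution on $\mathbb R^n$, if moreover $u\ge u_0$ at $t=0$ in the sense that $$\operatorname*{ess\,lim\,inf}_{t\to0+}\int_{\mathbb R^n}u(t,x)\psi(x)\,dx\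 \ge\ \langle u_0,\psi\rangle$$ for every non-negative $\psi\in C_c^\infty(\mathbb R^n)$. A function $v$ is an entire weak sub-solution of (1), respectively of the Cauchy problem with initial datum $v_0$, if $-v$ is an entire weak super-solution of (1), respectively of the Cauchy problem with initial datum $-v_0$. Theorem 2. Let $u_0,v_0$ be arbitrary, possibly different, initial data, let $u$ be an entire weak super-solution of the Cauchy problem for (1) with initial datum $u_0$ and let $v$ be an entire weak sub-solution of the Cauchy problem for (1) with initial datum $v_0$, such that $u\ge v$ almost everywhere in $\mathbb S$. Then $u=v$ almost everywhere in $\mathbb S$. -/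

import Mathlib

open MeasureTheory Filter Topology TopologicalSpace
open scoped Distributions

/-- The open half-space `(0, ∞) × ℝⁿ`, whose points are written `(t, x)`. -/
def halfSpace (n : ℕ) : Opens (ℝ × EuclideanSpace ℝ (Fin n)) where
  carrier := {z | 0 < z.1}
  is_open' := isOpen_lt continuous_const continuous_fst

/-- The classical partial derivative `φ_t`. -/
noncomputable def timeDeriv {n : ℕ} (φ : ℝ × EuclideanSpace ℝ (Fin n) → ℝ)
    (z : ℝ × EuclideanSpace ℝ (Fin n)) : ℝ :=
  deriv (fun t : ℝ => φ (t, z.2)) z.1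

/-- The classical partial derivative `φ_{x_i}`. -/
noncomputable def spaceDeriv {n : ℕ} (i : Fin n) (φ : ℝ × EuclideanSpace ℝ (Fin n) → ℝ)
    (z : ℝ × EuclideanSpace ℝ (Fin n)) : ℝ :=
  fderiv ℝ (fun x : EuclideanSpace ℝ (Fin n) => φ (z.1, x)) z.2 (EuclideanSpace.single i 1)

/-- `ut` is the weak derivative `u_t` of `u` in the half-space; both are locally integrable
there. Test functions are the smooth functions with compact support in the half-space. -/
def HasWeakTimeDeriv {n : ℕ} (u ut : ℝ × EuclideanSpace ℝ (Fin n) → ℝ) : Prop :=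
  LocallyIntegrableOn u (halfSpace n) ∧ LocallyIntegrableOn ut (halfSpace n) ∧
  ∀ φ : 𝓓(halfSpace n, ℝ),
    ∫ z in (halfSpace n : Set (ℝ × EuclideanSpace ℝ (Fin n))), u z * timeDeriv φ z =
      -∫ z in (halfSpace n : Set (ℝ × EuclideanSpace ℝ (Fin n))), ut z * φ z

/-- `g` is the weak spatial gradient `∇ₓ u` of `u` in the half-space; both are locally
integrable there. -/
def HasWeakSpaceGradient {n : ℕ} (u : ℝ × EuclideanSpace ℝ (Fin n) → ℝ)
    (g : ℝ × EuclideanSpace ℝ (Fin n) → EuclideanSpace ℝ (Fin n)) : Prop :=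
  LocallyIntegrableOn u (halfSpace n) ∧ LocallyIntegrableOn g (halfSpace n) ∧
  ∀ (i : Fin n) (φ : 𝓓(halfSpace n, ℝ)),
    ∫ z in (halfSpace n : Set (ℝ × EuclideanSpace ℝ (Fin n))), u z * spaceDeriv i φ z =
      -∫ z in (halfSpace n : Set (ℝ × EuclideanSpace ℝ (Fin n))), g z i * φ z

/-- `u` is an entire weak super-solution of `w_t - Δ_p w = |w|^{q-1} w` in the half-space:
`u ∈ L_{q,loc}`, `u_t ∈ L_{1,loc}`, `|∇ₓ u|^p ∈ L_{1,loc}` and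
`∫ [u_t φ + ∑ᵢ |∇ₓ u|^{p-2} u_{x_i} φ_{x_i} - |u|^{q-1} u φ] dt dx ≥ 0` for every non-negative
smooth `φ` with compact support in the half-space. (Weak derivatives are unique up to a null set,
so it is immaterial which representatives `ut`, `g` are chosen.) -/
def IsEntireWeakSuperSolution (n : ℕ) (p q : ℝ)
    (u : ℝ × EuclideanSpace ℝ (Fin n) → ℝ) : Prop :=
  AEStronglyMeasurable u
    (volume.restrict (halfSpace n : Set (ℝ × EuclideanSpace ℝ (Fin n)))) ∧
  LocallyIntegrableOn (fun z => |u z| ^ q) (halfSpace n) ∧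
  ∃ (ut : ℝ × EuclideanSpace ℝ (Fin n) → ℝ)
    (g : ℝ × EuclideanSpace ℝ (Fin n) → EuclideanSpace ℝ (Fin n)),
    HasWeakTimeDeriv u ut ∧ HasWeakSpaceGradient u g ∧
    LocallyIntegrableOn (fun z => ‖g z‖ ^ p) (halfSpace n) ∧
    ∀ φ : 𝓓(halfSpace n, ℝ), (∀ z, 0 ≤ φ z) →
      0 ≤ ∫ z in (halfSpace n : Set (ℝ × EuclideanSpace ℝ (Fin n))),
        (ut z * φ z + ∑ i : Fin n, ‖g z‖ ^ (p - 2) * g z i * spaceDeriv i φ z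
          - |u z| ^ (q - 1) * u z * φ z)

/-- `v` is an entire weak sub-solution if `-v` is an entire weak super-solution. -/
def IsEntireWeakSubSolution (n : ℕ) (p q : ℝ)
    (v : ℝ × EuclideanSpace ℝ (Fin n) → ℝ) : Prop :=
  IsEntireWeakSuperSolution n p q (fun z => -v z)

/-- The initial condition `u ≥ u₀` at `t = 0`, in the sense of distributions: for every
non-negative test function `ψ` on `ℝⁿ`,
`ess liminf_{t → 0+} ∫ u(t, x) ψ(x) dx ≥ ⟨u₀, ψ⟩`.
The filter `𝓝[>] 0 ⊓ ae volume` encodes `t → 0+` outside a null set of times. -/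
def InitiallyAtLeast {n : ℕ} (u₀ : 𝓓'((⊤ : Opens (EuclideanSpace ℝ (Fin n))), ℝ))
    (u : ℝ × EuclideanSpace ℝ (Fin n) → ℝ) : Prop :=
  ∀ ψ : 𝓓((⊤ : Opens (EuclideanSpace ℝ (Fin n))), ℝ), (∀ x, 0 ≤ ψ x) →
    ∀ ε : ℝ, 0 < ε → ∀ᶠ t : ℝ in 𝓝[>] (0 : ℝ) ⊓ ae volume,
      u₀ ψ - ε ≤ ∫ x : EuclideanSpace ℝ (Fin n), u (t, x) * ψ x

/-- `u` is an entire weak super-solution of the Cauchy problem `w_t - Δ_p w = |w|^{q-1} w` in the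
half-space, `w(0, ·) = u₀`. The initial datum `u₀` is any distribution on `ℝⁿ` (for instance a
locally integrable function or a Radon measure). -/
def IsEntireWeakSuperSolutionCauchy (n : ℕ) (p q : ℝ)
    (u₀ : 𝓓'((⊤ : Opens (EuclideanSpace ℝ (Fin n))), ℝ))
    (u : ℝ × EuclideanSpace ℝ (Fin n) → ℝ) : Prop :=
  IsEntireWeakSuperSolution n p q u ∧ InitiallyAtLeast u₀ u

/-- `v` is an entire weak sub-solution of the Cauchy problem with initial datum `v₀`: it is an
entire weak sub-solution of the equation and `v ≤ v₀` at `t = 0` in the sense of distributions. -/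
def IsEntireWeakSubSolutionCauchy (n : ℕ) (p q : ℝ)
    (v₀ : 𝓓'((⊤ : Opens (EuclideanSpace ℝ (Fin n))), ℝ))
    (v : ℝ × EuclideanSpace ℝ (Fin n) → ℝ) : Prop :=
  IsEntireWeakSubSolution n p q v ∧ InitiallyAtLeast (-v₀) (fun z => -v z)

/-! The difference w = u - v ≥ 0 satisfies a differential inequality of its own. Adding the
inequalities for the super-solutions u and -v gives w_t - div B ≥ f weakly, where B is the
difference of the two fluxes and f that of the two reaction terms. Uniform monotonicity of power
maps (`uniform_monotone_rpow_smul`) yields f ≥ c w^q. Applied to the inverse of the flux map, whose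
exponent p/(p-1) is at least 2 because p ≤ 2, it also yields c |B|^(p/(p-1)) ≤ B·∇w. Thus w behaves
like a non-negative super-solution of the original equation, and q lies in the Fujita range,
critical exponent included, where such functions vanish.

The vanishing is proved by the nonlinear capacity method. Testing with (w+ε)^(-ν) ζ
(`energy_estimate`) bounds the gradient energy ∫ B·∇w (w+ε)^(-ν-1) ζ (`exists_gradient_bound`).
Testing with ζ alone bounds ∫ w^q ζ by integrals of w and |B| over the region where the cylinder
cutoff is not locally constant, and Young's inequality trades |B| for gradient energy
(`exists_reaction_bound`). Here ζ = θ(t) ξ^s. The time factor θ is nondecreasing and vanishes near t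
= 0, so its derivative enters with a favourable sign and no control as t → 0 is needed. The high
power s absorbs the powers of ξ lost in differentiation.

On a cylinder of height T = λ^(-(q-1)) and radius R = λ^(-(q-p+1)/p), every error is of size λ^q
times the volume, that is, of order λ R^n. This stays bounded as R → ∞ precisely when q ≤ p-1+p/n
(`exists_scale`), so w^q θ is integrable on the half-space. At the critical exponent the bound need
not tend to zero. There `exists_reaction_tail_bound` gives c ∫ w^q ζ ≤ η·const + M(η) ∫ w^q ζ over
the outer region; integrability removes the last term as R → ∞, and then η → 0. -/

/-! ### Monotonicity of power maps and elementary inequalities -/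

/-- The map `ξ ↦ ‖ξ‖ ^ (r - 2) • ξ` is uniformly monotone for `r ≥ 2`. -/
theorem uniform_monotone_rpow_smul {E : Type*} [NormedAddCommGroup E] [InnerProductSpace ℝ E]
    {r : ℝ} (hr : 2 ≤ r) (a b : E) :
    2 ^ (1 - r) * ‖a - b‖ ^ r ≤
      inner ℝ (‖a‖ ^ (r - 2) • a - ‖b‖ ^ (r - 2) • b) (a - b) := by
  have hr2 : 0 ≤ r - 2 := by linarith
  set α := ‖a‖ ^ (r - 2)
  set β := ‖b‖ ^ (r - 2)
  have hα : 0 ≤ α := by positivity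
  have hβ : 0 ≤ β := by positivity
  -- Symmetrizing in α and β isolates a multiple of ‖a - b‖²; the remainder is non-negative since α
  -- - β and ‖a‖² - ‖b‖² have the same sign.
  have h1 : inner ℝ (α • a - β • b) (a - b) =
      (α + β) / 2 * ‖a - b‖ ^ 2 + (α - β) / 2 * (‖a‖ ^ 2 - ‖b‖ ^ 2) := by
    rw [norm_sub_sq_real]
    simp only [inner_sub_left, inner_sub_right, inner_smul_left, real_inner_self_eq_norm_sq,
      real_inner_comm a b]
    simp
    ring
  have h2 : 0 ≤ (α - β) / 2 * (‖a‖ ^ 2 - ‖b‖ ^ 2) := by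
    rcases le_total ‖a‖ ‖b‖ with h | h
    · have : α ≤ β := Real.rpow_le_rpow (norm_nonneg _) h hr2
      have h' : ‖a‖ ^ 2 ≤ ‖b‖ ^ 2 := by gcongr
      exact mul_nonneg_of_nonpos_of_nonpos (by linarith) (by linarith)
    · have : β ≤ α := Real.rpow_le_rpow (norm_nonneg _) h hr2
      have h' : ‖b‖ ^ 2 ≤ ‖a‖ ^ 2 := by gcongr
      exact mul_nonneg (by linarith) (by linarith)
  have h3 : ‖a - b‖ ^ (r - 2) ≤ 2 ^ (r - 2) * (α + β) := by
    have hm : ‖a - b‖ ≤ 2 * max ‖a‖ ‖b‖ := by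
      have := norm_sub_le a b
      have := le_max_left ‖a‖ ‖b‖
      have := le_max_right ‖a‖ ‖b‖
      linarith
    calc ‖a - b‖ ^ (r - 2) ≤ (2 * max ‖a‖ ‖b‖) ^ (r - 2) := by gcongr
      _ = 2 ^ (r - 2) * (max ‖a‖ ‖b‖) ^ (r - 2) := Real.mul_rpow (by norm_num) (by positivity)
      _ ≤ 2 ^ (r - 2) * (α + β) := by
        gcongr
        rcases max_cases ‖a‖ ‖b‖ with h | h <;> rw [h.1]
        · linarith
        · linarith
  have h4 : ‖a - b‖ ^ r = ‖a - b‖ ^ (r - 2) * ‖a - b‖ ^ 2 := by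
    rw [← Real.rpow_natCast, ← Real.rpow_add_of_nonneg (norm_nonneg _) hr2 (by norm_num)]
    norm_num
  have h5 : (2 : ℝ) ^ (1 - r) * 2 ^ (r - 2) = 1 / 2 := by
    rw [← Real.rpow_add (by norm_num)]
    ring_nf
    rw [Real.rpow_neg_one]; norm_num
  rw [h1, h4]
  calc 2 ^ (1 - r) * (‖a - b‖ ^ (r - 2) * ‖a - b‖ ^ 2)
      ≤ 2 ^ (1 - r) * ((2 ^ (r - 2) * (α + β)) * ‖a - b‖ ^ 2) := by gcongr
    _ = (2 ^ (1 - r) * 2 ^ (r - 2)) * (α + β) * ‖a - b‖ ^ 2 := by ring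
    _ ≤ _ := by rw [h5]; linarith

theorem norm_rpow_smul_self {E : Type*} [NormedAddCommGroup E] [NormedSpace ℝ E]
    {p : ℝ} (hp : 1 < p) (a : E) : ‖‖a‖ ^ (p - 2) • a‖ = ‖a‖ ^ (p - 1) := by
  rw [norm_smul, Real.norm_of_nonneg (by positivity)]
  rcases eq_or_lt_of_le (norm_nonneg a) with h | h
  · rw [← h, mul_zero, Real.zero_rpow (by linarith)]
  · rw [← Real.rpow_add_one h.ne']; ring_nf

/-- For `1 < p ≤ 2` the flux `ξ ↦ ‖ξ‖ ^ (p - 2) • ξ` is controlled by its monotonicity form. -/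
theorem flux_rpow_le_inner {E : Type*} [NormedAddCommGroup E] [InnerProductSpace ℝ E]
    {p : ℝ} (hp : 1 < p) (hp2 : p ≤ 2) (a b : E) :
    2 ^ (1 - p / (p - 1)) * ‖‖a‖ ^ (p - 2) • a + ‖b‖ ^ (p - 2) • b‖ ^ (p / (p - 1)) ≤
      inner ℝ (‖a‖ ^ (p - 2) • a + ‖b‖ ^ (p - 2) • b) (a + b) := by
  have hp0 : 0 < p - 1 := by linarith
  have hr : 2 ≤ p / (p - 1) := by rw [le_div_iff₀ hp0]; linarith
  -- Duality: the power map of exponent p/(p-1) inverts the flux map, so its uniform monotonicity,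
  -- evaluated at two fluxes, returns the original vectors.
  have key : ∀ c : E, ‖‖c‖ ^ (p - 2) • c‖ ^ (p / (p - 1) - 2) • (‖c‖ ^ (p - 2) • c) = c := by
    intro c
    rw [norm_rpow_smul_self hp]
    rcases eq_or_ne c 0 with rfl | hc
    · simp
    · have hc' : 0 < ‖c‖ := norm_pos_iff.2 hc
      rw [smul_smul, ← Real.rpow_mul hc'.le, ← Real.rpow_add hc']
      have : (p - 1) * (p / (p - 1) - 2) + (p - 2) = 0 := by field_simp; ring
      rw [this, Real.rpow_zero, one_smul]
  have h := uniform_monotone_rpow_smul hr (‖a‖ ^ (p - 2) • a) (-(‖b‖ ^ (p - 2) • b))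
  rw [norm_neg, smul_neg, key a, key b, sub_neg_eq_add, sub_neg_eq_add, real_inner_comm] at h
  exact h

/-- Uniform monotonicity on the line with exponent q + 1, taken between a and -b and divided by a +
b. The sum form fits the pair of super-solutions u and -v. -/
theorem rpow_le_signed_rpow_add {q : ℝ} (hq : 1 < q) {a b : ℝ} (hab : 0 ≤ a + b) :
    2 ^ (-q) * (a + b) ^ q ≤ |a| ^ (q - 1) * a + |b| ^ (q - 1) * b := by
  have h := uniform_monotone_rpow_smul (E := ℝ) (r := q + 1) (by linarith) a (-b)
  simp only [sub_neg_eq_add, smul_eq_mul, norm_neg, Real.norm_eq_abs, abs_of_nonneg hab,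
    mul_neg] at h
  have e1 : q + 1 - 2 = q - 1 := by ring
  have e2 : 1 - (q + 1) = -q := by ring
  rw [e1, e2] at h
  rcases eq_or_lt_of_le hab with h0 | h0
  · have hb : b = -a := by linarith
    subst hb
    simp [Real.zero_rpow (by linarith : q ≠ 0)]
  · rw [Real.rpow_add_one h0.ne'] at h
    have h' : (a + b) * (2 ^ (-q) * (a + b) ^ q) ≤
        (a + b) * (|a| ^ (q - 1) * a + |b| ^ (q - 1) * b) := by
      have : inner ℝ (|a| ^ (q - 1) * a + |b| ^ (q - 1) * b) (a + b) =
        (a + b) * (|a| ^ (q - 1) * a + |b| ^ (q - 1) * b) := by simp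
      rw [this] at h
      linarith
    exact le_of_mul_le_mul_left h' h0

/-- Young's inequality with a weight. -/
theorem mul_le_weighted_young {p b y α : ℝ} (hp : 1 < p) (hb : 0 ≤ b) (hy : 0 ≤ y) (hα : 0 < α) :
    b * y ≤ α * b ^ (p / (p - 1)) + α ^ (1 - p) * y ^ p := by
  have hp0 : 0 < p - 1 := by linarith
  -- At this threshold the two terms on the right balance; on either side of it one of them alone
  -- dominates b y, so no sharp constant is needed.
  rcases le_or_gt y (α * b ^ (1 / (p - 1))) with h | h
  · have e : b ^ (p / (p - 1)) = b * b ^ (1 / (p - 1)) := by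
      rw [← Real.rpow_one_add' hb (by positivity)]
      congr 1; field_simp; ring
    have : 0 ≤ α ^ (1 - p) * y ^ p := by positivity
    rw [e]
    nlinarith [mul_le_mul_of_nonneg_left h hb]
  · have h1 : b ≤ (y / α) ^ (p - 1) := by
      have h2 : b ^ (1 / (p - 1)) ≤ y / α := by rw [le_div_iff₀ hα]; linarith
      calc b = (b ^ (1 / (p - 1))) ^ (p - 1) := by
            rw [← Real.rpow_mul hb, one_div_mul_cancel hp0.ne', Real.rpow_one]
        _ ≤ _ := by gcongr
    have e : α ^ (1 - p) * y ^ p = (y / α) ^ (p - 1) * y := by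
      rw [Real.div_rpow hy hα.le, ← neg_sub p 1, Real.rpow_neg hα.le]
      have : y ^ p = y ^ (p - 1) * y := by
        rw [← Real.rpow_add_one' hy (by linarith)]; ring_nf
      rw [this]; ring
    rw [e]
    have : 0 ≤ α * b ^ (p / (p - 1)) := by positivity
    nlinarith [mul_le_mul_of_nonneg_right h1 hy]

/-- Interpolation between a power of `W` and a power of the scale `lam`, with a cutoff `x`. -/
theorem interpolation_cutoff {a b k s η W lam x : ℝ} (ha : 0 ≤ a) (hab : a < b) (hk : 0 < k)
    (hs : k * b / (b - a) ≤ s) (hη : 0 < η) (hW : 0 ≤ W) (hlam : 0 < lam) (hx : 0 ≤ x)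
    (hx1 : x ≤ 1) :
    lam ^ (b - a) * W ^ a * x ^ (s - k) ≤
      η * (W ^ b * x ^ s) + η ^ (-(a / (b - a))) * lam ^ b := by
  have hba : 0 < b - a := by linarith
  have hb : 0 < b := by linarith
  have hsk : k ≤ s := by
    refine le_trans ?_ hs
    rw [le_div_iff₀ hba]; nlinarith
  have hs0 : 0 < s := by linarith
  have hA : 0 ≤ η * (W ^ b * x ^ s) := by positivity
  have hB : 0 ≤ η ^ (-(a / (b - a))) * lam ^ b := by positivity
  -- Either the first term on the right dominates, or `W * x ^ (k / (b - a))` is at most a multiple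
  -- of `lam` and the second one does.
  rcases le_or_gt (lam ^ (b - a)) (η * (W ^ (b - a) * x ^ k)) with h | h
  · have e1 : W ^ b = W ^ (b - a) * W ^ a := by
      rw [← Real.rpow_add_of_nonneg hW hba.le ha]; ring_nf
    have e2 : x ^ s = x ^ k * x ^ (s - k) := by
      rw [← Real.rpow_add_of_nonneg hx hk.le (by linarith)]; ring_nf
    calc lam ^ (b - a) * W ^ a * x ^ (s - k)
        ≤ (η * (W ^ (b - a) * x ^ k)) * W ^ a * x ^ (s - k) := by gcongr
      _ = η * (W ^ b * x ^ s) := by rw [e1, e2]; ring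
      _ ≤ _ := by linarith
  · have h1 : W * x ^ (k / (b - a)) ≤ η ^ (-(1 / (b - a))) * lam := by
      have h2 : W ^ (b - a) * x ^ k ≤ η⁻¹ * lam ^ (b - a) := by
        rw [inv_mul_eq_div, le_div_iff₀ hη]; linarith
      have h3 := Real.rpow_le_rpow (by positivity) h2 (z := 1 / (b - a)) (by positivity)
      rw [Real.mul_rpow (by positivity) (by positivity),
        Real.mul_rpow (by positivity) (by positivity), ← Real.rpow_mul hW, ← Real.rpow_mul hx,
        ← Real.rpow_mul hlam.le, mul_one_div_cancel hba.ne', Real.rpow_one, Real.rpow_one,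
        mul_one_div, Real.inv_rpow hη.le, ← Real.rpow_neg hη.le] at h3
      exact h3
    have h4 : W ^ a * x ^ (k * a / (b - a)) ≤ η ^ (-(a / (b - a))) * lam ^ a := by
      have h3 := Real.rpow_le_rpow (by positivity) h1 ha
      rw [Real.mul_rpow (by positivity) (by positivity),
        Real.mul_rpow (by positivity) (by positivity), ← Real.rpow_mul hx,
        ← Real.rpow_mul hη.le] at h3
      convert h3 using 3 <;> ring
    have e : k * b / (b - a) = k + k * a / (b - a) := by field_simp; ring
    -- The lower bound on s is exactly s - k ≥ k a/(b - a). The point x = 0 is separate because the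
    -- right-hand exponent vanishes when a = 0, and 0^0 = 1.
    have h5 : x ^ (s - k) ≤ x ^ (k * a / (b - a)) := by
      rcases eq_or_lt_of_le hx with h0 | h0
      · rw [← h0]
        rcases eq_or_lt_of_le ha with h0a | h0a
        · rw [← h0a]
          simp only [mul_zero, zero_div, Real.rpow_zero]
          exact Real.zero_rpow_le_one _
        · have : 0 < k * a / (b - a) := by positivity
          rw [Real.zero_rpow (by linarith), Real.zero_rpow this.ne']
      · exact Real.rpow_le_rpow_of_exponent_ge h0 hx1 (by linarith)
    have e1 : lam ^ b = lam ^ (b - a) * lam ^ a := by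
      rw [← Real.rpow_add hlam]; ring_nf
    calc lam ^ (b - a) * W ^ a * x ^ (s - k)
        ≤ lam ^ (b - a) * W ^ a * x ^ (k * a / (b - a)) := by gcongr
      _ = lam ^ (b - a) * (W ^ a * x ^ (k * a / (b - a))) := by ring
      _ ≤ lam ^ (b - a) * (η ^ (-(a / (b - a))) * lam ^ a) := by gcongr
      _ = η ^ (-(a / (b - a))) * lam ^ b := by rw [e1]; ring
      _ ≤ _ := by linarith

theorem add_rpow_le_two_rpow_mul {q : ℝ} (hq : 0 ≤ q) {a b : ℝ} (ha : 0 ≤ a) (hb : 0 ≤ b) :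
    (a + b) ^ q ≤ 2 ^ q * (a ^ q + b ^ q) := by
  have h : a + b ≤ 2 * max a b := by
    have := le_max_left a b
    have := le_max_right a b
    linarith
  calc (a + b) ^ q ≤ (2 * max a b) ^ q := by gcongr
    _ = 2 ^ q * (max a b) ^ q := Real.mul_rpow (by norm_num) (by positivity)
    _ ≤ 2 ^ q * (a ^ q + b ^ q) := by
      have := Real.rpow_nonneg ha q
      have := Real.rpow_nonneg hb q
      gcongr
      rcases max_cases a b with h | h <;> rw [h.1] <;> linarith

/-! ### Convergence of integrals under varying majorants -/

/-- Dominated convergence with converging majorants. -/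
theorem tendsto_integral_of_convergent_majorants {α : Type*} [MeasurableSpace α] {μ : Measure α}
    {F G : ℕ → α → ℝ} {f g : α → ℝ} (hF : ∀ n, AEStronglyMeasurable (F n) μ)
    (hG : ∀ n, Integrable (G n) μ) (hg : Integrable g μ)
    (hFG : ∀ n, ∀ᵐ x ∂μ, |F n x| ≤ G n x)
    (hFf : ∀ᵐ x ∂μ, Tendsto (fun n => F n x) atTop (𝓝 (f x)))
    (hGg : ∀ᵐ x ∂μ, Tendsto (fun n => G n x) atTop (𝓝 (g x)))
    (hint : Tendsto (fun n => ∫ x, G n x ∂μ) atTop (𝓝 (∫ x, g x ∂μ))) :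
    Tendsto (fun n => ∫ x, F n x ∂μ) atTop (𝓝 (∫ x, f x ∂μ)) := by
  have hall : ∀ᵐ x ∂μ, ∀ n, |F n x| ≤ G n x := ae_all_iff.2 hFG
  have hfg : ∀ᵐ x ∂μ, |f x| ≤ g x := by
    filter_upwards [hall, hFf, hGg] with x h1 h2 h3
    exact le_of_tendsto_of_tendsto' h2.abs h3 h1
  have hFi : ∀ n, Integrable (F n) μ := fun n => (hG n).mono' (hF n) (hFG n)
  -- Truncating `F n` to [-g, g] makes ordinary dominated convergence available; the truncation
  -- error is at most `G n - min (G n) g`, whose integral tends to zero.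
  let c : ℕ → α → ℝ := fun n x => max (-g x) (min (F n x) (g x))
  have hcm : ∀ n, AEStronglyMeasurable (c n) μ := fun n =>
    hg.1.neg.sup ((hF n).inf hg.1)
  have hcb : ∀ n, ∀ᵐ x ∂μ, ‖c n x‖ ≤ g x := by
    intro n
    filter_upwards [hfg] with x hx
    have h0 : 0 ≤ g x := (abs_nonneg _).trans hx
    rw [Real.norm_eq_abs, abs_le]
    exact ⟨le_max_left _ _, max_le (by linarith) (min_le_right _ _)⟩
  have hci : ∀ n, Integrable (c n) μ := fun n => hg.mono' (hcm n) (hcb n)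
  have hc : Tendsto (fun n => ∫ x, c n x ∂μ) atTop (𝓝 (∫ x, f x ∂μ)) := by
    refine tendsto_integral_of_dominated_convergence g hcm hg hcb ?_
    filter_upwards [hfg, hFf] with x hx h
    have : f x = max (-g x) (min (f x) (g x)) := by
      rw [abs_le] at hx
      rw [min_eq_left hx.2, max_eq_right hx.1]
    rw [this]
    exact tendsto_const_nhds.max (h.min tendsto_const_nhds)
  have hm : Tendsto (fun n => ∫ x, min (G n x) (g x) ∂μ) atTop (𝓝 (∫ x, g x ∂μ)) := by
    refine tendsto_integral_of_dominated_convergence g (fun n => (hG n).1.inf hg.1) hg ?_ ?_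
    · intro n
      filter_upwards [hfg, hFG n] with x hx h
      have h0 : 0 ≤ g x := (abs_nonneg _).trans hx
      have h1 : 0 ≤ G n x := (abs_nonneg _).trans h
      rw [Real.norm_of_nonneg (le_min h1 h0)]
      exact min_le_right _ _
    · filter_upwards [hGg] with x h
      simpa using h.min (tendsto_const_nhds (x := g x))
  have hmi : ∀ n, Integrable (fun x => min (G n x) (g x)) μ := fun n => (hG n).inf hg
  have hd : Tendsto (fun n => ∫ x, (F n x - c n x) ∂μ) atTop (𝓝 0) := by
    refine squeeze_zero_norm (a := fun n => (∫ x, G n x ∂μ) - ∫ x, min (G n x) (g x) ∂μ) ?_ ?_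
    · intro n
      rw [← integral_sub (hG n) (hmi n)]
      refine norm_integral_le_of_norm_le ((hG n).sub (hmi n)) ?_
      filter_upwards [hfg, hFG n] with x hx h
      have h0 : 0 ≤ g x := (abs_nonneg _).trans hx
      have hab := abs_le.1 h
      simp only [c, Real.norm_eq_abs]
      rcases max_cases (-g x) (min (F n x) (g x)) with h1 | h1 <;>
      rcases min_cases (F n x) (g x) with h2 | h2 <;>
      rcases min_cases (G n x) (g x) with h3 | h3 <;>
      rw [h1.1, h3.1, abs_le] <;> constructor <;> linarith
    · simpa using hint.sub hm
  have := hd.add hc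
  simp only [zero_add] at this
  refine this.congr fun n => ?_
  rw [integral_sub (hFi n) (hci n)]; ring

/-! ### Mollification and weak derivatives -/

section Mollification

/-- A smooth bump function at the origin whose support has radius `2 / (k + 1)`. -/
noncomputable def shrinkingBump (E : Type*) [NormedAddCommGroup E] [NormedSpace ℝ E]
    [FiniteDimensional ℝ E] (k : ℕ) : ContDiffBump (0 : E) where
  rIn := 1 / ((k : ℝ) + 1)
  rOut := 2 / ((k : ℝ) + 1)
  rIn_pos := by positivity
  rIn_lt_rOut := by
    have : (0 : ℝ) < (k : ℝ) + 1 := by positivity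
    gcongr
    norm_num

theorem tendsto_shrinkingBump_rOut (E : Type*) [NormedAddCommGroup E] [NormedSpace ℝ E]
    [FiniteDimensional ℝ E] :
    Tendsto (fun k => (shrinkingBump E k).rOut) atTop (𝓝 0) :=
  tendsto_const_div_atTop_nhds_zero_nat (2 : ℝ) |>.comp (tendsto_add_atTop_nat 1) |>.congr
    fun k => by simp [shrinkingBump]

variable {E : Type*} [NormedAddCommGroup E] [NormedSpace ℝ E] [FiniteDimensional ℝ E]
  [MeasurableSpace E] [BorelSpace E]

/-- The convolution of `f` with a normalized shrinking bump function. -/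
noncomputable def mollify (μ : Measure E) (k : ℕ) (f : E → ℝ) : E → ℝ :=
  convolution ((shrinkingBump E k).normed μ) f (ContinuousLinearMap.lsmul ℝ ℝ) μ

variable (μ : Measure E) [μ.IsAddHaarMeasure]

theorem mollify_apply (k : ℕ) (f : E → ℝ) (z : E) :
    mollify μ k f z = ∫ y, (shrinkingBump E k).normed μ (z - y) * f y ∂μ := by
  simp [mollify, convolution_eq_swap]

variable {μ}

theorem contDiff_mollify (k : ℕ) {f : E → ℝ} (hf : Integrable f μ) :
    ContDiff ℝ (⊤ : ℕ∞) (mollify μ k f) :=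
  (shrinkingBump E k).hasCompactSupport_normed.contDiff_convolution_left _
    (shrinkingBump E k).contDiff_normed hf.locallyIntegrable

/-- The fixed ratio 2 of outer to inner radius makes the kernels comparable to averages over balls,
so Lebesgue differentiation applies. -/
theorem ae_tendsto_mollify {f : E → ℝ} (hf : Integrable f μ) :
    ∀ᵐ z ∂μ, Tendsto (fun k => mollify μ k f z) atTop (𝓝 (f z)) :=
  ContDiffBump.ae_convolution_tendsto_right_of_locallyIntegrable (K := 2)
    (tendsto_shrinkingBump_rOut E)
    (Eventually.of_forall fun k => by simp only [shrinkingBump]; apply le_of_eq; ring)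
    hf.locallyIntegrable

theorem integrable_bump_normed (k : ℕ) : Integrable ((shrinkingBump E k).normed μ) μ :=
  (shrinkingBump E k).continuous_normed.integrable_of_hasCompactSupport
    (shrinkingBump E k).hasCompactSupport_normed

theorem integrable_mollify (k : ℕ) {f : E → ℝ} (hf : Integrable f μ) :
    Integrable (mollify μ k f) μ :=
  (integrable_bump_normed k).integrable_convolution _ hf

/-- The kernel has mass one. Consequently majorants built from mollified functions have integrals
independent of k, as the limits under varying majorants require. -/
theorem integral_mollify (k : ℕ) {f : E → ℝ} (hf : Integrable f μ) :
    ∫ z, mollify μ k f z ∂μ = ∫ z, f z ∂μ := by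
  rw [mollify, integral_convolution _ (integrable_bump_normed k) hf,
    (shrinkingBump E k).integral_normed]
  simp

theorem integrable_mollify_integrand (k : ℕ) {f : E → ℝ} (hf : Integrable f μ) (z : E) :
    Integrable (fun y => (shrinkingBump E k).normed μ (z - y) * f y) μ := by
  obtain ⟨C, hC⟩ := (shrinkingBump E k).continuous_normed (μ := μ)
    |>.bounded_above_of_compact_support (shrinkingBump E k).hasCompactSupport_normed
  exact hf.bdd_mul (c := C) ((shrinkingBump E k).continuous_normed.comp
    (continuous_const.sub continuous_id)).aestronglyMeasurable
    (Eventually.of_forall fun y => hC _)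

theorem mollify_nonneg (k : ℕ) {f : E → ℝ} (hf : ∀ z, 0 ≤ f z) (z : E) : 0 ≤ mollify μ k f z := by
  rw [mollify_apply]
  exact integral_nonneg fun y => mul_nonneg ((shrinkingBump E k).nonneg_normed _) (hf y)

theorem abs_mollify_le (k : ℕ) (f : E → ℝ) (z : E) :
    |mollify μ k f z| ≤ mollify μ k (fun y => |f y|) z := by
  rw [mollify_apply, mollify_apply]
  refine (abs_integral_le_integral_abs).trans (le_of_eq ?_)
  congr 1 with y
  rw [abs_mul, abs_of_nonneg ((shrinkingBump E k).nonneg_normed _)]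

theorem integral_bump_sub (k : ℕ) (z : E) :
    ∫ y, (shrinkingBump E k).normed μ (z - y) ∂μ = 1 := by
  rw [integral_sub_left_eq_self (fun y => (shrinkingBump E k).normed μ y) μ z]
  exact (shrinkingBump E k).integral_normed

/-- Jensen's inequality for mollifications. -/
theorem abs_mollify_rpow_le {p : ℝ} (hp : 1 < p) (k : ℕ) {f : E → ℝ} (hf : Integrable f μ)
    (hfp : Integrable (fun z => |f z| ^ p) μ) (z : E) :
    |mollify μ k f z| ^ p ≤ mollify μ k (fun y => |f y| ^ p) z := by
  set c := mollify μ k (fun y => |f y|) z with hc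
  have hc0 : 0 ≤ c := mollify_nonneg k (fun y => abs_nonneg _) z
  have hp0 : 0 < p := by linarith
  -- The tangent line of a^p at a = c, obtained from Young's inequality. Integrating it against the
  -- probability kernel, with c the mean of |f|, gives Jensen.
  have tangent : ∀ a : ℝ, 0 ≤ a → p * c ^ (p - 1) * a - (p - 1) * c ^ p ≤ a ^ p := by
    intro a ha
    have hconj : p.HolderConjugate (p / (p - 1)) := Real.HolderConjugate.conjExponent hp
    have h := Real.young_inequality_of_nonneg ha (Real.rpow_nonneg hc0 (p - 1)) hconj
    have e : (c ^ (p - 1)) ^ (p / (p - 1)) = c ^ p := by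
      rw [← Real.rpow_mul hc0, mul_div_cancel₀ _ (by linarith : p - 1 ≠ 0)]
    rw [e] at h
    have h' := mul_le_mul_of_nonneg_left h hp0.le
    have e2 : p * (a ^ p / p + c ^ p / (p / (p - 1))) = a ^ p + (p - 1) * c ^ p := by
      have : p - 1 ≠ 0 := by linarith
      field_simp
    rw [e2] at h'
    linarith
  calc |mollify μ k f z| ^ p ≤ c ^ p := by gcongr; exact abs_mollify_le k f z
    _ = p * c ^ (p - 1) * c - (p - 1) * c ^ p := by
      have : c ^ p = c ^ (p - 1) * c := by
        rw [← Real.rpow_add_one' hc0 (by linarith)]; ring_nf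
      rw [this]; ring
    _ = ∫ y, (p * c ^ (p - 1) * ((shrinkingBump E k).normed μ (z - y) * |f y|) -
          (p - 1) * c ^ p * (shrinkingBump E k).normed μ (z - y)) ∂μ := by
      rw [integral_sub ((integrable_mollify_integrand k hf.abs z).const_mul _)
        (((integrable_bump_normed k).comp_sub_left z).const_mul _), integral_const_mul,
        integral_const_mul, integral_bump_sub, ← mollify_apply, ← hc, mul_one]
    _ ≤ ∫ y, (shrinkingBump E k).normed μ (z - y) * |f y| ^ p ∂μ := by
      refine integral_mono (((integrable_mollify_integrand k hf.abs z).const_mul _).sub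
        (((integrable_bump_normed k).comp_sub_left z).const_mul _))
        (integrable_mollify_integrand k hfp z) fun y => ?_
      have h := mul_le_mul_of_nonneg_left (tangent |f y| (abs_nonneg _))
        ((shrinkingBump E k).nonneg_normed (μ := μ) (z - y))
      dsimp only
      linarith
    _ = _ := (mollify_apply μ k _ z).symm

/-- `we` is the weak derivative of `w` in `Ω` in the direction `e`. -/
def HasWeakDirDeriv (μ : Measure E) (Ω : Opens E) (e : E) (w we : E → ℝ) : Prop :=
  ∀ φ : 𝓓(Ω, ℝ), ∫ z in (Ω : Set E), w z * fderiv ℝ φ z e ∂μ =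
    -∫ z in (Ω : Set E), we z * φ z ∂μ

/-- The derivative falls on the kernel, and the reflected kernel centred at z is a test function of
Ω once its ball lies in K. Restriction to K by indicators is needed because w is controlled only
locally in Ω. -/
theorem HasWeakDirDeriv.fderiv_mollify {Ω : Opens E} {e : E} {w we : E → ℝ}
    (h : HasWeakDirDeriv μ Ω e w we) {K : Set E} (hK : MeasurableSet K) (hKΩ : K ⊆ Ω)
    (hw : IntegrableOn w K μ) (k : ℕ) {z : E}
    (hz : Metric.closedBall z (shrinkingBump E k).rOut ⊆ K) :
    fderiv ℝ (mollify μ k (K.indicator w)) z e = mollify μ k (K.indicator we) z := by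
  set ρ := (shrinkingBump E k).normed μ with hρ
  have hρd : ContDiff ℝ (⊤ : ℕ∞) ρ := (shrinkingBump E k).contDiff_normed
  have hρc : HasCompactSupport ρ := (shrinkingBump E k).hasCompactSupport_normed
  have hwi : Integrable (K.indicator w) μ := hw.integrable_indicator hK
  have hder := hρc.hasFDerivAt_convolution_left (ContinuousLinearMap.lsmul ℝ ℝ) (𝕜 := ℝ)
    (hρd.of_le (by exact_mod_cast le_top)) hwi.locallyIntegrable z
  have hts : tsupport (fun y => ρ (z - y)) ⊆ Metric.closedBall z (shrinkingBump E k).rOut := by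
    refine closure_minimal ?_ Metric.isClosed_closedBall
    intro y hy
    have : z - y ∈ Function.support ρ := hy
    rw [hρ, ContDiffBump.support_normed_eq] at this
    simp only [Metric.mem_ball, dist_zero_right] at this
    rw [Metric.mem_closedBall, dist_comm, dist_eq_norm]
    exact this.le
  let φ : 𝓓(Ω, ℝ) :=
    { toFun := fun y => ρ (z - y)
      contDiff' := hρd.comp (contDiff_const.sub contDiff_id)
      hasCompactSupport' := HasCompactSupport.of_support_subset_isCompact
        (isCompact_closedBall z (shrinkingBump E k).rOut) ((subset_tsupport _).trans hts)
      tsupport_subset' := (hts.trans hz).trans hKΩ }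
  have hφ : ∀ y, φ y = ρ (z - y) := fun y => rfl
  have hφ' : ∀ y, fderiv ℝ φ y e = -(fderiv ℝ ρ (z - y) e) := by
    intro y
    have h1 : HasFDerivAt ρ (fderiv ℝ ρ (z - y)) (z - y) :=
      (hρd.differentiable (by simp)).differentiableAt.hasFDerivAt
    have h2 : HasFDerivAt (fun y : E => z - y) (-ContinuousLinearMap.id ℝ E) y :=
      (hasFDerivAt_id y).const_sub z
    have h3 : HasFDerivAt φ _ y := h1.comp y h2
    rw [h3.fderiv]
    simp
  -- Kernel and derivative vanish off K, so inserting the indicator changes neither integral.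
  have hout : ∀ y ∉ K, ρ (z - y) = 0 ∧ fderiv ℝ ρ (z - y) e = 0 := by
    intro y hy
    have hy' : y ∉ tsupport φ := fun hc => hy (hz (hts hc))
    refine ⟨image_eq_zero_of_notMem_tsupport (f := φ) hy', ?_⟩
    have := hφ' y
    rw [fderiv_of_notMem_tsupport (𝕜 := ℝ) hy'] at this
    simpa using this.symm
  have hex : ConvolutionExistsAt (fderiv ℝ ρ) (K.indicator w) z
      ((ContinuousLinearMap.lsmul ℝ ℝ).precompL E) μ :=
    (hρc.fderiv (𝕜 := ℝ)).convolutionExists_left _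
      (hρd.continuous_fderiv (by simp)) hwi.locallyIntegrable z
  rw [mollify, hder.fderiv, convolution_eq_swap, ContinuousLinearMap.integral_apply hex.integrable_swap]
  have h0 := h φ
  have e1 : ∫ y in (Ω : Set E), w y * fderiv ℝ φ y e ∂μ =
      -∫ y, fderiv ℝ ρ (z - y) e * K.indicator w y ∂μ := by
    rw [← integral_neg, ← integral_indicator Ω.isOpen.measurableSet]
    congr 1 with y
    by_cases hy : y ∈ K
    · rw [Set.indicator_of_mem (hKΩ hy), Set.indicator_of_mem hy, hφ']; ring
    · by_cases hy2 : y ∈ (Ω : Set E)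
      · rw [Set.indicator_of_mem hy2, Set.indicator_of_notMem hy, hφ', (hout y hy).2]; ring
      · rw [Set.indicator_of_notMem hy2, Set.indicator_of_notMem hy]; ring
  have e2 : ∫ y in (Ω : Set E), we y * φ y ∂μ = ∫ y, ρ (z - y) * K.indicator we y ∂μ := by
    rw [← integral_indicator Ω.isOpen.measurableSet]
    congr 1 with y
    by_cases hy : y ∈ K
    · rw [Set.indicator_of_mem (hKΩ hy), Set.indicator_of_mem hy, hφ]; ring
    · by_cases hy2 : y ∈ (Ω : Set E)
      · rw [Set.indicator_of_mem hy2, Set.indicator_of_notMem hy, hφ, (hout y hy).1]; ring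
      · rw [Set.indicator_of_notMem hy2, Set.indicator_of_notMem hy]; ring
  rw [e1, e2] at h0
  have h1 := neg_injective h0
  calc _ = ∫ y, fderiv ℝ ρ (z - y) e * K.indicator w y ∂μ := rfl
    _ = _ := by rw [h1, mollify_apply]

end Mollification

/-! ### Energy estimate for weak differential inequalities -/

section Energy

variable {E : Type*} [NormedAddCommGroup E] [NormedSpace ℝ E] [FiniteDimensional ℝ E]
  [MeasurableSpace E] [BorelSpace E] {μ : Measure E} [μ.IsAddHaarMeasure]

/-- Young and Jensen bound the product by a multiple of |b|^(p/(p-1)) plus the mollification of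
|D|^p. This majorant varies with k, but its integral does not. The result passes to the limit in the
diffusion term, where b and D lie only in dual Lebesgue spaces. -/
theorem integrable_and_tendsto_mul_mollify_mul {p : ℝ} (hp : 1 < p) {b D F : E → ℝ}
    {Fk : ℕ → E → ℝ} {C : ℝ} (m : ℕ) (hb : AEStronglyMeasurable b μ)
    (hbp : Integrable (fun z => |b z| ^ (p / (p - 1))) μ) (hD : Integrable D μ)
    (hDp : Integrable (fun z => |D z| ^ p) μ) (hFk : ∀ k, AEStronglyMeasurable (Fk k) μ)
    (hFC : ∀ k z, |Fk k z| ≤ C)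
    (hlim : ∀ᵐ z ∂μ, Tendsto (fun k => Fk k z) atTop (𝓝 (F z))) :
    (∀ k, Integrable (fun z => b z * mollify μ (k + m) D z * Fk k z) μ) ∧
    Tendsto (fun k => ∫ z, b z * mollify μ (k + m) D z * Fk k z ∂μ) atTop
      (𝓝 (∫ z, b z * D z * F z ∂μ)) := by
  have hp0 : 0 < p := by linarith
  let G : ℕ → E → ℝ := fun k z =>
    C * (|b z| ^ (p / (p - 1)) + mollify μ (k + m) (fun y => |D y| ^ p) z)
  have hGi : ∀ k, Integrable (G k) μ := fun k =>
    (hbp.add (integrable_mollify _ hDp)).const_mul C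
  have hmeas : ∀ k, AEStronglyMeasurable (fun z => b z * mollify μ (k + m) D z * Fk k z) μ :=
    fun k => (hb.mul (integrable_mollify _ hD).1).mul (hFk k)
  have hbound : ∀ k z, |b z * mollify μ (k + m) D z * Fk k z| ≤ G k z := by
    intro k z
    have h1 := mul_le_weighted_young hp (abs_nonneg (b z)) (abs_nonneg (mollify μ (k + m) D z))
      one_pos
    have h2 := abs_mollify_rpow_le hp (k + m) hD hDp z
    rw [abs_mul, abs_mul]
    have h3 : |b z| * |mollify μ (k + m) D z| ≤
        |b z| ^ (p / (p - 1)) + mollify μ (k + m) (fun y => |D y| ^ p) z := by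
      simp only [Real.one_rpow, one_mul] at h1
      linarith
    calc _ ≤ (|b z| ^ (p / (p - 1)) + mollify μ (k + m) (fun y => |D y| ^ p) z) * C :=
          mul_le_mul h3 (hFC k z) (abs_nonneg _) ((by positivity : (0:ℝ) ≤ |b z| * _).trans h3)
      _ = G k z := mul_comm _ _
  refine ⟨fun k => (hGi k).mono' (hmeas k) (Eventually.of_forall (hbound k)), ?_⟩
  refine tendsto_integral_of_convergent_majorants hmeas hGi
    (g := fun z => C * (|b z| ^ (p / (p - 1)) + |D z| ^ p)) ((hbp.add hDp).const_mul C)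
    (fun k => Eventually.of_forall (hbound k)) ?_ ?_ ?_
  · filter_upwards [hlim, ae_tendsto_mollify hD] with z h1 h2
    exact (tendsto_const_nhds.mul (h2.comp (tendsto_add_atTop_nat m))).mul h1
  · filter_upwards [ae_tendsto_mollify hDp] with z h2
    exact (tendsto_const_nhds.add (h2.comp (tendsto_add_atTop_nat m))).const_mul C
  · refine tendsto_const_nhds.congr fun k => ?_
    simp only [G]
    rw [integral_const_mul, integral_const_mul, integral_add hbp hDp,
      integral_add hbp (integrable_mollify _ hDp), integral_mollify _ hDp]

/-- The L¹ counterpart for the time derivative: D is merely integrable, so b must be bounded. -/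
theorem tendsto_integral_mul_mollify_mul {b D F : E → ℝ} {Fk : ℕ → E → ℝ} {C C' : ℝ} (m : ℕ)
    (hb : AEStronglyMeasurable b μ) (hbC : ∀ z, |b z| ≤ C') (hD : Integrable D μ)
    (hFk : ∀ k, AEStronglyMeasurable (Fk k) μ) (hFC : ∀ k z, |Fk k z| ≤ C)
    (hlim : ∀ᵐ z ∂μ, Tendsto (fun k => Fk k z) atTop (𝓝 (F z))) :
    Tendsto (fun k => ∫ z, b z * mollify μ (k + m) D z * Fk k z ∂μ) atTop
      (𝓝 (∫ z, b z * D z * F z ∂μ)) := by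
  have hDa := hD.abs
  refine tendsto_integral_of_convergent_majorants
    (G := fun k z => C' * mollify μ (k + m) (fun y => |D y|) z * C)
    (fun k => (hb.mul (integrable_mollify _ hD).1).mul (hFk k))
    (fun k => ((integrable_mollify _ hDa).const_mul C').mul_const C)
    (g := fun z => C' * |D z| * C) ((hDa.const_mul C').mul_const C)
    (fun k => Eventually.of_forall fun z => ?_) ?_ ?_ ?_
  · rw [abs_mul, abs_mul]
    have h1 := hbC z
    have h2 := hFC k z
    have h3 := abs_mollify_le (μ := μ) (k + m) D z
    have h4 : 0 ≤ C' := (abs_nonneg _).trans h1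
    have h5 := (abs_nonneg _).trans h3
    gcongr
  · filter_upwards [hlim, ae_tendsto_mollify hD] with z h1 h2
    exact (tendsto_const_nhds.mul (h2.comp (tendsto_add_atTop_nat m))).mul h1
  · filter_upwards [ae_tendsto_mollify hDa] with z h2
    exact ((h2.comp (tendsto_add_atTop_nat m)).const_mul C').mul_const C
  · refine tendsto_const_nhds.congr fun k => ?_
    rw [integral_mul_const, integral_mul_const, integral_const_mul, integral_const_mul,
      integral_mollify _ hDa]

/-- The energy estimate obtained by testing with `(w + ε) ^ (-ν) * ζ`. -/
theorem energy_estimate {ι : Type*} [Fintype ι] {p : ℝ} (hp : 1 < p) {Ω : Opens E} {τ : E}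
    {e : ι → E} {w wt f : E → ℝ} {B D : ι → E → ℝ} (hw0 : ∀ z, 0 ≤ w z)
    (hw : LocallyIntegrableOn w Ω μ) (hwt : LocallyIntegrableOn wt Ω μ)
    (hf : LocallyIntegrableOn f Ω μ)
    (hB : ∀ i, LocallyIntegrableOn (B i) Ω μ)
    (hBp : ∀ i, LocallyIntegrableOn (fun z => |B i z| ^ (p / (p - 1))) Ω μ)
    (hD : ∀ i, LocallyIntegrableOn (D i) Ω μ)
    (hDp : ∀ i, LocallyIntegrableOn (fun z => |D i z| ^ p) Ω μ)
    (hwτ : HasWeakDirDeriv μ Ω τ w wt) (hwe : ∀ i, HasWeakDirDeriv μ Ω (e i) w (D i))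
    (hineq : ∀ φ : 𝓓(Ω, ℝ), (∀ z, 0 ≤ φ z) →
      0 ≤ ∫ z in (Ω : Set E), (wt z * φ z + ∑ i, B i z * fderiv ℝ φ z (e i) - f z * φ z) ∂μ)
    {ν ε : ℝ} (hν : 0 < ν) (hν1 : ν < 1) (hε : 0 < ε) (ζ : 𝓓(Ω, ℝ)) (hζ : ∀ z, 0 ≤ ζ z) :
    ∫ z in (Ω : Set E), f z * ((w z + ε) ^ (-ν) * ζ z) ∂μ +
      ν * ∫ z in (Ω : Set E), (∑ i, B i z * D i z) * ((w z + ε) ^ (-ν - 1) * ζ z) ∂μ ≤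
    -(1 / (1 - ν)) * ∫ z in (Ω : Set E), (w z + ε) ^ (1 - ν) * fderiv ℝ ζ z τ ∂μ +
      ∫ z in (Ω : Set E), (∑ i, B i z * fderiv ℝ ζ z (e i)) * (w z + ε) ^ (-ν) ∂μ := by
  set K := tsupport ζ with hKdef
  have hK : IsCompact K := ζ.hasCompactSupport
  have hKΩ : K ⊆ Ω := ζ.tsupport_subset
  -- A margin around the support of ζ: with kernels of radius at most δ, mollified values there
  -- depend only on the compact set K' inside Ω.
  obtain ⟨δ, hδ, hδΩ⟩ := hK.exists_cthickening_subset_open Ω.isOpen hKΩ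
  set K' := Metric.cthickening δ K with hK'def
  have hK' : IsCompact K' := hK.cthickening
  have hKK' : K ⊆ K' := Metric.self_subset_cthickening K
  have hK'm : MeasurableSet K' := hK'.measurableSet
  obtain ⟨m, hm⟩ : ∃ m, ∀ k, (shrinkingBump E (k + m)).rOut ≤ δ := by
    have h := (tendsto_shrinkingBump_rOut E).eventually (gt_mem_nhds hδ)
    obtain ⟨m, hm⟩ := eventually_atTop.1 h
    exact ⟨m, fun k => (hm _ (Nat.le_add_left m k)).le⟩
  have hball : ∀ k, ∀ z ∈ K, Metric.closedBall z (shrinkingBump E (k + m)).rOut ⊆ K' :=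
    fun k z hz => (Metric.closedBall_subset_closedBall (hm k)).trans
      (Metric.closedBall_subset_cthickening hz δ)
  have ind : ∀ {g : E → ℝ}, LocallyIntegrableOn g Ω μ → Integrable (K'.indicator g) μ :=
    fun hg => (hg.integrableOn_compact_subset hδΩ hK').integrable_indicator hK'm
  set W := K'.indicator w with hWdef
  set WT := K'.indicator wt with hWTdef
  set DI : ι → E → ℝ := fun i => K'.indicator (D i) with hDIdef
  have hWi : Integrable W μ := ind hw
  have hWTi : Integrable WT μ := ind hwt
  have hDIi : ∀ i, Integrable (DI i) μ := fun i => ind (hD i)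
  have indp : ∀ {g : E → ℝ} {r : ℝ}, 0 < r → LocallyIntegrableOn (fun z => |g z| ^ r) Ω μ →
      Integrable (fun z => |K'.indicator g z| ^ r) μ := by
    intro g r hr hg
    convert ind hg using 1
    ext z
    by_cases hz : z ∈ K'
    · simp [hz]
    · simp [hz, Real.zero_rpow hr.ne']
  have hp0 : 0 < p := by linarith
  have hp1 : 0 < p / (p - 1) := div_pos hp0 (by linarith)
  have hW0 : ∀ z, 0 ≤ W z := fun z => Set.indicator_nonneg (fun z _ => hw0 z) z
  set wk : ℕ → E → ℝ := fun k => mollify μ (k + m) W with hwkdef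
  have hwk0 : ∀ k z, 0 ≤ wk k z := fun k => mollify_nonneg _ hW0
  have hwkd : ∀ k, ContDiff ℝ (⊤ : ℕ∞) (wk k) := fun k => contDiff_mollify _ hWi
  have hwkτ : ∀ k, ∀ z ∈ K, fderiv ℝ (wk k) z τ = mollify μ (k + m) WT z := fun k z hz =>
    hwτ.fderiv_mollify hK'm hδΩ (hw.integrableOn_compact_subset hδΩ hK') _ (hball k z hz)
  have hwke : ∀ k i, ∀ z ∈ K, fderiv ℝ (wk k) z (e i) = mollify μ (k + m) (DI i) z :=
    fun k i z hz => (hwe i).fderiv_mollify hK'm hδΩ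
      (hw.integrableOn_compact_subset hδΩ hK') _ (hball k z hz)
  have hpos : ∀ k z, 0 < wk k z + ε := fun k z => by linarith [hwk0 k z]
  have hpow : ∀ k (r : ℝ), ContDiff ℝ (⊤ : ℕ∞) (fun z => (wk k z + ε) ^ r) := fun k r =>
    ((hwkd k).add contDiff_const).rpow_const_of_ne fun z => (hpos k z).ne'
  have hpow' : ∀ k (r : ℝ) z v, fderiv ℝ (fun z => (wk k z + ε) ^ r) z v =
      r * (wk k z + ε) ^ (r - 1) * fderiv ℝ (wk k) z v := by
    intro k r z v
    have h1 : HasFDerivAt (fun z => wk k z + ε) (fderiv ℝ (wk k) z) z :=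
      ((hwkd k).differentiable (by simp) z).hasFDerivAt.add_const ε
    rw [(h1.rpow_const (Or.inl (hpos k z).ne')).fderiv]
    simp
  have hζd : ContDiff ℝ (⊤ : ℕ∞) ζ := ζ.contDiff
  have hζ0 : ∀ z ∉ K, ζ z = 0 := fun z hz => image_eq_zero_of_notMem_tsupport hz
  have hζ1 : ∀ z ∉ K, fderiv ℝ ζ z = 0 := fun z hz => fderiv_of_notMem_tsupport (𝕜 := ℝ) hz
  obtain ⟨Cζ, hCζ⟩ := ζ.continuous.bounded_above_of_compact_support ζ.hasCompactSupport
  have hζ'c : Continuous (fderiv ℝ ζ) := hζd.continuous_fderiv (by simp)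
  have hζ's : HasCompactSupport (fderiv ℝ ζ) := ζ.hasCompactSupport.fderiv (𝕜 := ℝ)
  have hζvc : ∀ v, Continuous fun z => fderiv ℝ ζ z v := fun v => hζ'c.clm_apply continuous_const
  have hζvs : ∀ v, HasCompactSupport fun z => fderiv ℝ ζ z v := fun v =>
    hζ's.comp_left (g := fun L : E →L[ℝ] ℝ => L v) rfl
  -- Only w is mollified, and only inside the test function. Since `wk` ≥ 0 and ε > 0, the base of
  -- the negative power stays at least ε, so the product is smooth.
  let φ : ℕ → 𝓓(Ω, ℝ) := fun k =>
    { toFun := fun z => (wk k z + ε) ^ (-ν) * ζ z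
      contDiff' := (hpow k _).mul hζd
      hasCompactSupport' := ζ.hasCompactSupport.mul_left
      tsupport_subset' := (tsupport_mul_subset_right).trans hKΩ }
  have hφ : ∀ k z, φ k z = (wk k z + ε) ^ (-ν) * ζ z := fun k z => rfl
  have hφ' : ∀ k z v, fderiv ℝ (φ k) z v =
      -ν * ((wk k z + ε) ^ (-ν - 1) * ζ z) * fderiv ℝ (wk k) z v +
        (wk k z + ε) ^ (-ν) * fderiv ℝ ζ z v := by
    intro k z v
    have h1 : fderiv ℝ (φ k) z = fderiv ℝ (fun z => (wk k z + ε) ^ (-ν) * ζ z) z := rfl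
    rw [h1, fderiv_fun_mul ((hpow k (-ν)).differentiable (by simp) z)
      (hζd.differentiable (by simp) z)]
    simp only [add_apply, smul_apply, smul_eq_mul, hpow']
    ring
  -- limits of the powers
  have hwlim : ∀ᵐ z ∂μ, Tendsto (fun k => wk k z) atTop (𝓝 (W z)) := by
    filter_upwards [ae_tendsto_mollify hWi] with z hz
    exact hz.comp (tendsto_add_atTop_nat m)
  have hWpos : ∀ z, 0 < W z + ε := fun z => by linarith [hW0 z]
  have hplim : ∀ r : ℝ, ∀ᵐ z ∂μ, Tendsto (fun k => (wk k z + ε) ^ r) atTop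
      (𝓝 ((W z + ε) ^ r)) := by
    intro r
    filter_upwards [hwlim] with z hz
    exact (hz.add_const ε).rpow_const (Or.inl (hWpos z).ne')
  have hpbd : ∀ r : ℝ, r ≤ 0 → ∀ k z, |(wk k z + ε) ^ r| ≤ ε ^ r := by
    intro r hr k z
    rw [abs_of_nonneg (Real.rpow_nonneg (hpos k z).le _)]
    exact Real.rpow_le_rpow_of_nonpos hε (by linarith [hwk0 k z]) hr
  have hpm : ∀ (r : ℝ) k, AEStronglyMeasurable (fun z => (wk k z + ε) ^ r) μ := fun r k =>
    (hpow k r).continuous.aestronglyMeasurable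
  have toΩ : ∀ g : E → ℝ, (∀ z ∉ K, g z = 0) → ∫ z in (Ω : Set E), g z ∂μ = ∫ z, g z ∂μ :=
    fun g hg => setIntegral_eq_integral_of_forall_compl_eq_zero
      fun z hz => hg z fun hc => hz (hKΩ hc)
  have indK : ∀ (g : E → ℝ), ∀ z ∈ K, K'.indicator g z = g z := fun g z hz =>
    Set.indicator_of_mem (hKK' hz) g
  -- the part of the test inequality without derivatives of `w`
  set H : E → ℝ := fun z => K'.indicator wt z * ζ z +
    ∑ i, K'.indicator (B i) z * fderiv ℝ ζ z (e i) - K'.indicator f z * ζ z with hHdef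
  have mulζ : ∀ {g : E → ℝ}, Integrable g μ → Integrable (fun z => g z * ζ z) μ := fun hg =>
    hg.mul_bdd ζ.continuous.aestronglyMeasurable (Eventually.of_forall hCζ)
  have mulζv : ∀ {g : E → ℝ} v, Integrable g μ → Integrable (fun z => g z * fderiv ℝ ζ z v) μ := by
    intro g v hg
    obtain ⟨C, hC⟩ := (hζvc v).bounded_above_of_compact_support (hζvs v)
    exact hg.mul_bdd (hζvc v).aestronglyMeasurable (Eventually.of_forall hC)
  have hHwt := mulζ hWTi
  have hHB : Integrable (fun z => ∑ i, K'.indicator (B i) z * fderiv ℝ ζ z (e i)) μ :=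
    integrable_finsetSum _ fun i _ => mulζv (e i) (ind (hB i))
  have hHf := mulζ (ind hf)
  have hHi : Integrable H μ := (hHwt.add hHB).sub hHf
  have mulpk : ∀ {g : E → ℝ} k, Integrable g μ →
      Integrable (fun z => g z * (wk k z + ε) ^ (-ν)) μ := fun k hg =>
    hg.mul_bdd (hpm (-ν) k) (Eventually.of_forall (hpbd (-ν) (by linarith) k))
  have hWm : ∀ r : ℝ, AEStronglyMeasurable (fun z => (W z + ε) ^ r) μ := fun r =>
    ((hWi.1.aemeasurable.add_const ε).pow_const r).aestronglyMeasurable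
  have mulp : ∀ {g : E → ℝ}, Integrable g μ →
      Integrable (fun z => g z * (W z + ε) ^ (-ν)) μ := by
    intro g hg
    refine hg.mul_bdd (c := ε ^ (-ν)) (hWm _) (Eventually.of_forall fun z => ?_)
    rw [Real.norm_of_nonneg (Real.rpow_nonneg (hWpos z).le _)]
    exact Real.rpow_le_rpow_of_nonpos hε (by linarith [hW0 z]) (by linarith)
  have limp : ∀ {g : E → ℝ}, Integrable g μ →
      Tendsto (fun k => ∫ z, g z * (wk k z + ε) ^ (-ν) ∂μ) atTop
        (𝓝 (∫ z, g z * (W z + ε) ^ (-ν) ∂μ)) := by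
    intro g hg
    refine tendsto_integral_of_dominated_convergence (fun z => |g z| * ε ^ (-ν))
      (fun k => (mulpk k hg).1) (hg.abs.mul_const _) (fun k => Eventually.of_forall fun z => ?_) ?_
    · rw [norm_mul]
      exact mul_le_mul_of_nonneg_left (hpbd (-ν) (by linarith) k z) (norm_nonneg _)
    · filter_upwards [hplim (-ν)] with z hz
      exact hz.const_mul _
  -- the diffusion part
  have hBζp : ∀ i, Integrable (fun z => |K'.indicator (B i) z * ζ z| ^ (p / (p - 1))) μ := by
    intro i
    have h1 : Integrable (fun z => |K'.indicator (B i) z| ^ (p / (p - 1)) *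
        |ζ z| ^ (p / (p - 1))) μ := by
      refine (indp hp1 (hBp i)).mul_bdd (c := Cζ ^ (p / (p - 1)))
        (ζ.continuous.abs.rpow_const fun z => Or.inr hp1.le).aestronglyMeasurable
        (Eventually.of_forall fun z => ?_)
      rw [Real.norm_of_nonneg (by positivity)]
      exact Real.rpow_le_rpow (abs_nonneg _) (hCζ z) hp1.le
    refine h1.congr (Eventually.of_forall fun z => ?_)
    dsimp only
    rw [abs_mul, Real.mul_rpow (abs_nonneg _) (abs_nonneg _)]
  have hdiff := fun i => integrable_and_tendsto_mul_mollify_mul hp m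
    (mulζ (ind (hB i))).1 (hBζp i) (hDIi i) (indp hp0 (hDp i)) (hpm (-ν - 1))
    (hpbd (-ν - 1) (by linarith)) (hplim (-ν - 1))
  -- the test inequality for the regularized functions
  have htest : ∀ k, 0 ≤ ∫ z, H z * (wk k z + ε) ^ (-ν) ∂μ - ν * ∑ i, ∫ z,
      K'.indicator (B i) z * ζ z * mollify μ (k + m) (DI i) z * (wk k z + ε) ^ (-ν - 1) ∂μ := by
    intro k
    have h := hineq (φ k) fun z => mul_nonneg (Real.rpow_nonneg (hpos k z).le _) (hζ z)
    rw [toΩ] at h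
    · refine h.trans_eq ?_
      rw [← integral_finsetSum _ (fun i _ => (hdiff i).1 k), ← integral_const_mul,
        ← integral_sub (mulpk k hHi)
          ((integrable_finsetSum _ fun i _ => (hdiff i).1 k).const_mul ν)]
      congr 1 with z
      by_cases hz : z ∈ K
      · simp only [hHdef, hφ, hφ', indK _ z hz, hwke k _ z hz, Finset.mul_sum, sub_mul, add_mul,
          Finset.sum_mul, mul_add, Finset.sum_add_distrib]
        have : ∀ a b c d x y : ℝ, x = -y → a + (x + b) - c = a + b - c - y := by
          intros; subst_vars; ring
        rw [this _ _ _ 0 _ (∑ i, ν * (B i z * ζ z * mollify μ (k + m) (DI i) z *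
          (wk k z + ε) ^ (-ν - 1)))]
        · congr 1
          congr 1
          · congr 1
            · ring
            · exact Finset.sum_congr rfl fun i _ => by ring
          · ring
        · rw [← Finset.sum_neg_distrib]
          exact Finset.sum_congr rfl fun i _ => by ring
      · simp [hHdef, hφ, hφ', hζ0 z hz, hζ1 z hz]
    · intro z hz
      simp [hφ, hφ', hζ0 z hz, hζ1 z hz]
  have hlim := ge_of_tendsto' ((limp hHi).sub
    ((tendsto_finsetSum Finset.univ fun i _ => (hdiff i).2).const_mul ν)) htest
  -- the time part
  have htime : ∫ z, K'.indicator wt z * ζ z * (W z + ε) ^ (-ν) ∂μ =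
      -(1 / (1 - ν)) * ∫ z, (W z + ε) ^ (1 - ν) * fderiv ℝ ζ z τ ∂μ := by
    have h1 := tendsto_integral_mul_mollify_mul m ζ.continuous.aestronglyMeasurable hCζ hWTi
      (hpm (-ν)) (hpbd (-ν) (by linarith)) (hplim (-ν))
    -- No chain rule for the nonsmooth w is invoked: integration by parts is done for the smooth
    -- `wk`, and both sides converge separately.
    have hparts : ∀ k, ∫ z, ζ z * mollify μ (k + m) WT z * (wk k z + ε) ^ (-ν) ∂μ =
        -(1 / (1 - ν)) * ∫ z, (wk k z + ε) ^ (1 - ν) * fderiv ℝ ζ z τ ∂μ := by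
      intro k
      have hG := hpow k (1 - ν)
      have hG'c : Continuous fun z => fderiv ℝ (fun z => (wk k z + ε) ^ (1 - ν)) z τ :=
        (hG.continuous_fderiv (by simp)).clm_apply continuous_const
      have h := integral_mul_fderiv_eq_neg_fderiv_mul_of_integrable (μ := μ) (𝕜 := ℝ)
        (f := fun z => (wk k z + ε) ^ (1 - ν)) (g := ζ) (v := τ)
        ((hG'c.mul ζ.continuous).integrable_of_hasCompactSupport ζ.hasCompactSupport.mul_left)
        ((hG.continuous.mul (hζvc τ)).integrable_of_hasCompactSupport (hζvs τ).mul_left)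
        ((hG.continuous.mul ζ.continuous).integrable_of_hasCompactSupport
          ζ.hasCompactSupport.mul_left)
        (fun z _ => hG.differentiable (by simp) z) (fun z _ => hζd.differentiable (by simp) z)
      rw [h, neg_mul_neg, ← integral_const_mul]
      congr 1 with z
      by_cases hz : z ∈ K
      · rw [hpow', hwkτ k z hz]
        have h1ν : 1 - ν ≠ 0 := by linarith
        have e1 : 1 - ν - 1 = -ν := by ring
        rw [e1]; field_simp
      · simp [hζ0 z hz]
    have h2 : Tendsto (fun k => ∫ z, (wk k z + ε) ^ (1 - ν) * fderiv ℝ ζ z τ ∂μ) atTop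
        (𝓝 (∫ z, (W z + ε) ^ (1 - ν) * fderiv ℝ ζ z τ ∂μ)) := by
      obtain ⟨C, hC⟩ := (hζvc τ).bounded_above_of_compact_support (hζvs τ)
      have hζi : Integrable (fun z => fderiv ℝ ζ z τ) μ :=
        (hζvc τ).integrable_of_hasCompactSupport (hζvs τ)
      -- Since 0 < 1 - ν < 1 the power is at most `wk + ε + 1`, so a majorant linear in `wk`
      -- suffices.
      refine tendsto_integral_of_convergent_majorants
        (G := fun k z => C * wk k z + (ε + 1) * |fderiv ℝ ζ z τ|)
        (g := fun z => C * W z + (ε + 1) * |fderiv ℝ ζ z τ|)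
        (fun k => (hpm _ k).mul (hζvc τ).aestronglyMeasurable)
        (fun k => ((integrable_mollify _ hWi).const_mul C).add (hζi.abs.const_mul _))
        ((hWi.const_mul C).add (hζi.abs.const_mul _))
        (fun k => Eventually.of_forall fun z => ?_) ?_ ?_ ?_
      · have h3 : (wk k z + ε) ^ (1 - ν) ≤ wk k z + ε + 1 := by
          rcases le_total (wk k z + ε) 1 with h | h
          · have := Real.rpow_le_one (hpos k z).le h (by linarith : 0 ≤ 1 - ν)
            linarith [hpos k z]
          · have := Real.rpow_le_rpow_of_exponent_le h (by linarith : 1 - ν ≤ 1)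
            rw [Real.rpow_one] at this
            linarith
        rw [abs_mul, abs_of_nonneg (Real.rpow_nonneg (hpos k z).le _)]
        have h4 : |fderiv ℝ ζ z τ| ≤ C := hC z
        nlinarith [mul_le_mul_of_nonneg_right h3 (abs_nonneg (fderiv ℝ ζ z τ)),
          mul_le_mul_of_nonneg_left h4 (hwk0 k z)]
      · filter_upwards [hplim (1 - ν)] with z hz
        exact hz.mul_const _
      · filter_upwards [hwlim] with z hz
        exact (hz.const_mul C).add_const _
      · refine tendsto_const_nhds.congr fun k => ?_
        rw [integral_add (hWi.const_mul C) (hζi.abs.const_mul _),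
          integral_add ((integrable_mollify _ hWi).const_mul C) (hζi.abs.const_mul _),
          integral_const_mul, integral_const_mul]
        rw [integral_const_mul, integral_mollify _ hWi]
    have h3 := tendsto_nhds_unique h1 ((h2.const_mul (-(1 / (1 - ν)))).congr fun k => (hparts k).symm)
    rw [← h3]
    congr 1 with z
    ring
  have hsplit : ∫ z, H z * (W z + ε) ^ (-ν) ∂μ =
      ∫ z, K'.indicator wt z * ζ z * (W z + ε) ^ (-ν) ∂μ +
      ∫ z, (∑ i, K'.indicator (B i) z * fderiv ℝ ζ z (e i)) * (W z + ε) ^ (-ν) ∂μ -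
      ∫ z, K'.indicator f z * ζ z * (W z + ε) ^ (-ν) ∂μ := by
    have h := integral_sub ((mulp hHwt).add (mulp hHB)) (mulp hHf)
    simp only [Pi.add_apply] at h
    rw [integral_add (mulp hHwt) (mulp hHB)] at h
    rw [← h]
    congr 1 with z
    simp only [hHdef, hWTdef]; ring
  rw [hsplit, htime] at hlim
  have hWK : ∀ z ∈ K, W z = w z := fun z hz => indK w z hz
  have hfin : ∀ i, Integrable (fun z => K'.indicator (B i) z * ζ z * DI i z *
      (W z + ε) ^ (-ν - 1)) μ := by
    intro i
    have h1 : Integrable (fun z => K'.indicator (B i) z * ζ z * DI i z) μ := by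
      refine ((hBζp i).add (indp hp0 (hDp i))).mono' ((mulζ (ind (hB i))).1.mul (hDIi i).1)
        (Eventually.of_forall fun z => ?_)
      have h1 := mul_le_weighted_young hp (abs_nonneg (K'.indicator (B i) z * ζ z))
        (abs_nonneg (DI i z)) one_pos
      simp only [Real.one_rpow, one_mul] at h1
      rw [Real.norm_eq_abs, abs_mul]
      exact h1
    refine h1.mul_bdd (c := ε ^ (-ν - 1)) (hWm _) (Eventually.of_forall fun z => ?_)
    rw [Real.norm_of_nonneg (Real.rpow_nonneg (hWpos z).le _)]
    exact Real.rpow_le_rpow_of_nonpos hε (by linarith [hW0 z]) (by linarith)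
  rw [toΩ _ (fun z hz => by simp [hζ0 z hz]), toΩ _ (fun z hz => by simp [hζ0 z hz]),
    toΩ _ (fun z hz => by simp [hζ1 z hz]), toΩ _ (fun z hz => by simp [hζ1 z hz])]
  have c1 : ∫ z, f z * ((w z + ε) ^ (-ν) * ζ z) ∂μ =
      ∫ z, K'.indicator f z * ζ z * (W z + ε) ^ (-ν) ∂μ := by
    congr 1 with z
    by_cases hz : z ∈ K
    · rw [indK _ z hz, hWK z hz]; ring
    · simp [hζ0 z hz]
  have c2 : ∫ z, (∑ i, B i z * D i z) * ((w z + ε) ^ (-ν - 1) * ζ z) ∂μ =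
      ∑ i, ∫ z, K'.indicator (B i) z * ζ z * DI i z * (W z + ε) ^ (-ν - 1) ∂μ := by
    rw [← integral_finsetSum _ fun i _ => hfin i]
    congr 1 with z
    by_cases hz : z ∈ K
    · simp only [hDIdef, indK _ z hz, hWK z hz, Finset.sum_mul]
      exact Finset.sum_congr rfl fun i _ => by ring
    · simp [hζ0 z hz]
  have c3 : ∫ z, (w z + ε) ^ (1 - ν) * fderiv ℝ ζ z τ ∂μ =
      ∫ z, (W z + ε) ^ (1 - ν) * fderiv ℝ ζ z τ ∂μ := by
    congr 1 with z
    by_cases hz : z ∈ K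
    · rw [hWK z hz]
    · simp [hζ1 z hz]
  have c4 : ∫ z, (∑ i, B i z * fderiv ℝ ζ z (e i)) * (w z + ε) ^ (-ν) ∂μ =
      ∫ z, (∑ i, K'.indicator (B i) z * fderiv ℝ ζ z (e i)) * (W z + ε) ^ (-ν) ∂μ := by
    congr 1 with z
    by_cases hz : z ∈ K
    · simp only [indK _ z hz, hWK z hz]
    · simp [hζ1 z hz]
  rw [c1, c2, c3, c4]
  linarith

end Energy

/-! ### Pointwise absorption of the error terms -/

/-- Young's inequality for the product of a flux and the gradient of a cutoff function. -/
theorem flux_mul_cutoff_le {p ν s σ W x b y : ℝ} (hp : 1 < p) (hs : p < s) (hσ : 0 < σ)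
    (hW : 0 < W) (hx : 0 ≤ x) (hb : 0 ≤ b) (hy : 0 ≤ y) :
    b * y * x ^ (s - 1) ≤ σ * (b ^ (p / (p - 1)) * (W ^ (-ν - 1) * x ^ s)) +
      σ ^ (1 - p) * y ^ p * W ^ ((1 + ν) * (p - 1)) * x ^ (s - p) := by
  rcases eq_or_lt_of_le hx with h0 | h0
  · rw [← h0, Real.zero_rpow (by linarith), mul_zero]
    positivity
  · have h := mul_le_weighted_young hp hb hy (α := σ * W ^ (-ν - 1) * x) (by positivity)
    have h1 := mul_le_mul_of_nonneg_right h (Real.rpow_nonneg hx (s - 1))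
    have e1 : x ^ s = x * x ^ (s - 1) := by
      rw [← Real.rpow_one_add' hx (by linarith)]; ring_nf
    have e2 : x ^ (s - p) = x ^ (1 - p) * x ^ (s - 1) := by
      rw [← Real.rpow_add h0]; ring_nf
    have e3 : (σ * W ^ (-ν - 1) * x) ^ (1 - p) =
        σ ^ (1 - p) * W ^ ((1 + ν) * (p - 1)) * x ^ (1 - p) := by
      rw [Real.mul_rpow (by positivity) hx, Real.mul_rpow hσ.le (by positivity),
        ← Real.rpow_mul hW.le]
      ring_nf
    rw [e3] at h1
    rw [e1, e2]
    linarith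

theorem add_rpow_mul_cutoff_le {q x w ε s : ℝ} (hq : 0 ≤ q) (hs : 0 ≤ s) (hw : 0 ≤ w)
    (hε : 0 ≤ ε) (hx : 0 ≤ x) (hx1 : x ≤ 1) :
    (w + ε) ^ q * x ^ s ≤ 2 ^ q * (w ^ q * x ^ s) + 2 ^ q * ε ^ q := by
  have h1 := add_rpow_le_two_rpow_mul hq hw hε
  have hxs := Real.rpow_nonneg hx s
  have hxs1 : x ^ s ≤ 1 := Real.rpow_le_one hx hx1 hs
  have hεq : 0 ≤ 2 ^ q * ε ^ q := by positivity
  nlinarith [mul_le_mul_of_nonneg_right h1 hxs, mul_le_mul_of_nonneg_left hxs1 hεq]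

/-- Absorption of the error terms of the energy estimate. -/
theorem exists_energy_absorption {p q ν s c C₁ : ℝ} (hp : 1 < p) (hq : 1 < q)
    (hpq : p - 1 < q) (hν : 0 < ν) (hνp : ν ≤ p - 1) (hν1 : ν < 1) (hps : p < s)
    (hs1 : 1 * (q - ν) / (q - ν - (1 - ν)) ≤ s)
    (hs2 : p * (q - ν) / (q - ν - (p - 1 - ν)) ≤ s) (hc : 0 < c) (hC₁ : 0 ≤ C₁) :
    ∃ C : ℝ, 0 ≤ C ∧ ∀ w b X x lam ε : ℝ, 0 ≤ w → 0 ≤ b → c * b ^ (p / (p - 1)) ≤ X →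
      0 ≤ x → x ≤ 1 → 0 < ε → ε ≤ lam →
      C₁ * lam ^ (q - 1) * (w + ε) ^ (1 - ν) * x ^ (s - 1) +
        C₁ * b * lam ^ ((q - p + 1) / p) * (w + ε) ^ (-ν) * x ^ (s - 1) ≤
      c * w ^ q * (w + ε) ^ (-ν) * x ^ s + ν / 2 * (X * (w + ε) ^ (-ν - 1) * x ^ s) +
        C * lam ^ (q - ν) := by
  have hp0 : 0 < p := by linarith
  -- With this σ the flux consumes half of the gradient energy, since c b^(p/(p-1)) ≤ X.
  set σ := c * ν / 2 with hσdef
  have hσ : 0 < σ := by positivity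
  set k₁ := C₁ with hk₁
  set k₂ := σ ^ (1 - p) * C₁ ^ p with hk₂
  have hk₂0 : 0 ≤ k₂ := by positivity
  -- Small enough that both interpolated powers fit into the reaction term; 2^(-q) pays for
  -- splitting (w+ε)^q into w^q and ε^q.
  set η := c * 2 ^ (-q) / (k₁ + k₂ + 1) with hηdef
  have hη : 0 < η := by positivity
  -- The first two summands are the interpolation remainders; the final c pays for ε^q (w+ε)^(-ν) ≤
  -- λ^(q-ν), which uses ε ≤ λ.
  set C := k₁ * η ^ (-((1 - ν) / (q - ν - (1 - ν)))) +
    k₂ * η ^ (-((p - 1 - ν) / (q - ν - (p - 1 - ν)))) + c with hCdef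
  refine ⟨C, by positivity, fun w b X x lam ε hw hb hX hx hx1 hε hεl => ?_⟩
  have hlam : 0 < lam := hε.trans_le hεl
  have hW : 0 < w + ε := by linarith
  have hxs := Real.rpow_nonneg hx s
  have hxs1 : x ^ s ≤ 1 := Real.rpow_le_one hx hx1 (by linarith)
  have t1 := interpolation_cutoff (a := 1 - ν) (b := q - ν) (k := 1) (s := s) (by linarith)
    (by linarith) one_pos hs1 hη hW.le hlam hx hx1
  have t2 := interpolation_cutoff (a := p - 1 - ν) (b := q - ν) (k := p) (s := s) (by linarith)
    (by linarith) hp0 hs2 hη hW.le hlam hx hx1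
  have y := flux_mul_cutoff_le (ν := ν) hp hps hσ hW hx hb
    (y := C₁ * lam ^ ((q - p + 1) / p) * (w + ε) ^ (-ν)) (by positivity)
  -- The exponents combine as -νp + (1+ν)(p-1) = p-1-ν, which is non-negative by the bound on ν.
  have ey : σ ^ (1 - p) * (C₁ * lam ^ ((q - p + 1) / p) * (w + ε) ^ (-ν)) ^ p *
      (w + ε) ^ ((1 + ν) * (p - 1)) * x ^ (s - p) =
      k₂ * (lam ^ (q - ν - (p - 1 - ν)) * (w + ε) ^ (p - 1 - ν) * x ^ (s - p)) := by
    rw [Real.mul_rpow (by positivity) (by positivity), Real.mul_rpow hC₁ (by positivity),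
      ← Real.rpow_mul hlam.le, ← Real.rpow_mul hW.le, div_mul_cancel₀ _ hp0.ne']
    have e : (w + ε) ^ (p - 1 - ν) = (w + ε) ^ (-ν * p) * (w + ε) ^ ((1 + ν) * (p - 1)) := by
      rw [← Real.rpow_add hW]; ring_nf
    have e' : q - ν - (p - 1 - ν) = q - p + 1 := by ring
    rw [e, e', hk₂]; ring
  rw [ey] at y
  have e1 : q - ν - (1 - ν) = q - 1 := by ring
  rw [e1] at t1
  have hXb : σ * (b ^ (p / (p - 1)) * ((w + ε) ^ (-ν - 1) * x ^ s)) ≤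
      ν / 2 * (X * (w + ε) ^ (-ν - 1) * x ^ s) := by
    have h := mul_le_mul_of_nonneg_right hX
      (by positivity : 0 ≤ ν / 2 * ((w + ε) ^ (-ν - 1) * x ^ s))
    rw [hσdef]; linarith
  have hWq : (w + ε) ^ (q - ν) = (w + ε) ^ q * (w + ε) ^ (-ν) := by
    rw [← Real.rpow_add hW]; ring_nf
  have hlq : lam ^ (q - ν) = lam ^ q * lam ^ (-ν) := by
    rw [← Real.rpow_add hlam]; ring_nf
  have hεν : ε ^ q * (w + ε) ^ (-ν) ≤ lam ^ (q - ν) := by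
    calc ε ^ q * (w + ε) ^ (-ν) ≤ ε ^ q * ε ^ (-ν) := by
          gcongr ?_ * ?_
          exact Real.rpow_le_rpow_of_nonpos hε (by linarith) (by linarith)
      _ = ε ^ (q - ν) := by rw [← Real.rpow_add hε]; ring_nf
      _ ≤ lam ^ (q - ν) := by
          apply Real.rpow_le_rpow hε.le hεl; linarith
  have habs : (k₁ + k₂) * (η * ((w + ε) ^ (q - ν) * x ^ s)) ≤
      c * w ^ q * (w + ε) ^ (-ν) * x ^ s + c * lam ^ (q - ν) := by
    have h1 : (k₁ + k₂) * η ≤ c * 2 ^ (-q) := by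
      rw [hηdef, mul_div_assoc', div_le_iff₀ (by positivity)]
      have : 0 ≤ c * 2 ^ (-q) := by positivity
      nlinarith
    have h2 := add_rpow_le_two_rpow_mul (by linarith : 0 ≤ q) hw hε.le
    have h3 : (2 : ℝ) ^ (-q) * 2 ^ q = 1 := by
      rw [← Real.rpow_add (by norm_num)]; simp
    have hZ : 0 ≤ (w + ε) ^ (-ν) * x ^ s := by positivity
    calc (k₁ + k₂) * (η * ((w + ε) ^ (q - ν) * x ^ s))
        = ((k₁ + k₂) * η) * ((w + ε) ^ (q - ν) * x ^ s) := by ring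
      _ ≤ c * 2 ^ (-q) * ((w + ε) ^ (q - ν) * x ^ s) := by gcongr
      _ = c * 2 ^ (-q) * (w + ε) ^ q * ((w + ε) ^ (-ν) * x ^ s) := by rw [hWq]; ring
      _ ≤ c * 2 ^ (-q) * (2 ^ q * (w ^ q + ε ^ q)) * ((w + ε) ^ (-ν) * x ^ s) := by gcongr
      _ = c * (2 ^ (-q) * 2 ^ q) * (w ^ q * (w + ε) ^ (-ν) * x ^ s) +
          c * (2 ^ (-q) * 2 ^ q) * ((ε ^ q * (w + ε) ^ (-ν)) * x ^ s) := by ring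
      _ ≤ c * (2 ^ (-q) * 2 ^ q) * (w ^ q * (w + ε) ^ (-ν) * x ^ s) +
          c * (2 ^ (-q) * 2 ^ q) * (lam ^ (q - ν) * 1) := by gcongr
      _ = _ := by rw [h3]; ring
  have t1' := mul_le_mul_of_nonneg_left t1 hC₁
  have t2' := mul_le_mul_of_nonneg_left t2 hk₂0
  rw [hCdef, e1]
  linarith

/-- Common core of the two absorption lemmas that follow. Young's inequality charges the flux to the
gradient energy with weight λ^ν, the weight at which that energy is of order λ^q times the volume.
What remains are the powers 1 and (1+ν)(p-1) of w + ε, ready for interpolation against w^q. Here ε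
is not yet tied to λ. -/
theorem exists_cutoff_absorption {p q ν s c C₁ η : ℝ} (hp : 1 < p) (hps : p < s) (hc : 0 < c)
    (hC₁ : 0 ≤ C₁) (hη : 0 < η) :
    ∃ C : ℝ, 0 ≤ C ∧ ∀ w b X x lam ε : ℝ, 0 ≤ w → 0 ≤ b → c * b ^ (p / (p - 1)) ≤ X →
      0 ≤ x → x ≤ 1 → 0 < ε → 0 < lam →
      C₁ * lam ^ (q - 1) * w * x ^ (s - 1) +
        C₁ * b * lam ^ ((q - p + 1) / p) * x ^ (s - 1) ≤
      η * lam ^ ν * (X * (w + ε) ^ (-ν - 1) * x ^ s) +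
        C * (lam ^ (q - 1) * (w + ε) ^ (1 : ℝ) * x ^ (s - 1)) +
        C * (lam ^ (q - (1 + ν) * (p - 1)) * (w + ε) ^ ((1 + ν) * (p - 1)) * x ^ (s - p)) := by
  have hp0 : 0 < p := by linarith
  set C := C₁ + (η * c) ^ (1 - p) * C₁ ^ p with hCdef
  have hCC : 0 ≤ (η * c) ^ (1 - p) * C₁ ^ p := by positivity
  refine ⟨C, by positivity, fun w b X x lam ε hw hb hX hx hx1 hε hlam => ?_⟩
  have hW : 0 < w + ε := by linarith
  have y := flux_mul_cutoff_le (ν := ν) hp hps (σ := η * c * lam ^ ν) (by positivity) hW hx hb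
    (y := C₁ * lam ^ ((q - p + 1) / p)) (by positivity)
  have ey : (η * c * lam ^ ν) ^ (1 - p) * (C₁ * lam ^ ((q - p + 1) / p)) ^ p *
      (w + ε) ^ ((1 + ν) * (p - 1)) * x ^ (s - p) = ((η * c) ^ (1 - p) * C₁ ^ p) *
      (lam ^ (q - (1 + ν) * (p - 1)) * (w + ε) ^ ((1 + ν) * (p - 1)) * x ^ (s - p)) := by
    rw [Real.mul_rpow (by positivity) (by positivity), Real.mul_rpow hC₁ (by positivity),
      ← Real.rpow_mul hlam.le, ← Real.rpow_mul hlam.le, div_mul_cancel₀ _ hp0.ne']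
    have e : lam ^ (q - (1 + ν) * (p - 1)) = lam ^ (ν * (1 - p)) * lam ^ (q - p + 1) := by
      rw [← Real.rpow_add hlam]; ring_nf
    rw [e]; ring
  rw [ey] at y
  have hXb : η * c * lam ^ ν * (b ^ (p / (p - 1)) * ((w + ε) ^ (-ν - 1) * x ^ s)) ≤
      η * lam ^ ν * (X * (w + ε) ^ (-ν - 1) * x ^ s) := by
    have h := mul_le_mul_of_nonneg_right hX
      (by positivity : 0 ≤ η * lam ^ ν * ((w + ε) ^ (-ν - 1) * x ^ s))
    linarith
  have h1 : C₁ * lam ^ (q - 1) * w * x ^ (s - 1) ≤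
      C₁ * (lam ^ (q - 1) * (w + ε) ^ (1 : ℝ) * x ^ (s - 1)) := by
    rw [Real.rpow_one, ← mul_assoc, ← mul_assoc]
    gcongr
    linarith
  have hT1 : 0 ≤ lam ^ (q - 1) * (w + ε) ^ (1 : ℝ) * x ^ (s - 1) := by positivity
  have hT2 : 0 ≤ lam ^ (q - (1 + ν) * (p - 1)) * (w + ε) ^ ((1 + ν) * (p - 1)) * x ^ (s - p) := by
    positivity
  rw [hCdef]
  nlinarith [mul_nonneg hC₁ hT2, mul_nonneg hCC hT1]

/-- The error terms are absorbed up to a small multiple of the reaction term. -/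
theorem exists_cutoff_absorption_reaction {p q ν s c C₁ : ℝ} (hp : 1 < p) (hq : 1 < q)
    (hν : 0 < ν) (hνq : (1 + ν) * (p - 1) < q) (hps : p < s) (hs1 : 1 * q / (q - 1) ≤ s)
    (hs2 : p * q / (q - (1 + ν) * (p - 1)) ≤ s) (hc : 0 < c) (hC₁ : 0 ≤ C₁) :
    ∃ M : ℝ, 0 ≤ M ∧ ∀ w b X x lam : ℝ, 0 ≤ w → 0 ≤ b → c * b ^ (p / (p - 1)) ≤ X →
      0 ≤ x → x ≤ 1 → 0 < lam →
      C₁ * lam ^ (q - 1) * w * x ^ (s - 1) +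
        C₁ * b * lam ^ ((q - p + 1) / p) * x ^ (s - 1) ≤
      lam ^ ν * (X * (w + lam) ^ (-ν - 1) * x ^ s) + c / 2 * (w ^ q * x ^ s) + M * lam ^ q := by
  obtain ⟨C, hC, h⟩ := exists_cutoff_absorption (q := q) (ν := ν) (η := 1) hp hps hc hC₁ one_pos
  set a := (1 + ν) * (p - 1)
  have ha : 0 ≤ a := mul_nonneg (by linarith) (by linarith)
  -- Chosen so that 2Cσ 2^q ≤ c/2: two interpolations and one splitting of (w+λ)^q cost half of the
  -- reaction term.
  set σ := c / (4 * (C + 1) * 2 ^ q) with hσdef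
  have hσ : 0 < σ := by positivity
  refine ⟨C * σ ^ (-(1 / (q - 1))) + C * σ ^ (-(a / (q - a))) + c / 2, by positivity,
    fun w b X x lam hw hb hX hx hx1 hlam => ?_⟩
  have h0 := h w b X x lam lam hw hb hX hx hx1 hlam hlam
  have hW : 0 ≤ w + lam := by linarith
  have t1 := mul_le_mul_of_nonneg_left (interpolation_cutoff (a := 1) (b := q) (k := 1) (s := s)
    (by linarith) hq one_pos hs1 hσ hW hlam hx hx1) hC
  have t2 := mul_le_mul_of_nonneg_left (interpolation_cutoff (a := a) (b := q) (k := p) (s := s)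
    ha hνq (by linarith) hs2 hσ hW hlam hx hx1) hC
  have h2 := add_rpow_mul_cutoff_le (by linarith : 0 ≤ q) (by linarith : 0 ≤ s) hw hlam.le hx hx1
  have h3 : 2 * C * σ * ((w + lam) ^ q * x ^ s) ≤ c / 2 * (w ^ q * x ^ s) + c / 2 * lam ^ q := by
    have h4 : 2 * C * σ * 2 ^ q ≤ c / 2 := by
      rw [hσdef]
      have : (0 : ℝ) < 2 ^ q := by positivity
      rw [show 2 * C * (c / (4 * (C + 1) * 2 ^ q)) * 2 ^ q = c / 2 * (C / (C + 1)) by field_simp; ring]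
      have : C / (C + 1) ≤ 1 := by rw [div_le_one (by positivity)]; linarith
      nlinarith
    have h5 : 0 ≤ w ^ q * x ^ s := by positivity
    have h6 : 0 ≤ lam ^ q := by positivity
    nlinarith [mul_le_mul_of_nonneg_left h2 (by positivity : 0 ≤ 2 * C * σ),
      mul_le_mul_of_nonneg_right h4 h5, mul_le_mul_of_nonneg_right h4 h6]
  linarith

/-- The error terms are absorbed up to a small multiple of the scale. -/
theorem exists_cutoff_absorption_scale {p q ν s c C₁ η : ℝ} (hp : 1 < p) (hq : 1 < q)
    (hν : 0 < ν) (hνq : (1 + ν) * (p - 1) < q) (hps : p < s) (hs1 : 1 * q / (q - 1) ≤ s)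
    (hs2 : p * q / (q - (1 + ν) * (p - 1)) ≤ s) (hc : 0 < c) (hC₁ : 0 ≤ C₁) (hη : 0 < η) :
    ∃ M κ : ℝ, 0 ≤ M ∧ 0 < κ ∧ κ ≤ 1 ∧ ∀ w b X x lam : ℝ, 0 ≤ w → 0 ≤ b →
      c * b ^ (p / (p - 1)) ≤ X → 0 ≤ x → x ≤ 1 → 0 < lam →
      C₁ * lam ^ (q - 1) * w * x ^ (s - 1) +
        C₁ * b * lam ^ ((q - p + 1) / p) * x ^ (s - 1) ≤
      η * (lam ^ ν * (X * (w + κ * lam) ^ (-ν - 1) * x ^ s)) + M * (w ^ q * x ^ s) +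
        η * lam ^ q := by
  obtain ⟨C, hC, h⟩ := exists_cutoff_absorption (q := q) (ν := ν) hp hps hc hC₁ hη
  set a := (1 + ν) * (p - 1)
  have ha : 0 < a := mul_pos (by linarith) (by linarith)
  have hq1 : 0 < q - 1 := by linarith
  have hqa : 0 < q - a := by linarith
  -- Here σ is taken large, contrary to the previous absorption: the coefficient of λ^q must be
  -- small, whereas that of w^q may be arbitrarily large because it will be integrated only over the
  -- outer region.
  have large : ∀ r : ℝ, 0 < r → ∃ σ : ℝ, 0 < σ ∧ C * σ ^ (-r) ≤ η / 4 := by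
    intro r hr
    refine ⟨(η / 4 / (C + 1)) ^ (-r⁻¹), by positivity, ?_⟩
    rw [← Real.rpow_mul (by positivity), neg_mul_neg, inv_mul_cancel₀ hr.ne', Real.rpow_one,
      mul_div_assoc', div_le_iff₀ (by positivity)]
    nlinarith
  obtain ⟨σ₁, hσ₁, hs₁⟩ := large (1 / (q - 1)) (by positivity)
  obtain ⟨σ₂, hσ₂, hs₂⟩ := large (a / (q - a)) (by positivity)
  set N := C * (σ₁ + σ₂) with hN
  have hN0 : 0 ≤ N := by positivity
  -- The large coefficient N also multiplies ε^q when (w+ε)^q is split, so ε = κλ with κ small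
  -- replaces ε = λ.
  obtain ⟨κ, hκ0, hκ1, hκ⟩ : ∃ κ : ℝ, 0 < κ ∧ κ ≤ 1 ∧ N * 2 ^ q * κ ^ q ≤ η / 2 := by
    have hB : (0 : ℝ) < N * 2 ^ q + 1 := by positivity
    refine ⟨min 1 ((η / 2 / (N * 2 ^ q + 1)) ^ (q⁻¹)), by positivity, min_le_left _ _, ?_⟩
    have h1 : (min 1 ((η / 2 / (N * 2 ^ q + 1)) ^ (q⁻¹))) ^ q ≤ η / 2 / (N * 2 ^ q + 1) := by
      calc _ ≤ ((η / 2 / (N * 2 ^ q + 1)) ^ (q⁻¹)) ^ q :=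
            Real.rpow_le_rpow (by positivity) (min_le_right _ _) (by linarith)
        _ = _ := by
            rw [← Real.rpow_mul (by positivity), inv_mul_cancel₀ (by linarith), Real.rpow_one]
    have h2 := mul_le_mul_of_nonneg_left h1 (by positivity : 0 ≤ N * 2 ^ q)
    refine h2.trans ?_
    rw [mul_div_assoc', div_le_iff₀ hB]
    nlinarith
  refine ⟨N * 2 ^ q, κ, by positivity, hκ0, hκ1, fun w b X x lam hw hb hX hx hx1 hlam => ?_⟩
  have hε : 0 < κ * lam := by positivity
  have h0 := h w b X x lam (κ * lam) hw hb hX hx hx1 hε hlam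
  have hW : 0 ≤ w + κ * lam := by linarith
  have t1 := mul_le_mul_of_nonneg_left (interpolation_cutoff (a := 1) (b := q) (k := 1) (s := s)
    (by linarith) hq one_pos hs1 hσ₁ hW hlam hx hx1) hC
  have t2 := mul_le_mul_of_nonneg_left (interpolation_cutoff (a := a) (b := q) (k := p) (s := s)
    ha.le hνq (by linarith) hs2 hσ₂ hW hlam hx hx1) hC
  have h2 := mul_le_mul_of_nonneg_left (add_rpow_mul_cutoff_le (by linarith : 0 ≤ q)
    (by linarith : 0 ≤ s) hw hε.le hx hx1) hN0
  rw [Real.mul_rpow hκ0.le hlam.le] at h2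
  have hl : 0 ≤ lam ^ q := by positivity
  have l1 := mul_le_mul_of_nonneg_right hs₁ hl
  have l2 := mul_le_mul_of_nonneg_right hs₂ hl
  have l3 := mul_le_mul_of_nonneg_right hκ hl
  rw [hN] at h2 l3 ⊢
  linarith

/-! ### Space-time cutoff functions -/

section Cutoff

variable {n : ℕ}

/-- The anisotropic rescaling `(t, x) ↦ (t / T, x / R)`. -/
noncomputable def parabolicScaling (n : ℕ) (T R : ℝ) :
    ℝ × EuclideanSpace ℝ (Fin n) →L[ℝ] ℝ × EuclideanSpace ℝ (Fin n) :=
  (T⁻¹ • ContinuousLinearMap.fst ℝ ℝ (EuclideanSpace ℝ (Fin n))).prod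
    (R⁻¹ • ContinuousLinearMap.snd ℝ ℝ (EuclideanSpace ℝ (Fin n)))

theorem parabolicScaling_apply (T R : ℝ) (z : ℝ × EuclideanSpace ℝ (Fin n)) :
    parabolicScaling n T R z = (T⁻¹ * z.1, R⁻¹ • z.2) := rfl

/-- A bump function on space-time equal to `1` on the unit ball. -/
noncomputable def unitBump (n : ℕ) : ContDiffBump (0 : ℝ × EuclideanSpace ℝ (Fin n)) where
  rIn := 1
  rOut := 2
  rIn_pos := one_pos
  rIn_lt_rOut := one_lt_two

/-- A cutoff function adapted to the cylinder of height `T` and radius `R`. -/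
noncomputable def cylinderCutoff (T R : ℝ) (z : ℝ × EuclideanSpace ℝ (Fin n)) : ℝ :=
  unitBump n (parabolicScaling n T R z)

/-- A nondecreasing cutoff function in time, vanishing for `t ≤ δ`. -/
noncomputable def timeCutoff (δ t : ℝ) : ℝ := Real.smoothTransition (t / δ - 1)

theorem contDiff_timeCutoff (δ : ℝ) : ContDiff ℝ (⊤ : ℕ∞) (timeCutoff δ) :=
  Real.smoothTransition.contDiff.comp ((contDiff_id.div_const δ).sub contDiff_const)

theorem timeCutoff_nonneg (δ t : ℝ) : 0 ≤ timeCutoff δ t := Real.smoothTransition.nonneg _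

theorem timeCutoff_le_one (δ t : ℝ) : timeCutoff δ t ≤ 1 := Real.smoothTransition.le_one _

theorem timeCutoff_eq_zero {δ t : ℝ} (hδ : 0 < δ) (ht : t ≤ δ) : timeCutoff δ t = 0 := by
  apply Real.smoothTransition.zero_of_nonpos
  rw [sub_nonpos, div_le_one hδ]
  exact ht

theorem timeCutoff_eq_one {δ t : ℝ} (hδ : 0 < δ) (ht : 2 * δ ≤ t) : timeCutoff δ t = 1 := by
  apply Real.smoothTransition.one_of_one_le
  rw [le_sub_iff_add_le, le_div_iff₀ hδ]
  linarith

theorem deriv_timeCutoff_nonneg {δ : ℝ} (hδ : 0 < δ) (t : ℝ) : 0 ≤ deriv (timeCutoff δ) t := by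
  apply Monotone.deriv_nonneg
  intro a b hab
  apply Real.smoothTransition.monotone
  gcongr

theorem contDiff_cylinderCutoff (T R : ℝ) :
    ContDiff ℝ (⊤ : ℕ∞) (cylinderCutoff T R : ℝ × EuclideanSpace ℝ (Fin n) → ℝ) :=
  (unitBump n).contDiff.comp (parabolicScaling n T R).contDiff

theorem cylinderCutoff_nonneg (T R : ℝ) (z : ℝ × EuclideanSpace ℝ (Fin n)) :
    0 ≤ cylinderCutoff T R z := (unitBump n).nonneg

theorem cylinderCutoff_le_one (T R : ℝ) (z : ℝ × EuclideanSpace ℝ (Fin n)) :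
    cylinderCutoff T R z ≤ 1 := (unitBump n).le_one

theorem cylinderCutoff_eq_one {T R : ℝ} {z : ℝ × EuclideanSpace ℝ (Fin n)}
    (hz : ‖parabolicScaling n T R z‖ < 1) : cylinderCutoff T R z = 1 :=
  (unitBump n).one_of_mem_closedBall (by simpa [unitBump] using hz.le)

theorem fderiv_cylinderCutoff (T R : ℝ) (z v : ℝ × EuclideanSpace ℝ (Fin n)) :
    fderiv ℝ (cylinderCutoff T R) z v =
      fderiv ℝ (unitBump n) (parabolicScaling n T R z) (parabolicScaling n T R v) := by
  have h1 : HasFDerivAt (unitBump n) (fderiv ℝ (unitBump n) (parabolicScaling n T R z))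
      (parabolicScaling n T R z) :=
    (((unitBump n).contDiff (n := 1)).differentiable (by simp) _).hasFDerivAt
  have h2 : HasFDerivAt (cylinderCutoff T R) _ z := h1.comp z (parabolicScaling n T R).hasFDerivAt
  rw [h2.fderiv]
  rfl

theorem exists_bound_fderiv_unitBump (n : ℕ) : ∃ C : ℝ, 0 ≤ C ∧
    ∀ z v : ℝ × EuclideanSpace ℝ (Fin n), |fderiv ℝ (unitBump n) z v| ≤ C * ‖v‖ ∧
      (‖z‖ < 1 → fderiv ℝ (unitBump n) z v = 0) := by
  have hc : Continuous (fderiv ℝ (unitBump n)) :=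
    ((unitBump n).contDiff (n := 1)).continuous_fderiv (by simp)
  have hs : HasCompactSupport (fderiv ℝ (unitBump n)) :=
    (unitBump n).hasCompactSupport.fderiv (𝕜 := ℝ)
  obtain ⟨C, hC⟩ := hc.bounded_above_of_compact_support hs
  refine ⟨C, (norm_nonneg _).trans (hC 0), fun z v => ⟨?_, fun hz => ?_⟩⟩
  · exact ((fderiv ℝ (unitBump n) z).le_opNorm v).trans (by gcongr; exact hC z)
  · have h : (unitBump n : ℝ × EuclideanSpace ℝ (Fin n) → ℝ) =ᶠ[𝓝 z] fun _ => 1 :=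
      (unitBump n).eventuallyEq_one_of_mem_ball (by simpa [unitBump] using hz)
    rw [h.fderiv_eq]
    simp

/-- The closed cylinder supporting the cutoff functions. -/
def cutoffCylinder (n : ℕ) (δ T R : ℝ) : Set (ℝ × EuclideanSpace ℝ (Fin n)) :=
  Set.Icc δ (2 * T) ×ˢ Metric.closedBall 0 (2 * R)

theorem isCompact_cutoffCylinder (δ T R : ℝ) : IsCompact (cutoffCylinder n δ T R) :=
  isCompact_Icc.prod (isCompact_closedBall _ _)

theorem cutoffCylinder_subset {δ : ℝ} (hδ : 0 < δ) (T R : ℝ) :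
    cutoffCylinder n δ T R ⊆ (halfSpace n : Set (ℝ × EuclideanSpace ℝ (Fin n))) :=
  fun _ hz => hδ.trans_le hz.1.1

theorem volume_real_cutoffCylinder_le {δ T R : ℝ} (hδ : 0 < δ) (hT : 0 < T) (hR : 0 < R) :
    (volume : Measure (ℝ × EuclideanSpace ℝ (Fin n))).real (cutoffCylinder n δ T R) ≤
      2 * T * ((2 * R) ^ n *
        (volume : Measure (EuclideanSpace ℝ (Fin n))).real (Metric.ball 0 1)) := by
  rw [cutoffCylinder, Measure.volume_eq_prod, measureReal_prod_prod,
    measureReal_def (μ := (volume : Measure (EuclideanSpace ℝ (Fin n)))) (s := Metric.closedBall _ _),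
    Measure.addHaar_closedBall _ _ (by positivity), ENNReal.toReal_mul,
    ENNReal.toReal_ofReal (by positivity)]
  simp only [finrank_euclideanSpace, Fintype.card_fin]
  have h : (volume : Measure ℝ).real (Set.Icc δ (2 * T)) ≤ 2 * T := by
    rw [Real.volume_real_Icc]
    exact max_le (by linarith) (by linarith)
  gcongr
  exact le_rfl

/-- The norm on the product is the maximum norm, so a ball pulled back by the scaling is a cylinder.
-/
theorem cutoff_eq_zero {δ T R : ℝ} (hδ : 0 < δ) (hT : 0 < T) (hR : 0 < R)
    {z : ℝ × EuclideanSpace ℝ (Fin n)} (hz : z ∉ cutoffCylinder n δ T R) :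
    timeCutoff δ z.1 = 0 ∨ cylinderCutoff T R z = 0 := by
  by_contra! h
  apply hz
  have h1 : δ ≤ z.1 := by
    by_contra! hc
    exact h.1 (timeCutoff_eq_zero hδ hc.le)
  have h2 : ‖parabolicScaling n T R z‖ < 2 := by
    by_contra! hc
    exact h.2 ((unitBump n).zero_of_le_dist (by simpa [unitBump] using hc))
  rw [parabolicScaling_apply, Prod.norm_def, max_lt_iff] at h2
  simp only [norm_mul, norm_smul, norm_inv, Real.norm_eq_abs, abs_of_pos hT, abs_of_pos hR] at h2
  rw [inv_mul_lt_iff₀ hT, inv_mul_lt_iff₀ hR] at h2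
  refine ⟨⟨h1, ?_⟩, ?_⟩
  · linarith [le_abs_self z.1]
  · rw [mem_closedBall_zero_iff]
    linarith

/-- The test function `θ(t) ξ(t, x) ^ s`. -/
noncomputable def cutoffTest {δ T R : ℝ} (hδ : 0 < δ) (hT : 0 < T) (hR : 0 < R) {s : ℕ}
    (hs : s ≠ 0) : 𝓓(halfSpace n, ℝ) where
  toFun z := timeCutoff δ z.1 * cylinderCutoff T R z ^ s
  contDiff' := ((contDiff_timeCutoff δ).comp contDiff_fst).mul ((contDiff_cylinderCutoff T R).pow s)
  hasCompactSupport' := by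
    refine HasCompactSupport.intro (isCompact_cutoffCylinder δ T R) fun z hz => ?_
    rcases cutoff_eq_zero hδ hT hR hz with h | h <;> simp [h, hs]
  tsupport_subset' := by
    refine (closure_minimal (fun z hz => ?_) (isCompact_cutoffCylinder δ T R).isClosed).trans
      (cutoffCylinder_subset hδ T R)
    by_contra hc
    apply hz
    rcases cutoff_eq_zero hδ hT hR hc with h | h <;> simp [h, hs]

variable {δ T R : ℝ} (hδ : 0 < δ) (hT : 0 < T) (hR : 0 < R) {s : ℕ} (hs : s ≠ 0)

theorem cutoffTest_apply (z : ℝ × EuclideanSpace ℝ (Fin n)) :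
    cutoffTest hδ hT hR hs z = timeCutoff δ z.1 * cylinderCutoff T R z ^ s := rfl

theorem cutoffTest_nonneg (z : ℝ × EuclideanSpace ℝ (Fin n)) : 0 ≤ cutoffTest hδ hT hR hs z :=
  mul_nonneg (timeCutoff_nonneg _ _) (pow_nonneg (cylinderCutoff_nonneg _ _ _) _)

theorem cutoffTest_eq_zero {z : ℝ × EuclideanSpace ℝ (Fin n)}
    (hz : z ∉ cutoffCylinder n δ T R) : cutoffTest hδ hT hR hs z = 0 := by
  rw [cutoffTest_apply]
  rcases cutoff_eq_zero hδ hT hR hz with h | h <;> simp [h, hs]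

theorem fderiv_cutoffTest_eq_zero {z : ℝ × EuclideanSpace ℝ (Fin n)}
    (hz : z ∉ cutoffCylinder n δ T R) : fderiv ℝ (cutoffTest hδ hT hR hs) z = 0 := by
  have h : (cutoffTest hδ hT hR hs : ℝ × EuclideanSpace ℝ (Fin n) → ℝ) =ᶠ[𝓝 z] fun _ => 0 := by
    filter_upwards [(isCompact_cutoffCylinder δ T R).isClosed.isOpen_compl.mem_nhds hz] with y hy
    exact cutoffTest_eq_zero hδ hT hR hs hy
  rw [h.fderiv_eq]
  simp

theorem fderiv_cutoffTest (z v : ℝ × EuclideanSpace ℝ (Fin n)) :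
    fderiv ℝ (cutoffTest hδ hT hR hs) z v =
      deriv (timeCutoff δ) z.1 * v.1 * cylinderCutoff T R z ^ s +
      timeCutoff δ z.1 * (s * cylinderCutoff T R z ^ (s - 1) *
        fderiv ℝ (cylinderCutoff T R) z v) := by
  have h1 : HasFDerivAt (fun z : ℝ × EuclideanSpace ℝ (Fin n) => timeCutoff δ z.1) _ z :=
    ((contDiff_timeCutoff δ).differentiable (by simp) z.1).hasDerivAt.hasFDerivAt.comp z
      hasFDerivAt_fst
  have h2 : HasFDerivAt (cylinderCutoff T R) (fderiv ℝ (cylinderCutoff T R) z) z :=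
    ((contDiff_cylinderCutoff T R).differentiable (by simp) z).hasFDerivAt
  have h3 : HasFDerivAt (cutoffTest hδ hT hR hs) _ z := h1.mul (h2.pow s)
  rw [h3.fderiv]
  simp
  ring

/-- The time cutoff is nondecreasing, so its derivative contributes with a favourable sign and is
dropped. The remaining term lives where the cylinder cutoff is not locally constant, which the
indicator records. -/
theorem neg_fderiv_cutoffTest_time_le {C : ℝ}
    (hC : ∀ z v : ℝ × EuclideanSpace ℝ (Fin n), |fderiv ℝ (unitBump n) z v| ≤ C * ‖v‖ ∧
      (‖z‖ < 1 → fderiv ℝ (unitBump n) z v = 0)) (z : ℝ × EuclideanSpace ℝ (Fin n)) :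
    -(fderiv ℝ (cutoffTest hδ hT hR hs) z (1, 0)) ≤
      {z | 1 ≤ ‖parabolicScaling n T R z‖}.indicator
        (fun z => s * C * T⁻¹ * cylinderCutoff T R z ^ (s - 1) * timeCutoff δ z.1) z := by
  rw [fderiv_cutoffTest, fderiv_cylinderCutoff]
  have hx := cylinderCutoff_nonneg (n := n) T R z
  have hθ := timeCutoff_nonneg δ z.1
  have hd := deriv_timeCutoff_nonneg hδ z.1
  have h0 : 0 ≤ deriv (timeCutoff δ) z.1 * cylinderCutoff T R z ^ s := by positivity
  by_cases hz : 1 ≤ ‖parabolicScaling n T R z‖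
  · rw [Set.indicator_of_mem (by exact hz)]
    have h1 := (hC (parabolicScaling n T R z) (parabolicScaling n T R (1, 0))).1
    have h2 : ‖parabolicScaling n T R (1, 0)‖ = T⁻¹ := by
      rw [parabolicScaling_apply, Prod.norm_def]
      simp [abs_of_pos hT, hT.le]
    rw [h2] at h1
    have h3 := mul_le_mul_of_nonneg_left ((neg_le_abs _).trans h1)
      (by positivity : 0 ≤ timeCutoff δ z.1 * (s * cylinderCutoff T R z ^ (s - 1)))
    simp only [mul_one]
    linarith
  · rw [Set.indicator_of_notMem (by exact hz),
      (hC (parabolicScaling n T R z) (parabolicScaling n T R (1, 0))).2 (not_le.1 hz)]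
    simp only [mul_one, mul_zero, add_zero]
    linarith

/-- The time factor is untouched by spatial differentiation; one power of the cylinder cutoff is
lost and a factor 1/R gained. -/
theorem abs_fderiv_cutoffTest_space_le {C : ℝ}
    (hC : ∀ z v : ℝ × EuclideanSpace ℝ (Fin n), |fderiv ℝ (unitBump n) z v| ≤ C * ‖v‖ ∧
      (‖z‖ < 1 → fderiv ℝ (unitBump n) z v = 0)) (z : ℝ × EuclideanSpace ℝ (Fin n))
    (y : EuclideanSpace ℝ (Fin n)) :
    |fderiv ℝ (cutoffTest hδ hT hR hs) z (0, y)| ≤ ‖y‖ *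
      {z | 1 ≤ ‖parabolicScaling n T R z‖}.indicator
        (fun z => s * C * R⁻¹ * cylinderCutoff T R z ^ (s - 1) * timeCutoff δ z.1) z := by
  rw [fderiv_cutoffTest, fderiv_cylinderCutoff]
  have hx := cylinderCutoff_nonneg (n := n) T R z
  have hθ := timeCutoff_nonneg δ z.1
  simp only [mul_zero, zero_mul, zero_add]
  by_cases hz : 1 ≤ ‖parabolicScaling n T R z‖
  · rw [Set.indicator_of_mem (by exact hz)]
    have h1 := (hC (parabolicScaling n T R z) (parabolicScaling n T R (0, y))).1
    have h2 : ‖parabolicScaling n T R (0, y)‖ = R⁻¹ * ‖y‖ := by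
      rw [parabolicScaling_apply, Prod.norm_def]
      simp only [mul_zero, norm_zero, norm_smul, norm_inv, Real.norm_eq_abs, abs_of_pos hR]
      exact max_eq_right (by positivity)
    rw [h2] at h1
    have h0 : 0 ≤ timeCutoff δ z.1 * (s * cylinderCutoff T R z ^ (s - 1)) := by positivity
    have h3 := mul_le_mul_of_nonneg_left h1 h0
    rw [← mul_assoc (timeCutoff δ z.1), abs_mul, abs_of_nonneg h0]
    linarith
  · rw [Set.indicator_of_notMem (by exact hz),
      (hC (parabolicScaling n T R z) (parabolicScaling n T R (0, y))).2 (not_le.1 hz)]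
    simp

end Cutoff

/-! ### The differential inequality tested on cylinders -/

/-- The weak differential inequality satisfied by the difference `w` of a super-solution and a
sub-solution: `w_t - div B ≥ f` with `f ≥ c w ^ q` and a flux `B` that is controlled by its product
with the gradient `D` of `w`. -/
structure DifferenceInequality (n : ℕ) (p q c : ℝ) (w wt f : ℝ × EuclideanSpace ℝ (Fin n) → ℝ)
    (B D : ℝ × EuclideanSpace ℝ (Fin n) → EuclideanSpace ℝ (Fin n)) : Prop where
  nonneg : ∀ z, 0 ≤ w z
  locallyIntegrable : LocallyIntegrableOn w (halfSpace n)
  locallyIntegrable_rpow : LocallyIntegrableOn (fun z => w z ^ q) (halfSpace n)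
  locallyIntegrable_time : LocallyIntegrableOn wt (halfSpace n)
  locallyIntegrable_reaction : LocallyIntegrableOn f (halfSpace n)
  locallyIntegrable_flux : LocallyIntegrableOn B (halfSpace n)
  locallyIntegrable_flux_rpow :
    LocallyIntegrableOn (fun z => ‖B z‖ ^ (p / (p - 1))) (halfSpace n)
  locallyIntegrable_grad : LocallyIntegrableOn D (halfSpace n)
  locallyIntegrable_grad_rpow : LocallyIntegrableOn (fun z => ‖D z‖ ^ p) (halfSpace n)
  weak_time : HasWeakDirDeriv volume (halfSpace n) (1, 0) w wt
  weak_space : ∀ i, HasWeakDirDeriv volume (halfSpace n) (0, EuclideanSpace.single i 1) w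
    (fun z => D z i)
  reaction : ∀ᵐ z ∂(volume.restrict (halfSpace n : Set (ℝ × EuclideanSpace ℝ (Fin n)))),
    c * w z ^ q ≤ f z
  coercive : ∀ z, c * ‖B z‖ ^ (p / (p - 1)) ≤ inner ℝ (B z) (D z)
  test : ∀ φ : 𝓓(halfSpace n, ℝ), (∀ z, 0 ≤ φ z) →
    0 ≤ ∫ z in (halfSpace n : Set (ℝ × EuclideanSpace ℝ (Fin n))),
      (wt z * φ z + ∑ i, B z i * fderiv ℝ φ z (0, EuclideanSpace.single i 1) - f z * φ z)

theorem MeasureTheory.LocallyIntegrableOn.euclidean_apply {X : Type*} [TopologicalSpace X]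
    [MeasurableSpace X] {μ : Measure X} {s : Set X} {n : ℕ} {g : X → EuclideanSpace ℝ (Fin n)}
    (hg : LocallyIntegrableOn g s μ) (i : Fin n) : LocallyIntegrableOn (fun x => g x i) s μ := by
  intro x hx
  obtain ⟨t, ht, hgt⟩ := hg x hx
  exact ⟨t, ht, (EuclideanSpace.proj (𝕜 := ℝ) i).integrable_comp hgt⟩

theorem MeasureTheory.LocallyIntegrableOn.of_le {X E F : Type*} [TopologicalSpace X]
    [MeasurableSpace X] [NormedAddCommGroup E] [NormedAddCommGroup F] {μ : Measure X} {s : Set X}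
    (hs : MeasurableSet s) {g : X → E} {h : X → F} (hh : LocallyIntegrableOn h s μ)
    (hg : AEStronglyMeasurable g (μ.restrict s)) (hgh : ∀ x ∈ s, ‖g x‖ ≤ ‖h x‖) :
    LocallyIntegrableOn g s μ := by
  intro x hx
  obtain ⟨t, ht, hht⟩ := hh x hx
  refine ⟨t ∩ s, Filter.inter_mem ht self_mem_nhdsWithin, ?_⟩
  refine Integrable.mono (hht.mono_set Set.inter_subset_left)
    (hg.mono_measure (Measure.restrict_mono_set _ Set.inter_subset_right)) ?_
  have : ∀ᵐ y ∂(μ.restrict s), ‖g y‖ ≤ ‖h y‖ := ae_restrict_of_forall_mem hs hgh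
  exact ae_mono (Measure.restrict_mono_set _ Set.inter_subset_right) this

instance isAddHaarMeasure_volume_spaceTime (n : ℕ) :
    (volume : Measure (ℝ × EuclideanSpace ℝ (Fin n))).IsAddHaarMeasure :=
  Measure.prod.instIsAddHaarMeasure volume volume

theorem sum_mul_clm_eq {n : ℕ} (L : ℝ × EuclideanSpace ℝ (Fin n) →L[ℝ] ℝ)
    (y : EuclideanSpace ℝ (Fin n)) :
    ∑ i, y i * L (0, EuclideanSpace.single i 1) = L (0, y) := by
  have h : ((0 : ℝ), y) = ∑ i, y i • ((0 : ℝ), EuclideanSpace.single i (1 : ℝ)) := by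
    rw [← Prod.mk.eta (p := ∑ i, y i • ((0 : ℝ), EuclideanSpace.single i (1 : ℝ))), Prod.fst_sum,
      Prod.snd_sum]
    congr 1
    · simp
    · ext j
      simp [Finset.sum_apply, Pi.single_apply]
  rw [h, map_sum]
  exact Finset.sum_congr rfl fun i _ => by rw [map_smul, smul_eq_mul]

theorem inner_eq_sum_mul {n : ℕ} (x y : EuclideanSpace ℝ (Fin n)) :
    inner ℝ x y = ∑ i, x i * y i := by
  rw [PiLp.inner_apply]
  exact Finset.sum_congr rfl fun i _ => by simp [mul_comm]

namespace DifferenceInequality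

variable {n : ℕ} {p q c : ℝ} {w wt f : ℝ × EuclideanSpace ℝ (Fin n) → ℝ}
  {B D : ℝ × EuclideanSpace ℝ (Fin n) → EuclideanSpace ℝ (Fin n)}

theorem integrableOn_of_locallyIntegrableOn {F : Type*} [NormedAddCommGroup F]
    {g : ℝ × EuclideanSpace ℝ (Fin n) → F} (hg : LocallyIntegrableOn g (halfSpace n)) {δ : ℝ}
    (hδ : 0 < δ) (T R : ℝ) : IntegrableOn g (cutoffCylinder n δ T R) :=
  hg.integrableOn_compact_subset (cutoffCylinder_subset hδ T R) (isCompact_cutoffCylinder δ T R)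

theorem setIntegral_eq {g : ℝ × EuclideanSpace ℝ (Fin n) → ℝ} {δ T R : ℝ} (hδ : 0 < δ)
    (hg : ∀ z ∉ cutoffCylinder n δ T R, g z = 0) :
    ∫ z in (halfSpace n : Set (ℝ × EuclideanSpace ℝ (Fin n))), g z =
      ∫ z in cutoffCylinder n δ T R, g z :=
  (setIntegral_eq_of_subset_of_forall_sdiff_eq_zero (halfSpace n).isOpen.measurableSet
    (cutoffCylinder_subset hδ T R) fun z hz => hg z hz.2)

theorem continuous_cutoff_rpow {r : ℝ} (hr : 0 ≤ r) (δ T R : ℝ) :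
    Continuous fun z : ℝ × EuclideanSpace ℝ (Fin n) =>
      cylinderCutoff T R z ^ r * timeCutoff δ z.1 :=
  ((contDiff_cylinderCutoff T R).continuous.rpow_const fun _ => Or.inr hr).mul
    ((contDiff_timeCutoff δ).continuous.comp continuous_fst)

theorem aestronglyMeasurable_add_rpow (h : DifferenceInequality n p q c w wt f B D) {δ : ℝ}
    (hδ : 0 < δ) (T R ε r : ℝ) : AEStronglyMeasurable (fun z => (w z + ε) ^ r)
      (volume.restrict (cutoffCylinder n δ T R)) :=
  (((integrableOn_of_locallyIntegrableOn h.locallyIntegrable hδ T R).1.aemeasurable.add_const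
    ε).pow_const r).aestronglyMeasurable

theorem integrableOn_mul_rpow (h : DifferenceInequality n p q c w wt f B D) {δ : ℝ}
    (hδ : 0 < δ) (T R : ℝ) {ε r : ℝ} (hε : 0 < ε) (hr : r ≤ 0)
    {g k : ℝ × EuclideanSpace ℝ (Fin n) → ℝ} (hg : LocallyIntegrableOn g (halfSpace n))
    (hk : Continuous k) :
    IntegrableOn (fun z => g z * (w z + ε) ^ r * k z) (cutoffCylinder n δ T R) := by
  refine IntegrableOn.mul_continuousOn ?_ hk.continuousOn (isCompact_cutoffCylinder δ T R)
  refine Integrable.mul_bdd (c := ε ^ r) (integrableOn_of_locallyIntegrableOn hg hδ T R)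
    (h.aestronglyMeasurable_add_rpow hδ T R ε r) (Eventually.of_forall fun z => ?_)
  have hw := h.nonneg z
  rw [Real.norm_of_nonneg (Real.rpow_nonneg (by linarith) _)]
  exact Real.rpow_le_rpow_of_nonpos hε (by linarith) hr

theorem integrableOn_add_rpow (h : DifferenceInequality n p q c w wt f B D) {δ : ℝ}
    (hδ : 0 < δ) (T R : ℝ) {ε r : ℝ} (hε : 0 < ε) (hr : 0 ≤ r) (hr1 : r ≤ 1)
    {k : ℝ × EuclideanSpace ℝ (Fin n) → ℝ} (hk : Continuous k) :
    IntegrableOn (fun z => (w z + ε) ^ r * k z) (cutoffCylinder n δ T R) := by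
  refine IntegrableOn.mul_continuousOn ?_ hk.continuousOn (isCompact_cutoffCylinder δ T R)
  have hK : volume (cutoffCylinder n δ T R) ≠ ⊤ :=
    (isCompact_cutoffCylinder δ T R).measure_lt_top.ne
  refine Integrable.mono' (g := fun z => w z + (ε + 1))
    ((integrableOn_of_locallyIntegrableOn h.locallyIntegrable hδ T R).add
      (integrableOn_const hK)) (h.aestronglyMeasurable_add_rpow hδ T R ε r)
    (Eventually.of_forall fun z => ?_)
  have hw := h.nonneg z
  rw [Real.norm_of_nonneg (Real.rpow_nonneg (by linarith) _)]
  rcases le_total (w z + ε) 1 with h1 | h1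
  · have := Real.rpow_le_one (by linarith) h1 hr
    linarith
  · have := Real.rpow_le_rpow_of_exponent_le h1 hr1
    rw [Real.rpow_one] at this
    linarith

theorem integrableOn_fderiv_flux (h : DifferenceInequality n p q c w wt f B D) {δ : ℝ}
    (hδ : 0 < δ) (T R : ℝ) {ε r : ℝ} (hε : 0 < ε) (hr : r ≤ 0)
    {L : ℝ × EuclideanSpace ℝ (Fin n) → ℝ × EuclideanSpace ℝ (Fin n) →L[ℝ] ℝ} (hL : Continuous L) :
    IntegrableOn (fun z => L z (0, B z) * (w z + ε) ^ r) (cutoffCylinder n δ T R) := by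
  have h1 : Integrable (fun z => ∑ i, B z i * (w z + ε) ^ r * L z (0, EuclideanSpace.single i 1))
      (volume.restrict (cutoffCylinder n δ T R)) :=
    integrable_finsetSum _ fun i _ => h.integrableOn_mul_rpow hδ T R hε hr
      (h.locallyIntegrable_flux.euclidean_apply i) (hL.clm_apply continuous_const)
  refine h1.congr (Eventually.of_forall fun z => ?_)
  dsimp only
  rw [← sum_mul_clm_eq, Finset.sum_mul]
  exact Finset.sum_congr rfl fun i _ => by ring

theorem ae_reaction (h : DifferenceInequality n p q c w wt f B D) {δ : ℝ} (hδ : 0 < δ) (T R : ℝ) :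
    ∀ᵐ z ∂(volume.restrict (cutoffCylinder n δ T R)), c * w z ^ q ≤ f z :=
  ae_mono (Measure.restrict_mono_set _ (cutoffCylinder_subset hδ T R)) h.reaction

theorem locallyIntegrableOn_norm_flux (h : DifferenceInequality n p q c w wt f B D) :
    LocallyIntegrableOn (fun z => ‖B z‖) (halfSpace n) :=
  h.locallyIntegrable_flux.norm

theorem locallyIntegrableOn_inner (hp : 1 < p)
    (h : DifferenceInequality n p q c w wt f B D) :
    LocallyIntegrableOn (fun z => inner ℝ (B z) (D z)) (halfSpace n) := by
  refine (h.locallyIntegrable_flux_rpow.add h.locallyIntegrable_grad_rpow).of_le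
    (halfSpace n).isOpen.measurableSet
    (h.locallyIntegrable_flux.aestronglyMeasurable.inner
      h.locallyIntegrable_grad.aestronglyMeasurable) fun z _ => ?_
  have h1 := mul_le_weighted_young hp (norm_nonneg (B z)) (norm_nonneg (D z)) one_pos
  simp only [Real.one_rpow, one_mul] at h1
  rw [Pi.add_apply, Real.norm_of_nonneg (r := ‖B z‖ ^ (p / (p - 1)) + ‖D z‖ ^ p) (by positivity)]
  exact (abs_real_inner_le_norm _ _).trans h1

/-- The energy estimate on a cylinder. -/
theorem cylinder_energy_estimate (hp : 1 < p)
    (h : DifferenceInequality n p q c w wt f B D) {C : ℝ} (hC0 : 0 ≤ C)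
    (hC : ∀ z v : ℝ × EuclideanSpace ℝ (Fin n), |fderiv ℝ (unitBump n) z v| ≤ C * ‖v‖ ∧
      (‖z‖ < 1 → fderiv ℝ (unitBump n) z v = 0))
    {δ T R : ℝ} (hδ : 0 < δ) (hT : 0 < T) (hR : 0 < R) {s : ℕ} (hs : 1 ≤ s) {ν ε : ℝ} (hν : 0 < ν)
    (hν1 : ν < 1) (hε : 0 < ε) :
    (∫ z in cutoffCylinder n δ T R, w z ^ q * (w z + ε) ^ (-ν) *
        (cylinderCutoff T R z ^ (s : ℝ) * timeCutoff δ z.1) * c) +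
      ν * ∫ z in cutoffCylinder n δ T R, inner ℝ (B z) (D z) * (w z + ε) ^ (-ν - 1) *
        (cylinderCutoff T R z ^ (s : ℝ) * timeCutoff δ z.1) ≤
    (s * C / (1 - ν)) * T⁻¹ * (∫ z in cutoffCylinder n δ T R, (w z + ε) ^ (1 - ν) *
        (cylinderCutoff T R z ^ ((s : ℝ) - 1) * timeCutoff δ z.1)) +
      (s * C / (1 - ν)) * R⁻¹ * (∫ z in cutoffCylinder n δ T R, ‖B z‖ * (w z + ε) ^ (-ν) *
        (cylinderCutoff T R z ^ ((s : ℝ) - 1) * timeCutoff δ z.1)) := by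
  have hs0 : s ≠ 0 := by omega
  have hs1 : (1 : ℝ) ≤ s := by exact_mod_cast hs
  have h1ν : 0 < 1 - ν := by linarith
  set ζ : 𝓓(halfSpace n, ℝ) := cutoffTest hδ hT hR hs0 with hζdef
  set K := cutoffCylinder n δ T R with hKdef
  have hK : MeasurableSet K := (isCompact_cutoffCylinder δ T R).measurableSet
  have hζ : ∀ z, ζ z = cylinderCutoff T R z ^ (s : ℝ) * timeCutoff δ z.1 := fun z => by
    rw [hζdef, cutoffTest_apply, Real.rpow_natCast, mul_comm]
  have hpow : ∀ z : ℝ × EuclideanSpace ℝ (Fin n),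
      cylinderCutoff T R z ^ (s - 1) = cylinderCutoff T R z ^ ((s : ℝ) - 1) := fun z => by
    rw [← Real.rpow_natCast, Nat.cast_sub hs, Nat.cast_one]
  have flux_le : ∀ (u : LocallyIntegrableOn B (halfSpace n)) i,
      LocallyIntegrableOn (fun z => |B z i| ^ (p / (p - 1))) (halfSpace n) := fun u i => by
    have hp1 : 0 ≤ p / (p - 1) := div_nonneg (by linarith) (by linarith)
    refine h.locallyIntegrable_flux_rpow.of_le (halfSpace n).isOpen.measurableSet ?_ fun z _ => ?_
    · exact ((u.euclidean_apply i).aestronglyMeasurable.norm.aemeasurable.pow_const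
        _).aestronglyMeasurable
    · rw [Real.norm_of_nonneg (by positivity), Real.norm_of_nonneg (by positivity)]
      exact Real.rpow_le_rpow (abs_nonneg _) (PiLp.norm_apply_le (B z) i) hp1
  have grad_le : ∀ i, LocallyIntegrableOn (fun z => |D z i| ^ p) (halfSpace n) := fun i => by
    refine h.locallyIntegrable_grad_rpow.of_le (halfSpace n).isOpen.measurableSet ?_ fun z _ => ?_
    · exact ((h.locallyIntegrable_grad.euclidean_apply
        i).aestronglyMeasurable.norm.aemeasurable.pow_const _).aestronglyMeasurable
    · rw [Real.norm_of_nonneg (by positivity), Real.norm_of_nonneg (by positivity)]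
      exact Real.rpow_le_rpow (abs_nonneg _) (PiLp.norm_apply_le (D z) i) (by linarith)
  have key := energy_estimate (μ := volume) hp (Ω := halfSpace n)
    (e := fun i => ((0 : ℝ), EuclideanSpace.single i (1 : ℝ))) (B := fun i z => B z i)
    (D := fun i z => D z i) h.nonneg h.locallyIntegrable h.locallyIntegrable_time
    h.locallyIntegrable_reaction (fun i => h.locallyIntegrable_flux.euclidean_apply i)
    (fun i => flux_le h.locallyIntegrable_flux i)
    (fun i => h.locallyIntegrable_grad.euclidean_apply i) grad_le h.weak_time h.weak_space h.test
    hν hν1 hε ζ (cutoffTest_nonneg hδ hT hR hs0)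
  simp only [sum_mul_clm_eq, ← inner_eq_sum_mul] at key
  have hζ0 : ∀ z ∉ K, ζ z = 0 := fun z hz => cutoffTest_eq_zero hδ hT hR hs0 hz
  have hζ1 : ∀ z ∉ K, fderiv ℝ ζ z = 0 := fun z hz => fderiv_cutoffTest_eq_zero hδ hT hR hs0 hz
  rw [setIntegral_eq hδ (T := T) (R := R) (fun z hz => by simp [hζ0 z hz]),
    setIntegral_eq hδ (T := T) (R := R) (fun z hz => by simp [hζ0 z hz]),
    setIntegral_eq hδ (T := T) (R := R) (fun z hz => by simp [hζ1 z hz]),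
    setIntegral_eq hδ (T := T) (R := R) (fun z hz => by simp [hζ1 z hz])] at key
  have hcs := continuous_cutoff_rpow (n := n) (by linarith : (0 : ℝ) ≤ s) δ T R
  have hcs1 := continuous_cutoff_rpow (n := n) (by linarith : (0 : ℝ) ≤ (s : ℝ) - 1) δ T R
  have hW : ∀ z, 0 < w z + ε := fun z => by linarith [h.nonneg z]
  have hx := fun z : ℝ × EuclideanSpace ℝ (Fin n) => cylinderCutoff_nonneg T R z
  have hθ := fun z : ℝ × EuclideanSpace ℝ (Fin n) => timeCutoff_nonneg δ z.1
  have hζ'c : Continuous (fderiv ℝ ζ) := ζ.contDiff.continuous_fderiv (by simp)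
  -- the reaction term
  have k1 : ∫ z in K, w z ^ q * (w z + ε) ^ (-ν) *
        (cylinderCutoff T R z ^ (s : ℝ) * timeCutoff δ z.1) * c ≤
      ∫ z in K, f z * ((w z + ε) ^ (-ν) * ζ z) := by
    refine integral_mono_ae
      ((h.integrableOn_mul_rpow hδ T R hε (by linarith) h.locallyIntegrable_rpow hcs).mul_const c)
      ((h.integrableOn_mul_rpow hδ T R hε (r := -ν) (by linarith)
        h.locallyIntegrable_reaction ζ.continuous).congr
        (Eventually.of_forall fun z => mul_assoc _ _ _)) ?_
    filter_upwards [h.ae_reaction hδ T R] with z hz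
    rw [hζ]
    have : 0 ≤ (w z + ε) ^ (-ν) * (cylinderCutoff T R z ^ (s : ℝ) * timeCutoff δ z.1) :=
      mul_nonneg (Real.rpow_nonneg (hW z).le _)
        (mul_nonneg (Real.rpow_nonneg (hx z) _) (hθ z))
    have := mul_le_mul_of_nonneg_right hz this
    linarith
  have k2 : ∫ z in K, inner ℝ (B z) (D z) * ((w z + ε) ^ (-ν - 1) * ζ z) =
      ∫ z in K, inner ℝ (B z) (D z) * (w z + ε) ^ (-ν - 1) *
        (cylinderCutoff T R z ^ (s : ℝ) * timeCutoff δ z.1) := by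
    congr 1 with z
    rw [hζ]; ring
  have hτc : Continuous fun z => fderiv ℝ ζ z (1, 0) := hζ'c.clm_apply continuous_const
  have k3 : -(1 / (1 - ν)) * ∫ z in K, (w z + ε) ^ (1 - ν) * fderiv ℝ ζ z (1, 0) ≤
      (s * C / (1 - ν)) * T⁻¹ * (∫ z in K, (w z + ε) ^ (1 - ν) *
        (cylinderCutoff T R z ^ ((s : ℝ) - 1) * timeCutoff δ z.1)) := by
    rw [← integral_const_mul, ← integral_const_mul]
    refine integral_mono
      ((h.integrableOn_add_rpow hδ T R hε (by linarith) (by linarith) hτc).const_mul _)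
      ((h.integrableOn_add_rpow hδ T R hε (by linarith) (by linarith) hcs1).const_mul _)
      fun z => ?_
    -- The localization to the outer region is discarded here; the gradient bound does not use it.
    have h1 := (neg_fderiv_cutoffTest_time_le hδ hT hR hs0 hC z).trans
      (Set.indicator_le_self' (fun _ _ => mul_nonneg (mul_nonneg (by positivity)
        (pow_nonneg (hx _) _)) (hθ _)) z)
    rw [hpow] at h1
    have h2 : 0 ≤ 1 / (1 - ν) * (w z + ε) ^ (1 - ν) :=
      mul_nonneg (by positivity) (Real.rpow_nonneg (hW z).le _)
    have h3 := mul_le_mul_of_nonneg_left h1 h2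
    have e : (s * C / (1 - ν)) = 1 / (1 - ν) * (s * C) := by ring
    rw [e]
    dsimp only
    linarith
  have k4 : ∫ z in K, fderiv ℝ ζ z (0, B z) * (w z + ε) ^ (-ν) ≤
      (s * C / (1 - ν)) * R⁻¹ * (∫ z in K, ‖B z‖ * (w z + ε) ^ (-ν) *
        (cylinderCutoff T R z ^ ((s : ℝ) - 1) * timeCutoff δ z.1)) := by
    rw [← integral_const_mul]
    refine integral_mono (h.integrableOn_fderiv_flux hδ T R hε (by linarith) hζ'c)
      ((h.integrableOn_mul_rpow hδ T R hε (by linarith) h.locallyIntegrableOn_norm_flux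
        hcs1).const_mul _) fun z => ?_
    have h1 := ((le_abs_self _).trans
      (abs_fderiv_cutoffTest_space_le hδ hT hR hs0 hC z (B z))).trans
      (mul_le_mul_of_nonneg_left (Set.indicator_le_self' (fun _ _ => mul_nonneg (mul_nonneg
        (by positivity) (pow_nonneg (hx _) _)) (hθ _)) z) (norm_nonneg _))
    rw [hpow] at h1
    have h3 := mul_le_mul_of_nonneg_right h1 (Real.rpow_nonneg (hW z).le (-ν))
    -- Enlarging the flux constant by 1/(1-ν) lets one constant serve both error terms.
    have e : (s * C : ℝ) ≤ s * C / (1 - ν) := by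
      rw [le_div_iff₀ h1ν]
      have : 0 ≤ s * C := by positivity
      nlinarith
    refine h3.trans ?_
    have h4 : 0 ≤ R⁻¹ * (‖B z‖ * (w z + ε) ^ (-ν) *
        (cylinderCutoff T R z ^ ((s : ℝ) - 1) * timeCutoff δ z.1)) :=
      mul_nonneg (by positivity) (mul_nonneg (mul_nonneg (norm_nonneg _)
        (Real.rpow_nonneg (hW z).le _)) (mul_nonneg (Real.rpow_nonneg (hx z) _) (hθ z)))
    have h5 := mul_le_mul_of_nonneg_right e h4
    linarith
  rw [k2] at key
  linarith

/-- The estimate obtained by testing with the cutoff function alone. -/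
theorem cylinder_test_estimate (h : DifferenceInequality n p q c w wt f B D) {C : ℝ}
    (hC : ∀ z v : ℝ × EuclideanSpace ℝ (Fin n), |fderiv ℝ (unitBump n) z v| ≤ C * ‖v‖ ∧
      (‖z‖ < 1 → fderiv ℝ (unitBump n) z v = 0))
    {δ T R : ℝ} (hδ : 0 < δ) (hT : 0 < T) (hR : 0 < R) {s : ℕ} (hs : 1 ≤ s) :
    ∫ z in cutoffCylinder n δ T R, w z ^ q *
        (cylinderCutoff T R z ^ (s : ℝ) * timeCutoff δ z.1) * c ≤
    ∫ z in cutoffCylinder n δ T R, {z | 1 ≤ ‖parabolicScaling n T R z‖}.indicator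
      (fun z => (s * C * T⁻¹ * w z + s * C * ‖B z‖ * R⁻¹) *
        (cylinderCutoff T R z ^ ((s : ℝ) - 1) * timeCutoff δ z.1)) z := by
  have hs0 : s ≠ 0 := by omega
  have hs1 : (1 : ℝ) ≤ s := by exact_mod_cast hs
  set ζ : 𝓓(halfSpace n, ℝ) := cutoffTest hδ hT hR hs0 with hζdef
  set K := cutoffCylinder n δ T R with hKdef
  have hKc : IsCompact K := isCompact_cutoffCylinder δ T R
  have hζ : ∀ z, ζ z = cylinderCutoff T R z ^ (s : ℝ) * timeCutoff δ z.1 := fun z => by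
    rw [hζdef, cutoffTest_apply, Real.rpow_natCast, mul_comm]
  have hpow : ∀ z : ℝ × EuclideanSpace ℝ (Fin n),
      cylinderCutoff T R z ^ (s - 1) = cylinderCutoff T R z ^ ((s : ℝ) - 1) := fun z => by
    rw [← Real.rpow_natCast, Nat.cast_sub hs, Nat.cast_one]
  have hζ0 : ∀ z ∉ K, ζ z = 0 := fun z hz => cutoffTest_eq_zero hδ hT hR hs0 hz
  have hζ1 : ∀ z ∉ K, fderiv ℝ ζ z = 0 := fun z hz => fderiv_cutoffTest_eq_zero hδ hT hR hs0 hz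
  have hcs := continuous_cutoff_rpow (n := n) (by linarith : (0 : ℝ) ≤ s) δ T R
  have hcs1 := continuous_cutoff_rpow (n := n) (by linarith : (0 : ℝ) ≤ (s : ℝ) - 1) δ T R
  have hζ'c : Continuous (fderiv ℝ ζ) := ζ.contDiff.continuous_fderiv (by simp)
  have hτc : Continuous fun z => fderiv ℝ ζ z (1, 0) := hζ'c.clm_apply continuous_const
  have onK : ∀ {g : ℝ × EuclideanSpace ℝ (Fin n) → ℝ}, LocallyIntegrableOn g (halfSpace n) →
      IntegrableOn g K := fun hg => integrableOn_of_locallyIntegrableOn hg hδ T R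
  have itest := h.test ζ (cutoffTest_nonneg hδ hT hR hs0)
  have itime := h.weak_time ζ
  simp only [sum_mul_clm_eq] at itest
  rw [setIntegral_eq hδ (T := T) (R := R) (fun z hz => by simp [hζ0 z hz, hζ1 z hz])] at itest
  rw [setIntegral_eq hδ (T := T) (R := R) (fun z hz => by simp [hζ1 z hz]),
    setIntegral_eq hδ (T := T) (R := R) (fun z hz => by simp [hζ0 z hz])] at itime
  have i1 : IntegrableOn (fun z => wt z * ζ z) K :=
    (onK h.locallyIntegrable_time).mul_continuousOn ζ.continuous.continuousOn hKc
  have i2 : IntegrableOn (fun z => fderiv ℝ ζ z (0, B z)) K := by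
    simpa using h.integrableOn_fderiv_flux hδ T R one_pos le_rfl hζ'c
  have i3 : IntegrableOn (fun z => f z * ζ z) K :=
    (onK h.locallyIntegrable_reaction).mul_continuousOn ζ.continuous.continuousOn hKc
  have i4 : IntegrableOn (fun z => w z * fderiv ℝ ζ z (1, 0)) K :=
    (onK h.locallyIntegrable).mul_continuousOn hτc.continuousOn hKc
  have i5 : IntegrableOn (fun z => w z ^ q *
      (cylinderCutoff T R z ^ (s : ℝ) * timeCutoff δ z.1)) K :=
    (onK h.locallyIntegrable_rpow).mul_continuousOn hcs.continuousOn hKc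
  have hA : MeasurableSet {z : ℝ × EuclideanSpace ℝ (Fin n) | 1 ≤ ‖parabolicScaling n T R z‖} :=
    (isClosed_le continuous_const (parabolicScaling n T R).continuous.norm).measurableSet
  have i6 : IntegrableOn ({z | 1 ≤ ‖parabolicScaling n T R z‖}.indicator
      (fun z => (s * C * T⁻¹ * w z + s * C * ‖B z‖ * R⁻¹) *
        (cylinderCutoff T R z ^ ((s : ℝ) - 1) * timeCutoff δ z.1))) K := by
    refine Integrable.indicator (IntegrableOn.mul_continuousOn ?_ hcs1.continuousOn hKc) hA
    exact ((onK h.locallyIntegrable).const_mul _).add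
      (((onK h.locallyIntegrableOn_norm_flux).const_mul _).mul_const _)
  have e1 : ∫ z in K, (wt z * ζ z + fderiv ℝ ζ z (0, B z) - f z * ζ z) =
      (∫ z in K, wt z * ζ z) + (∫ z in K, fderiv ℝ ζ z (0, B z)) - ∫ z in K, f z * ζ z := by
    have e := integral_sub (i1.add i2) i3
    simp only [Pi.add_apply] at e
    rw [e, integral_add i1 i2]
  have e2 : ∫ z in K, (fderiv ℝ ζ z (0, B z) - w z * fderiv ℝ ζ z (1, 0)) =
      (∫ z in K, fderiv ℝ ζ z (0, B z)) - ∫ z in K, w z * fderiv ℝ ζ z (1, 0) :=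
    integral_sub i2 i4
  have e3 : ∫ z in K, w z ^ q * (cylinderCutoff T R z ^ (s : ℝ) * timeCutoff δ z.1) * c ≤
      ∫ z in K, f z * ζ z := by
    refine integral_mono_ae (i5.mul_const c) i3 ?_
    filter_upwards [h.ae_reaction hδ T R] with z hz
    have := mul_le_mul_of_nonneg_right hz (cutoffTest_nonneg hδ hT hR hs0 z)
    rw [← hζdef, hζ] at this
    rw [hζ]
    linarith
  -- The indicator is kept this time: the tail estimate depends on errors living only in the outer
  -- region.
  have e4 := integral_mono (i2.sub i4) i6 fun z => by
    have hw := h.nonneg z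
    have h1 := mul_le_mul_of_nonneg_left (neg_fderiv_cutoffTest_time_le hδ hT hR hs0 hC z) hw
    have h2 := (le_abs_self _).trans (abs_fderiv_cutoffTest_space_le hδ hT hR hs0 hC z (B z))
    rw [← hζdef] at h1 h2
    simp only [Pi.sub_apply]
    by_cases hz : z ∈ {z : ℝ × EuclideanSpace ℝ (Fin n) | 1 ≤ ‖parabolicScaling n T R z‖}
    · simp only [Set.indicator_of_mem hz, hpow] at h1 h2 ⊢
      linarith
    · simp only [Set.indicator_of_notMem hz] at h1 h2 ⊢
      linarith
  simp only [Pi.sub_apply] at e4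
  linarith

/-! ### Bounds at the natural scale -/

/-- The gradient term of the energy is bounded at the natural scale. -/
theorem exists_gradient_bound (hp : 1 < p) (hq : 1 < q) (hpq : p - 1 < q)
    (h : DifferenceInequality n p q c w wt f B D) (hc : 0 < c) {ν : ℝ} (hν : 0 < ν)
    (hνp : ν ≤ p - 1) (hν1 : ν < 1) {s : ℕ} (hps : p < s)
    (hs1 : 1 * (q - ν) / (q - ν - (1 - ν)) ≤ s)
    (hs2 : p * (q - ν) / (q - ν - (p - 1 - ν)) ≤ s) {δ : ℝ} (hδ : 0 < δ) :
    ∃ G : ℝ, 0 ≤ G ∧ ∀ T R lam ε : ℝ, 0 < T → 0 < R → T⁻¹ = lam ^ (q - 1) →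
      R⁻¹ = lam ^ ((q - p + 1) / p) → 0 < ε → ε ≤ lam →
      lam ^ ν * ∫ z in cutoffCylinder n δ T R, inner ℝ (B z) (D z) * (w z + ε) ^ (-ν - 1) *
        (cylinderCutoff T R z ^ (s : ℝ) * timeCutoff δ z.1) ≤
      G * (lam ^ q * volume.real (cutoffCylinder n δ T R)) := by
  obtain ⟨C, hC0, hC⟩ := exists_bound_fderiv_unitBump n
  set C₁ : ℝ := s * C / (1 - ν) with hC₁def
  have hC₁ : 0 ≤ C₁ := div_nonneg (by positivity) (by linarith)
  obtain ⟨M, hM, habs⟩ := exists_energy_absorption hp hq hpq hν hνp hν1 hps hs1 hs2 hc hC₁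
  have hs : 1 ≤ s := by
    have : (1 : ℝ) ≤ s := by linarith
    exact_mod_cast this
  refine ⟨2 / ν * M, by positivity, fun T R lam ε hT hR hTl hRl hε hεl => ?_⟩
  have hlam : 0 < lam := hε.trans_le hεl
  have hs1 : (1 : ℝ) ≤ s := by exact_mod_cast hs
  have henergy := h.cylinder_energy_estimate hp hC0 hC hδ hT hR hs hν hν1 hε
  set K := cutoffCylinder n δ T R with hK
  have hKf : volume K ≠ ⊤ := (isCompact_cutoffCylinder δ T R).measure_lt_top.ne
  have hcs := continuous_cutoff_rpow (n := n) (by linarith : (0 : ℝ) ≤ s) δ T R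
  have hcs1 := continuous_cutoff_rpow (n := n) (by linarith : (0 : ℝ) ≤ (s : ℝ) - 1) δ T R
  have i1 := h.integrableOn_mul_rpow hδ T R hε (r := -ν) (by linarith) h.locallyIntegrable_rpow hcs
  have i2 := h.integrableOn_mul_rpow hδ T R hε (r := -ν - 1) (by linarith)
    (h.locallyIntegrableOn_inner hp) hcs
  have i3 := h.integrableOn_add_rpow hδ T R hε (r := 1 - ν) (by linarith) (by linarith) hcs1
  have i4 := h.integrableOn_mul_rpow hδ T R hε (r := -ν) (by linarith)
    h.locallyIntegrableOn_norm_flux hcs1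
  have i5 : IntegrableOn (fun _ : ℝ × EuclideanSpace ℝ (Fin n) => M * lam ^ (q - ν)) K :=
    integrableOn_const hKf
  -- The absorption is integrated over the cylinder. Its reaction term equals the one in the energy
  -- estimate and cancels, leaving half of the gradient energy, hence the factor 2/ν.
  have hmono := integral_mono ((i3.const_mul (C₁ * T⁻¹)).add (i4.const_mul (C₁ * R⁻¹)))
    (((i1.mul_const c).add (i2.const_mul (ν / 2))).add i5) fun z => by
      have hw := h.nonneg z
      have hx := cylinderCutoff_nonneg T R z
      have hx1 := cylinderCutoff_le_one T R z
      have hθ := timeCutoff_nonneg δ z.1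
      have hθ1 := timeCutoff_le_one δ z.1
      have h1 := mul_le_mul_of_nonneg_right
        (habs (w z) ‖B z‖ (inner ℝ (B z) (D z)) (cylinderCutoff T R z) lam ε hw (norm_nonneg _)
          (h.coercive z) hx hx1 hε hεl) hθ
      have h2 : M * lam ^ (q - ν) * timeCutoff δ z.1 ≤ M * lam ^ (q - ν) :=
        mul_le_of_le_one_right (by positivity) hθ1
      simp only [Pi.add_apply]
      rw [hTl, hRl]
      linarith
  simp only [Pi.add_apply] at hmono
  have e1 := integral_add (i3.const_mul (C₁ * T⁻¹)) (i4.const_mul (C₁ * R⁻¹))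
  have e2 := integral_add ((i1.mul_const c).add (i2.const_mul (ν / 2))) i5
  have e3 := integral_add (i1.mul_const c) (i2.const_mul (ν / 2))
  simp only [Pi.add_apply] at e1 e2 e3
  rw [e1, e2, e3, integral_const_mul, integral_const_mul, integral_const_mul (ν / 2),
    setIntegral_const, smul_eq_mul] at hmono
  set I := ∫ z in K, inner ℝ (B z) (D z) * (w z + ε) ^ (-ν - 1) *
        (cylinderCutoff T R z ^ (s : ℝ) * timeCutoff δ z.1) with hI
  have hIle : ν / 2 * I ≤ volume.real K * (M * lam ^ (q - ν)) := by linarith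
  have e : lam ^ q = lam ^ ν * lam ^ (q - ν) := by
    rw [← Real.rpow_add hlam]; ring_nf
  calc lam ^ ν * I = lam ^ ν * (2 / ν) * (ν / 2 * I) := by field_simp
    _ ≤ lam ^ ν * (2 / ν) * (volume.real K * (M * lam ^ (q - ν))) := by gcongr
    _ = _ := by rw [e]; ring

/-- The reaction term on cylinders is bounded at the natural scale. -/
theorem exists_reaction_bound (hp : 1 < p) (hq : 1 < q) (hpq : p - 1 < q)
    (h : DifferenceInequality n p q c w wt f B D) (hc : 0 < c) {ν : ℝ} (hν : 0 < ν)
    (hνp : ν ≤ p - 1) (hν1 : ν < 1) (hνq : (1 + ν) * (p - 1) < q) {s : ℕ} (hps : p < s)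
    (hs1 : 1 * (q - ν) / (q - ν - (1 - ν)) ≤ s)
    (hs2 : p * (q - ν) / (q - ν - (p - 1 - ν)) ≤ s) (hs3 : 1 * q / (q - 1) ≤ s)
    (hs4 : p * q / (q - (1 + ν) * (p - 1)) ≤ s) {δ : ℝ} (hδ : 0 < δ) :
    ∃ G : ℝ, 0 ≤ G ∧ ∀ T R lam : ℝ, 0 < T → 0 < R → T⁻¹ = lam ^ (q - 1) →
      R⁻¹ = lam ^ ((q - p + 1) / p) → 0 < lam →
      ∫ z in cutoffCylinder n δ T R, w z ^ q *
        (cylinderCutoff T R z ^ (s : ℝ) * timeCutoff δ z.1) ≤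
      G * (lam ^ q * volume.real (cutoffCylinder n δ T R)) := by
  obtain ⟨C, hC0, hC⟩ := exists_bound_fderiv_unitBump n
  obtain ⟨G, hG0, hG⟩ := h.exists_gradient_bound hp hq hpq hc hν hνp hν1 hps hs1 hs2 hδ
  obtain ⟨M, hM, habs⟩ := exists_cutoff_absorption_reaction hp hq hν hνq hps hs3 hs4 hc
    (by positivity : 0 ≤ s * C)
  have hs1 : (1 : ℝ) ≤ s := by linarith
  have hs : 1 ≤ s := by exact_mod_cast hs1
  refine ⟨2 / c * (G + M), by positivity, fun T R lam hT hR hTl hRl hlam => ?_⟩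
  have htest := h.cylinder_test_estimate hC hδ hT hR hs
  -- The regularization ε = λ suffices for a bound with no smallness.
  have hgrad := hG T R lam lam hT hR hTl hRl hlam le_rfl
  set K := cutoffCylinder n δ T R with hK
  have hKc : IsCompact K := isCompact_cutoffCylinder δ T R
  have hKf : volume K ≠ ⊤ := hKc.measure_lt_top.ne
  have hcs := continuous_cutoff_rpow (n := n) (by linarith : (0 : ℝ) ≤ s) δ T R
  have i1 : IntegrableOn (fun z => w z ^ q *
      (cylinderCutoff T R z ^ (s : ℝ) * timeCutoff δ z.1)) K :=
    (integrableOn_of_locallyIntegrableOn h.locallyIntegrable_rpow hδ T R).mul_continuousOn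
      hcs.continuousOn hKc
  have i2 := h.integrableOn_mul_rpow hδ T R hlam (r := -ν - 1) (by linarith)
    (h.locallyIntegrableOn_inner hp) hcs
  have i3 : IntegrableOn (fun _ : ℝ × EuclideanSpace ℝ (Fin n) => M * lam ^ q) K :=
    integrableOn_const hKf
  have hmono := integral_mono_of_nonneg (μ := volume.restrict K)
    (Eventually.of_forall fun z => Set.indicator_nonneg (fun z _ => ?_) z)
    (((i2.const_mul (lam ^ ν)).add (i1.const_mul (c / 2))).add i3)
    (Eventually.of_forall fun z => ?_) (f := {z | 1 ≤ ‖parabolicScaling n T R z‖}.indicator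
      (fun z => (s * C * T⁻¹ * w z + s * C * ‖B z‖ * R⁻¹) *
        (cylinderCutoff T R z ^ ((s : ℝ) - 1) * timeCutoff δ z.1)))
  · have hle := htest.trans hmono
    simp only [Pi.add_apply] at hle
    have e2 := integral_add ((i2.const_mul (lam ^ ν)).add (i1.const_mul (c / 2))) i3
    have e3 := integral_add (i2.const_mul (lam ^ ν)) (i1.const_mul (c / 2))
    simp only [Pi.add_apply] at e2 e3
    rw [e2, e3, integral_const_mul, integral_const_mul, integral_mul_const, setIntegral_const,
      smul_eq_mul] at hle
    set J := ∫ z in K, w z ^ q * (cylinderCutoff T R z ^ (s : ℝ) * timeCutoff δ z.1)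
    have hJ : c / 2 * J ≤ (G + M) * (lam ^ q * volume.real K) := by linarith
    calc J = 2 / c * (c / 2 * J) := by field_simp
      _ ≤ 2 / c * ((G + M) * (lam ^ q * volume.real K)) := by gcongr
      _ = _ := by ring
  · have hw := h.nonneg z
    have hx := cylinderCutoff_nonneg T R z
    have hθ := timeCutoff_nonneg δ z.1
    positivity
  · have hw := h.nonneg z
    have hx := cylinderCutoff_nonneg T R z
    have hx1 := cylinderCutoff_le_one T R z
    have hθ := timeCutoff_nonneg δ z.1
    have hθ1 := timeCutoff_le_one δ z.1
    refine (Set.indicator_le_self' (fun z _ => ?_) z).trans ?_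
    · have hw := h.nonneg z
      have hx := cylinderCutoff_nonneg T R z
      have hθ := timeCutoff_nonneg δ z.1
      positivity
    · have h1 := mul_le_mul_of_nonneg_right
        (habs (w z) ‖B z‖ (inner ℝ (B z) (D z)) (cylinderCutoff T R z) lam hw (norm_nonneg _)
          (h.coercive z) hx hx1 hlam) hθ
      have h2 : M * lam ^ q * timeCutoff δ z.1 ≤ M * lam ^ q :=
        mul_le_of_le_one_right (by positivity) hθ1
      simp only [Pi.add_apply]
      rw [hTl, hRl]
      linarith

/-- The reaction term on a cylinder is controlled by its part near the boundary of the cylinder. -/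
theorem exists_reaction_tail_bound (hp : 1 < p) (hq : 1 < q) (hpq : p - 1 < q)
    (h : DifferenceInequality n p q c w wt f B D) (hc : 0 < c) {ν : ℝ} (hν : 0 < ν)
    (hνp : ν ≤ p - 1) (hν1 : ν < 1) (hνq : (1 + ν) * (p - 1) < q) {s : ℕ} (hps : p < s)
    (hs1 : 1 * (q - ν) / (q - ν - (1 - ν)) ≤ s)
    (hs2 : p * (q - ν) / (q - ν - (p - 1 - ν)) ≤ s) (hs3 : 1 * q / (q - 1) ≤ s)
    (hs4 : p * q / (q - (1 + ν) * (p - 1)) ≤ s) {δ : ℝ} (hδ : 0 < δ) :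
    ∃ G : ℝ, 0 ≤ G ∧ ∀ η : ℝ, 0 < η → ∃ M : ℝ, 0 ≤ M ∧ ∀ T R lam : ℝ, 0 < T → 0 < R →
      T⁻¹ = lam ^ (q - 1) → R⁻¹ = lam ^ ((q - p + 1) / p) → 0 < lam →
      c * ∫ z in cutoffCylinder n δ T R, w z ^ q *
        (cylinderCutoff T R z ^ (s : ℝ) * timeCutoff δ z.1) ≤
      η * (G * (lam ^ q * volume.real (cutoffCylinder n δ T R))) +
        M * ∫ z in cutoffCylinder n δ T R, {z | 1 ≤ ‖parabolicScaling n T R z‖}.indicator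
          (fun z => w z ^ q * (cylinderCutoff T R z ^ (s : ℝ) * timeCutoff δ z.1)) z := by
  obtain ⟨C, hC0, hC⟩ := exists_bound_fderiv_unitBump n
  obtain ⟨G, hG0, hG⟩ := h.exists_gradient_bound hp hq hpq hc hν hνp hν1 hps hs1 hs2 hδ
  have hs1 : (1 : ℝ) ≤ s := by linarith
  have hs : 1 ≤ s := by exact_mod_cast hs1
  -- The summand 1 accounts for the direct remainder η λ^q.
  refine ⟨G + 1, by positivity, fun η hη => ?_⟩
  obtain ⟨M, κ, hM, hκ0, hκ1, habs⟩ := exists_cutoff_absorption_scale hp hq hν hνq hps hs3 hs4 hc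
    (by positivity : 0 ≤ s * C) hη
  refine ⟨M, hM, fun T R lam hT hR hTl hRl hlam => ?_⟩
  have hε : 0 < κ * lam := by positivity
  have htest := h.cylinder_test_estimate hC hδ hT hR hs
  -- The constant in the gradient bound is uniform in ε ≤ λ, so it does not deteriorate with κ, and
  -- hence not with η.
  have hgrad := hG T R lam (κ * lam) hT hR hTl hRl hε (mul_le_of_le_one_left hlam.le hκ1)
  set K := cutoffCylinder n δ T R with hK
  set A := {z : ℝ × EuclideanSpace ℝ (Fin n) | 1 ≤ ‖parabolicScaling n T R z‖} with hAdef
  have hA : MeasurableSet A :=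
    (isClosed_le continuous_const (parabolicScaling n T R).continuous.norm).measurableSet
  have hKc : IsCompact K := isCompact_cutoffCylinder δ T R
  have hKf : volume K ≠ ⊤ := hKc.measure_lt_top.ne
  have hcs := continuous_cutoff_rpow (n := n) (by linarith : (0 : ℝ) ≤ s) δ T R
  have i1 : IntegrableOn (fun z => w z ^ q *
      (cylinderCutoff T R z ^ (s : ℝ) * timeCutoff δ z.1)) K :=
    (integrableOn_of_locallyIntegrableOn h.locallyIntegrable_rpow hδ T R).mul_continuousOn
      hcs.continuousOn hKc
  have i1' := Integrable.indicator i1 hA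
  have i2 := h.integrableOn_mul_rpow hδ T R hε (r := -ν - 1) (by linarith)
    (h.locallyIntegrableOn_inner hp) hcs
  have i3 : IntegrableOn (fun _ : ℝ × EuclideanSpace ℝ (Fin n) => η * lam ^ q) K :=
    integrableOn_const hKf
  have hmono := integral_mono_of_nonneg (μ := volume.restrict K)
    (Eventually.of_forall fun z => Set.indicator_nonneg (fun z _ => ?_) z)
    (((i2.const_mul (η * lam ^ ν)).add (i1'.const_mul M)).add i3)
    (Eventually.of_forall fun z => ?_) (f := A.indicator
      (fun z => (s * C * T⁻¹ * w z + s * C * ‖B z‖ * R⁻¹) *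
        (cylinderCutoff T R z ^ ((s : ℝ) - 1) * timeCutoff δ z.1)))
  · have hle := htest.trans hmono
    simp only [Pi.add_apply] at hle
    have e2 := integral_add ((i2.const_mul (η * lam ^ ν)).add (i1'.const_mul M)) i3
    have e3 := integral_add (i2.const_mul (η * lam ^ ν)) (i1'.const_mul M)
    simp only [Pi.add_apply] at e2 e3
    rw [e2, e3, integral_const_mul, integral_const_mul, integral_mul_const, setIntegral_const,
      smul_eq_mul] at hle
    have := mul_le_mul_of_nonneg_left hgrad hη.le
    linarith
  · have hw := h.nonneg z
    have hx := cylinderCutoff_nonneg T R z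
    have hθ := timeCutoff_nonneg δ z.1
    positivity
  · have hw := h.nonneg z
    have hx := cylinderCutoff_nonneg T R z
    have hx1 := cylinderCutoff_le_one T R z
    have hθ := timeCutoff_nonneg δ z.1
    have hθ1 := timeCutoff_le_one δ z.1
    have hW : 0 ≤ w z + κ * lam := by linarith
    have hX : 0 ≤ inner ℝ (B z) (D z) := le_trans (by positivity) (h.coercive z)
    simp only [Pi.add_apply]
    by_cases hz : z ∈ A
    · simp only [Set.indicator_of_mem hz]
      have h1 := mul_le_mul_of_nonneg_right
        (habs (w z) ‖B z‖ (inner ℝ (B z) (D z)) (cylinderCutoff T R z) lam hw (norm_nonneg _)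
          (h.coercive z) hx hx1 hlam) hθ
      have h2 : η * lam ^ q * timeCutoff δ z.1 ≤ η * lam ^ q :=
        mul_le_of_le_one_right (by positivity) hθ1
      rw [hTl, hRl]
      linarith
    · simp only [Set.indicator_of_notMem hz]
      positivity

/-! ### Choice of scale and vanishing of the difference -/

/-- Choice of the space-time scale with `lam ^ q` times the volume of the cylinder bounded. -/
theorem exists_scale (hn : 1 ≤ n) (hp : 1 < p) (hq : 1 < q) (hpq : p - 1 < q)
    (hq2 : q ≤ p - 1 + p / (n : ℝ)) {δ : ℝ} (hδ : 0 < δ) :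
    ∃ V : ℝ, 0 ≤ V ∧ ∃ T R lam : ℕ → ℝ, (∀ k, 0 < T k) ∧ (∀ k, 0 < R k) ∧ (∀ k, 0 < lam k) ∧
      (∀ k, (T k)⁻¹ = lam k ^ (q - 1)) ∧ (∀ k, (R k)⁻¹ = lam k ^ ((q - p + 1) / p)) ∧
      Tendsto (fun k => (T k)⁻¹) atTop (𝓝 0) ∧ Tendsto (fun k => (R k)⁻¹) atTop (𝓝 0) ∧
      ∀ k, lam k ^ q * volume.real (cutoffCylinder n δ (T k) (R k)) ≤ V := by
  have hd : 0 < q - p + 1 := by linarith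
  have hp0 : 0 < p := by linarith
  have hn0 : (0 : ℝ) < n := by exact_mod_cast hn
  -- With R = k + 1 and λ = R^(-a), the radius relation holds and λ^q T R^n = λ R^n = R^(n-a). The
  -- upper bound on q says exactly n ≤ a.
  set a := p / (q - p + 1) with ha
  have ha0 : 0 < a := by positivity
  have han : (n : ℝ) ≤ a := by
    rw [ha, le_div_iff₀ hd]
    have : q - p + 1 ≤ p / n := by linarith
    calc (n : ℝ) * (q - p + 1) ≤ n * (p / n) := by gcongr
      _ = p := by field_simp
  set v := (volume : Measure (EuclideanSpace ℝ (Fin n))).real (Metric.ball 0 1) with hv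
  have hR : ∀ k : ℕ, (0 : ℝ) < (k : ℝ) + 1 := fun k => by positivity
  have hlam : ∀ k : ℕ, 0 < ((k : ℝ) + 1) ^ (-a) := fun k => Real.rpow_pos_of_pos (hR k) _
  have hkt : Tendsto (fun k : ℕ => (k : ℝ) + 1) atTop atTop :=
    tendsto_atTop_add_const_right _ _ tendsto_natCast_atTop_atTop
  refine ⟨2 * 2 ^ n * v, by positivity, fun k => (((k : ℝ) + 1) ^ (-a)) ^ (-(q - 1)),
    fun k => (k : ℝ) + 1, fun k => ((k : ℝ) + 1) ^ (-a),
    fun k => Real.rpow_pos_of_pos (hlam k) _, hR, hlam, ?_, ?_, ?_, ?_, ?_⟩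
  · intro k
    dsimp only
    rw [Real.rpow_neg (hlam k).le, inv_inv]
  · intro k
    dsimp only
    rw [← Real.rpow_mul (hR k).le]
    have : -a * ((q - p + 1) / p) = -1 := by rw [ha]; field_simp
    rw [this, Real.rpow_neg_one]
  · have h1 : ∀ k : ℕ, ((((k : ℝ) + 1) ^ (-a)) ^ (-(q - 1)))⁻¹ = ((k : ℝ) + 1) ^ (-(a * (q - 1))) := by
      intro k
      rw [Real.rpow_neg (hlam k).le, inv_inv, ← Real.rpow_mul (hR k).le, neg_mul]
    simp only [h1]
    exact (tendsto_rpow_neg_atTop (mul_pos ha0 (by linarith))).comp hkt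
  · exact tendsto_inv_atTop_zero.comp hkt
  · intro k
    set R := (k : ℝ) + 1
    set lam := R ^ (-a) with hl
    have hR1 : 1 ≤ R := by simp [R]
    have hvol := volume_real_cutoffCylinder_le (n := n) hδ
      (Real.rpow_pos_of_pos (hlam k) (-(q - 1))) (hR k)
    have hlp := hlam k
    calc lam ^ q * volume.real (cutoffCylinder n δ (lam ^ (-(q - 1))) R)
        ≤ lam ^ q * (2 * lam ^ (-(q - 1)) * ((2 * R) ^ n * v)) := by gcongr
      _ = 2 * 2 ^ n * v * ((lam ^ q * lam ^ (-(q - 1))) * R ^ n) := by rw [mul_pow]; ring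
      _ = 2 * 2 ^ n * v * (R ^ (-a) * R ^ (n : ℝ)) := by
        rw [← Real.rpow_add hlp, Real.rpow_natCast]
        have : q + -(q - 1) = 1 := by ring
        rw [this, Real.rpow_one]
      _ = 2 * 2 ^ n * v * R ^ (-a + n) := by rw [Real.rpow_add (hR k)]
      _ ≤ 2 * 2 ^ n * v * 1 := by
        gcongr
        exact Real.rpow_le_one_of_one_le_of_nonpos hR1 (by linarith)
      _ = _ := mul_one _

/-- A nonnegative function satisfying the differential inequality in the subcritical range
vanishes. -/
theorem ae_eq_zero (hn : 1 ≤ n) (hp : 1 < p) (hp2 : p ≤ 2) (hq : 1 < q)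
    (hq2 : q ≤ p - 1 + p / (n : ℝ)) (hc : 0 < c)
    (h : DifferenceInequality n p q c w wt f B D) :
    ∀ᵐ z ∂(volume.restrict (halfSpace n : Set (ℝ × EuclideanSpace ℝ (Fin n)))), w z = 0 := by
  have hpq : p - 1 < q := by linarith
  set S := (halfSpace n : Set (ℝ × EuclideanSpace ℝ (Fin n))) with hSdef
  have hSm : MeasurableSet S := (halfSpace n).isOpen.measurableSet
  -- Half of p - 1 gives ν < 1 and ν ≤ p - 1; half of q - 1, together with p ≤ 2, gives (1+ν)(p-1) ≤
  -- 1 + ν < q.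
  set ν := min (p - 1) (q - 1) / 2 with hνdef
  have hν : 0 < ν := by
    have : 0 < min (p - 1) (q - 1) := lt_min (by linarith) (by linarith)
    positivity
  have hν1' : ν ≤ (p - 1) / 2 := by rw [hνdef]; gcongr; exact min_le_left _ _
  have hν2' : ν ≤ (q - 1) / 2 := by rw [hνdef]; gcongr; exact min_le_right _ _
  have hνp : ν ≤ p - 1 := by linarith
  have hν1 : ν < 1 := by linarith
  have hνq : (1 + ν) * (p - 1) < q := by nlinarith
  obtain ⟨s, hs⟩ := exists_nat_gt (max p (max (1 * (q - ν) / (q - ν - (1 - ν)))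
    (max (p * (q - ν) / (q - ν - (p - 1 - ν))) (max (1 * q / (q - 1))
      (p * q / (q - (1 + ν) * (p - 1)))))))
  simp only [max_lt_iff] at hs
  obtain ⟨hps, hs1, hs2, hs3, hs4⟩ := hs
  -- For fixed δ the constants may depend on δ; only the cylinder grows. The time cutoff is removed
  -- at the end by taking δ = 1/(k+1).
  have main : ∀ δ : ℝ, 0 < δ → ∀ᵐ z ∂(volume.restrict S), w z ^ q * timeCutoff δ z.1 = 0 := by
    intro δ hδ
    obtain ⟨V, hV, T, R, lam, hT, hR, hlam, hTl, hRl, hTlim, hRlim, hvol⟩ :=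
      exists_scale hn hp hq hpq hq2 hδ
    obtain ⟨G₁, hG₁, hbd⟩ := h.exists_reaction_bound hp hq hpq hc hν hνp hν1 hνq hps hs1.le hs2.le
      hs3.le hs4.le hδ
    obtain ⟨G₂, hG₂, htail⟩ := h.exists_reaction_tail_bound hp hq hpq hc hν hνp hν1 hνq hps hs1.le
      hs2.le hs3.le hs4.le hδ
    set g : ℝ × EuclideanSpace ℝ (Fin n) → ℝ := fun z => w z ^ q * timeCutoff δ z.1 with hg
    have hg0 : ∀ z, 0 ≤ g z := fun z =>
      mul_nonneg (Real.rpow_nonneg (h.nonneg z) _) (timeCutoff_nonneg _ _)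
    -- The regions where the cylinder cutoff equals 1; they exhaust the half-space because T and R
    -- tend to infinity.
    let φ : ℕ → Set (ℝ × EuclideanSpace ℝ (Fin n)) := fun k =>
      {z | ‖parabolicScaling n (T k) (R k) z‖ < 1}
    have hφm : ∀ k, MeasurableSet (φ k) := fun k =>
      (isOpen_lt (parabolicScaling n (T k) (R k)).continuous.norm continuous_const).measurableSet
    have hcover : AECover (volume.restrict S) atTop φ := by
      refine ⟨Eventually.of_forall fun z => ?_, hφm⟩
      have h1 : Tendsto (fun k => parabolicScaling n (T k) (R k) z) atTop (𝓝 0) := by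
        have := (hTlim.mul_const z.1).prodMk_nhds (hRlim.smul_const z.2)
        simp only [zero_mul, zero_smul] at this
        exact this
      have h2 := h1.norm
      rw [norm_zero] at h2
      exact h2.eventually (gt_mem_nhds one_pos)
    set j : ℕ → ℝ × EuclideanSpace ℝ (Fin n) → ℝ := fun k z => w z ^ q *
      (cylinderCutoff (T k) (R k) z ^ (s : ℝ) * timeCutoff δ z.1) with hj
    have hs0 : (s : ℝ) ≠ 0 := by linarith
    have hjK : ∀ k, ∀ z ∉ cutoffCylinder n δ (T k) (R k), j k z = 0 := by
      intro k z hz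
      rcases cutoff_eq_zero hδ (hT k) (hR k) hz with h | h <;>
        simp only [hj, h, Real.zero_rpow hs0, mul_zero, zero_mul]
    have hj0 : ∀ k z, 0 ≤ j k z := fun k z => mul_nonneg (Real.rpow_nonneg (h.nonneg z) _)
      (mul_nonneg (Real.rpow_nonneg (cylinderCutoff_nonneg _ _ _) _) (timeCutoff_nonneg _ _))
    have hjle : ∀ k z, j k z ≤ g z := fun k z => by
      have h1 := Real.rpow_le_one (cylinderCutoff_nonneg (T k) (R k) z)
        (cylinderCutoff_le_one (T k) (R k) z) (Nat.cast_nonneg s)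
      have h2 := mul_le_mul_of_nonneg_right h1 (hg0 z)
      simp only [hj, hg] at h2 ⊢
      linarith
    have hji : ∀ k, IntegrableOn (j k) S := by
      intro k
      have h1 : IntegrableOn (j k) (cutoffCylinder n δ (T k) (R k)) :=
        (integrableOn_of_locallyIntegrableOn h.locallyIntegrable_rpow hδ _ _).mul_continuousOn
          (continuous_cutoff_rpow (Nat.cast_nonneg s) δ _ _).continuousOn
          (isCompact_cutoffCylinder _ _ _)
      exact h1.of_forall_sdiff_eq_zero hSm fun z hz => hjK k z hz.2
    have hjφ : ∀ k, ∀ z ∈ φ k, j k z = g z := by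
      intro k z hz
      simp only [hj, hg]
      rw [cylinderCutoff_eq_one hz, Real.one_rpow, one_mul]
    have hgφ : ∀ k, IntegrableOn g (φ k) (volume.restrict S) := fun k =>
      (Integrable.integrableOn (hji k)).congr_fun (hjφ k) (hφm k)
    have hgle : ∀ k, ∫ z in φ k, g z ∂(volume.restrict S) ≤
        ∫ z in cutoffCylinder n δ (T k) (R k), j k z := by
      intro k
      rw [← setIntegral_eq hδ (hjK k), ← setIntegral_congr_fun (hφm k) (hjφ k)]
      exact setIntegral_le_integral (hji k) (Eventually.of_forall (hj0 k))
    -- The uniform bound on growing regions gives integrability of g; this is what makes the outer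
    -- integrals tend to zero.
    have hgi : Integrable g (volume.restrict S) := by
      refine hcover.integrable_of_integral_bounded_of_nonneg_ae (G₁ * V) hgφ
        (Eventually.of_forall hg0) (Eventually.of_forall fun k => (hgle k).trans ?_)
      exact (hbd _ _ _ (hT k) (hR k) (hTl k) (hRl k) (hlam k)).trans
        (mul_le_mul_of_nonneg_left (hvol k) hG₁)
    have hlim := hcover.integral_tendsto_of_countably_generated hgi
    have htailim : Tendsto (fun k => ∫ z in (φ k)ᶜ, g z ∂(volume.restrict S)) atTop (𝓝 0) := by
      have h1 := (tendsto_const_nhds (x := ∫ z, g z ∂(volume.restrict S))).sub hlim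
      rw [sub_self] at h1
      refine h1.congr fun k => ?_
      rw [← integral_add_compl (hφm k) hgi]; ring
    -- M depends on η but not on the cylinder, so the cylinder grows first, which removes the M
    -- term, and η tends to zero afterwards.
    have hle : ∀ η : ℝ, 0 < η → c * ∫ z, g z ∂(volume.restrict S) ≤ η * (G₂ * V) := by
      intro η hη
      obtain ⟨M, hM, hMb⟩ := htail η hη
      have h1 : ∀ k, c * ∫ z in φ k, g z ∂(volume.restrict S) ≤
          η * (G₂ * V) + M * ∫ z in (φ k)ᶜ, g z ∂(volume.restrict S) := by
        intro k
        refine (mul_le_mul_of_nonneg_left (hgle k) hc.le).trans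
          ((hMb _ _ _ (hT k) (hR k) (hTl k) (hRl k) (hlam k)).trans ?_)
        have hcompl : {z | 1 ≤ ‖parabolicScaling n (T k) (R k) z‖} = (φ k)ᶜ := by
          ext z; simp [φ]
        gcongr
        · exact hvol k
        · rw [hcompl, ← setIntegral_eq hδ (fun z hz => Set.indicator_apply_eq_zero.2
            fun _ => hjK k z hz), integral_indicator (hφm k).compl]
          exact integral_mono (Integrable.integrableOn (hji k)) hgi.integrableOn (hjle k)
      have h2 := le_of_tendsto_of_tendsto' (hlim.const_mul c)
        ((htailim.const_mul M).const_add (η * (G₂ * V))) h1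
      simpa using h2
    have hzero : ∫ z, g z ∂(volume.restrict S) = 0 := by
      refine le_antisymm ?_ (integral_nonneg hg0)
      have h1 : c * ∫ z, g z ∂(volume.restrict S) ≤ 0 := by
        refine le_of_forall_pos_le_add fun r hr => ?_
        have h2 := hle (r / (G₂ * V + 1)) (by positivity)
        refine h2.trans ?_
        rw [zero_add, div_mul_eq_mul_div, div_le_iff₀ (by positivity)]
        nlinarith
      nlinarith
    exact (integral_eq_zero_iff_of_nonneg hg0 hgi).1 hzero
  have hall := ae_all_iff.2 fun k : ℕ => main (1 / ((k : ℝ) + 1)) (by positivity)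
  filter_upwards [hall, ae_restrict_mem hSm] with z hz hzS
  have hz0 : 0 < z.1 := hzS
  obtain ⟨k, hk⟩ := exists_nat_one_div_lt (by linarith : 0 < z.1 / 2)
  have h1 := hz k
  rw [timeCutoff_eq_one (by positivity) (by linarith), mul_one] at h1
  exact (Real.rpow_eq_zero (h.nonneg z) (by linarith)).1 h1

end DifferenceInequality

/-! ### Reduction to the difference inequality -/

section Reduction

variable {n : ℕ}

theorem timeDeriv_eq_fderiv {φ : ℝ × EuclideanSpace ℝ (Fin n) → ℝ} (hφ : Differentiable ℝ φ)
    (z : ℝ × EuclideanSpace ℝ (Fin n)) : timeDeriv φ z = fderiv ℝ φ z (1, 0) := by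
  have h1 : HasFDerivAt φ (fderiv ℝ φ z) (z.1, z.2) := (hφ z).hasFDerivAt
  have h2 : HasDerivAt (fun t : ℝ => (t, z.2)) ((1 : ℝ), (0 : EuclideanSpace ℝ (Fin n))) z.1 :=
    (hasDerivAt_id z.1).prodMk (hasDerivAt_const z.1 z.2)
  exact (h1.comp_hasDerivAt z.1 h2).deriv

theorem spaceDeriv_eq_fderiv {φ : ℝ × EuclideanSpace ℝ (Fin n) → ℝ} (hφ : Differentiable ℝ φ)
    (i : Fin n) (z : ℝ × EuclideanSpace ℝ (Fin n)) :
    spaceDeriv i φ z = fderiv ℝ φ z (0, EuclideanSpace.single i 1) := by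
  have h1 : HasFDerivAt φ (fderiv ℝ φ z) (z.1, z.2) := (hφ z).hasFDerivAt
  have h2 : HasFDerivAt (𝕜 := ℝ) (fun x : EuclideanSpace ℝ (Fin n) => (z.1, x)) _ z.2 :=
    (hasFDerivAt_const z.1 z.2).prodMk (hasFDerivAt_id z.2)
  have h3 : HasFDerivAt (fun x : EuclideanSpace ℝ (Fin n) => φ (z.1, x)) _ z.2 := h1.comp z.2 h2
  rw [spaceDeriv, h3.fderiv]
  simp

theorem differentiable_testFunction {Ω : Opens (ℝ × EuclideanSpace ℝ (Fin n))} (φ : 𝓓(Ω, ℝ)) :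
    Differentiable ℝ φ := φ.contDiff.differentiable (by simp)

theorem HasWeakTimeDeriv.hasWeakDirDeriv {u ut : ℝ × EuclideanSpace ℝ (Fin n) → ℝ}
    (h : HasWeakTimeDeriv u ut) : HasWeakDirDeriv volume (halfSpace n) (1, 0) u ut := fun φ => by
  simpa only [timeDeriv_eq_fderiv (differentiable_testFunction φ)] using h.2.2 φ

theorem HasWeakSpaceGradient.hasWeakDirDeriv {u : ℝ × EuclideanSpace ℝ (Fin n) → ℝ}
    {g : ℝ × EuclideanSpace ℝ (Fin n) → EuclideanSpace ℝ (Fin n)}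
    (h : HasWeakSpaceGradient u g) (i : Fin n) :
    HasWeakDirDeriv volume (halfSpace n) (0, EuclideanSpace.single i 1) u (fun z => g z i) :=
  fun φ => by
    simpa only [spaceDeriv_eq_fderiv (differentiable_testFunction φ)] using h.2.2 i φ

theorem integrableOn_mul_of_support {Ω : Opens (ℝ × EuclideanSpace ℝ (Fin n))} (φ : 𝓓(Ω, ℝ))
    {g k : ℝ × EuclideanSpace ℝ (Fin n) → ℝ} (hg : LocallyIntegrableOn g Ω) (hk : Continuous k)
    (hkφ : ∀ z ∉ tsupport φ, k z = 0) :
    IntegrableOn (fun z => g z * k z) (Ω : Set (ℝ × EuclideanSpace ℝ (Fin n))) := by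
  have hK : IsCompact (tsupport φ) := φ.hasCompactSupport
  have h1 : IntegrableOn (fun z => g z * k z) (tsupport φ) :=
    (hg.integrableOn_compact_subset φ.tsupport_subset hK).mul_continuousOn hk.continuousOn hK
  exact h1.of_forall_sdiff_eq_zero Ω.isOpen.measurableSet fun z hz => by
    rw [hkφ z hz.2, mul_zero]

theorem integrableOn_mul_testFunction {Ω : Opens (ℝ × EuclideanSpace ℝ (Fin n))} (φ : 𝓓(Ω, ℝ))
    {g : ℝ × EuclideanSpace ℝ (Fin n) → ℝ} (hg : LocallyIntegrableOn g Ω) :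
    IntegrableOn (fun z => g z * φ z) (Ω : Set (ℝ × EuclideanSpace ℝ (Fin n))) :=
  integrableOn_mul_of_support φ hg φ.continuous fun _ hz => image_eq_zero_of_notMem_tsupport hz

theorem integrableOn_mul_fderiv_testFunction {Ω : Opens (ℝ × EuclideanSpace ℝ (Fin n))}
    (φ : 𝓓(Ω, ℝ)) {g : ℝ × EuclideanSpace ℝ (Fin n) → ℝ} (hg : LocallyIntegrableOn g Ω)
    (v : ℝ × EuclideanSpace ℝ (Fin n)) :
    IntegrableOn (fun z => g z * fderiv ℝ φ z v) (Ω : Set (ℝ × EuclideanSpace ℝ (Fin n))) :=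
  integrableOn_mul_of_support φ hg
    ((φ.contDiff.continuous_fderiv (by simp)).clm_apply continuous_const) fun z hz => by
      rw [fderiv_of_notMem_tsupport (𝕜 := ℝ) hz]; simp

theorem HasWeakDirDeriv.add {Ω : Opens (ℝ × EuclideanSpace ℝ (Fin n))}
    {e : ℝ × EuclideanSpace ℝ (Fin n)} {w₁ d₁ w₂ d₂ : ℝ × EuclideanSpace ℝ (Fin n) → ℝ}
    (h₁ : HasWeakDirDeriv volume Ω e w₁ d₁) (h₂ : HasWeakDirDeriv volume Ω e w₂ d₂)
    (hw₁ : LocallyIntegrableOn w₁ Ω) (hd₁ : LocallyIntegrableOn d₁ Ω)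
    (hw₂ : LocallyIntegrableOn w₂ Ω) (hd₂ : LocallyIntegrableOn d₂ Ω) :
    HasWeakDirDeriv volume Ω e (fun z => w₁ z + w₂ z) (fun z => d₁ z + d₂ z) := by
  intro φ
  simp only [add_mul]
  rw [integral_add (integrableOn_mul_fderiv_testFunction φ hw₁ e)
      (integrableOn_mul_fderiv_testFunction φ hw₂ e),
    integral_add (integrableOn_mul_testFunction φ hd₁) (integrableOn_mul_testFunction φ hd₂),
    h₁ φ, h₂ φ, neg_add]

theorem HasWeakDirDeriv.congr_ae {Ω : Opens (ℝ × EuclideanSpace ℝ (Fin n))}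
    {e : ℝ × EuclideanSpace ℝ (Fin n)} {w w' d : ℝ × EuclideanSpace ℝ (Fin n) → ℝ}
    (h : HasWeakDirDeriv volume Ω e w d)
    (hw : ∀ᵐ z ∂(volume.restrict (Ω : Set (ℝ × EuclideanSpace ℝ (Fin n)))), w z = w' z) :
    HasWeakDirDeriv volume Ω e w' d := by
  intro φ
  rw [← h φ]
  refine integral_congr_ae ?_
  filter_upwards [hw] with z hz
  rw [hz]

/-- The flux has norm ‖g‖^(p-1), which is at most 1 + ‖g‖^p. -/
theorem locallyIntegrableOn_flux {p : ℝ} (hp : 1 < p)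
    {g : ℝ × EuclideanSpace ℝ (Fin n) → EuclideanSpace ℝ (Fin n)}
    (hg : LocallyIntegrableOn g (halfSpace n))
    (hgp : LocallyIntegrableOn (fun z => ‖g z‖ ^ p) (halfSpace n)) :
    LocallyIntegrableOn (fun z => ‖g z‖ ^ (p - 2) • g z) (halfSpace n) := by
  have h1 : LocallyIntegrableOn (fun _ : ℝ × EuclideanSpace ℝ (Fin n) => (1 : ℝ)) (halfSpace n) :=
    locallyIntegrableOn_const 1
  refine (h1.add hgp).of_le (halfSpace n).isOpen.measurableSet ?_ fun z _ => ?_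
  · exact ((hg.aestronglyMeasurable.norm.aemeasurable.pow_const _).aestronglyMeasurable).smul
      hg.aestronglyMeasurable
  · rw [norm_rpow_smul_self hp, Pi.add_apply, Real.norm_of_nonneg (by positivity)]
    rcases le_total ‖g z‖ 1 with h | h
    · have := Real.rpow_le_one (norm_nonneg _) h (by linarith : 0 ≤ p - 1)
      have : 0 ≤ ‖g z‖ ^ p := by positivity
      linarith
    · have := Real.rpow_le_rpow_of_exponent_le h (by linarith : p - 1 ≤ p)
      linarith

theorem locallyIntegrableOn_norm_add_rpow {F : Type*} [NormedAddCommGroup F] {r : ℝ} (hr : 0 ≤ r)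
    {a b : ℝ × EuclideanSpace ℝ (Fin n) → F}
    (ha : LocallyIntegrableOn a (halfSpace n)) (hb : LocallyIntegrableOn b (halfSpace n))
    (har : LocallyIntegrableOn (fun z => ‖a z‖ ^ r) (halfSpace n))
    (hbr : LocallyIntegrableOn (fun z => ‖b z‖ ^ r) (halfSpace n)) :
    LocallyIntegrableOn (fun z => ‖a z + b z‖ ^ r) (halfSpace n) := by
  refine ((har.add hbr).smul ((2 : ℝ) ^ r)).of_le (halfSpace n).isOpen.measurableSet ?_
    fun z _ => ?_
  · exact ((ha.aestronglyMeasurable.add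
      hb.aestronglyMeasurable).norm.aemeasurable.pow_const _).aestronglyMeasurable
  · rw [Real.norm_of_nonneg (by positivity)]
    simp only [Pi.smul_apply, Pi.add_apply, smul_eq_mul]
    rw [Real.norm_of_nonneg (by positivity)]
    exact (Real.rpow_le_rpow (norm_nonneg _) (norm_add_le _ _) hr).trans
      (add_rpow_le_two_rpow_mul hr (norm_nonneg _) (norm_nonneg _))

theorem locallyIntegrableOn_signed_rpow {q : ℝ} (hq : 1 < q)
    {u : ℝ × EuclideanSpace ℝ (Fin n) → ℝ} (hu : LocallyIntegrableOn u (halfSpace n))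
    (huq : LocallyIntegrableOn (fun z => |u z| ^ q) (halfSpace n)) :
    LocallyIntegrableOn (fun z => |u z| ^ (q - 1) * u z) (halfSpace n) := by
  refine huq.of_le (halfSpace n).isOpen.measurableSet
    (((hu.aestronglyMeasurable.norm.aemeasurable.pow_const _).aestronglyMeasurable).mul
      hu.aestronglyMeasurable) fun z _ => le_of_eq ?_
  have h0 : ∀ r : ℝ, 0 ≤ |u z| ^ r := fun r => Real.rpow_nonneg (abs_nonneg _) r
  rw [norm_mul, Real.norm_of_nonneg (h0 _), Real.norm_of_nonneg (h0 _), Real.norm_eq_abs,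
    ← Real.rpow_add_one' (abs_nonneg _) (by linarith)]
  ring_nf

theorem norm_flux_rpow {p : ℝ} (hp : 1 < p) (x : EuclideanSpace ℝ (Fin n)) :
    ‖‖x‖ ^ (p - 2) • x‖ ^ (p / (p - 1)) = ‖x‖ ^ p := by
  rw [norm_rpow_smul_self hp, ← Real.rpow_mul (norm_nonneg _),
    mul_div_cancel₀ _ (by linarith : p - 1 ≠ 0)]

/-- Two super-solutions `u₁`, `u₂` with `u₁ ≥ -u₂` give a difference inequality for `u₁ + u₂`. -/
theorem IsEntireWeakSuperSolution.exists_differenceInequality {p q : ℝ} (hp : 1 < p) (hp2 : p ≤ 2)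
    (hq : 1 < q) {u₁ u₂ : ℝ × EuclideanSpace ℝ (Fin n) → ℝ}
    (h₁ : IsEntireWeakSuperSolution n p q u₁) (h₂ : IsEntireWeakSuperSolution n p q u₂)
    (h : ∀ᵐ z ∂(volume.restrict (halfSpace n : Set (ℝ × EuclideanSpace ℝ (Fin n)))),
      0 ≤ u₁ z + u₂ z) :
    ∃ wt f B D, DifferenceInequality n p q (min (2 ^ (-q)) (2 ^ (1 - p / (p - 1))))
      (fun z => max (u₁ z + u₂ z) 0) wt f B D := by
  obtain ⟨-, hq₁, d₁, g₁, ht₁, hg₁, hp₁, hi₁⟩ := h₁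
  obtain ⟨-, hq₂, d₂, g₂, ht₂, hg₂, hp₂, hi₂⟩ := h₂
  have hS : MeasurableSet (halfSpace n : Set (ℝ × EuclideanSpace ℝ (Fin n))) :=
    (halfSpace n).isOpen.measurableSet
  -- Non-negativity is known only almost everywhere, while `DifferenceInequality` asks for it at
  -- every point; passing to the positive part changes a null set and leaves weak derivatives
  -- intact.
  have hmax : ∀ᵐ z ∂(volume.restrict (halfSpace n : Set (ℝ × EuclideanSpace ℝ (Fin n)))),
      u₁ z + u₂ z = max (u₁ z + u₂ z) 0 := by
    filter_upwards [h] with z hz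
    rw [max_eq_left hz]
  have hA₁ := locallyIntegrableOn_flux hp hg₁.2.1 hp₁
  have hA₂ := locallyIntegrableOn_flux hp hg₂.2.1 hp₂
  have hf₁ := locallyIntegrableOn_signed_rpow hq ht₁.1 hq₁
  have hf₂ := locallyIntegrableOn_signed_rpow hq ht₂.1 hq₂
  have hm : AEStronglyMeasurable (fun z => max (u₁ z + u₂ z) 0)
      (volume.restrict (halfSpace n : Set (ℝ × EuclideanSpace ℝ (Fin n)))) :=
    (ht₁.1.aestronglyMeasurable.add ht₂.1.aestronglyMeasurable).sup aestronglyMeasurable_const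
  have hmaxle : ∀ z, max (u₁ z + u₂ z) 0 ≤ ‖u₁ z + u₂ z‖ := fun z =>
    max_le (le_abs_self _) (norm_nonneg _)
  have hq0 : 0 ≤ q := by linarith
  refine ⟨fun z => d₁ z + d₂ z, fun z => |u₁ z| ^ (q - 1) * u₁ z + |u₂ z| ^ (q - 1) * u₂ z,
    fun z => ‖g₁ z‖ ^ (p - 2) • g₁ z + ‖g₂ z‖ ^ (p - 2) • g₂ z, fun z => g₁ z + g₂ z,
    { nonneg := fun z => le_max_right _ _
      locallyIntegrable := (ht₁.1.add ht₂.1).of_le hS hm fun z _ => ?_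
      locallyIntegrable_rpow := (locallyIntegrableOn_norm_add_rpow hq0 ht₁.1 ht₂.1 hq₁ hq₂).of_le hS
        (hm.aemeasurable.pow_const q).aestronglyMeasurable fun z _ => ?_
      locallyIntegrable_time := ht₁.2.1.add ht₂.2.1
      locallyIntegrable_reaction := hf₁.add hf₂
      locallyIntegrable_flux := hA₁.add hA₂
      locallyIntegrable_flux_rpow := locallyIntegrableOn_norm_add_rpow
        (div_nonneg (by linarith) (by linarith)) hA₁ hA₂ (by simpa only [norm_flux_rpow hp] using hp₁)
        (by simpa only [norm_flux_rpow hp] using hp₂)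
      locallyIntegrable_grad := hg₁.2.1.add hg₂.2.1
      locallyIntegrable_grad_rpow :=
        locallyIntegrableOn_norm_add_rpow (by linarith) hg₁.2.1 hg₂.2.1 hp₁ hp₂
      weak_time := (ht₁.hasWeakDirDeriv.add ht₂.hasWeakDirDeriv ht₁.1 ht₁.2.1 ht₂.1
        ht₂.2.1).congr_ae hmax
      weak_space := fun i => ((hg₁.hasWeakDirDeriv i).add (hg₂.hasWeakDirDeriv i) hg₁.1
        (hg₁.2.1.euclidean_apply i) hg₂.1 (hg₂.2.1.euclidean_apply i)).congr_ae hmax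
      reaction := ?_
      coercive := fun z => ?_
      test := fun φ hφ => ?_ }⟩
  · rw [Real.norm_of_nonneg (le_max_right _ _)]
    exact hmaxle z
  · rw [Real.norm_of_nonneg (by positivity), Real.norm_of_nonneg (by positivity)]
    exact Real.rpow_le_rpow (le_max_right _ _) (hmaxle z) hq0
  · filter_upwards [h] with z hz
    rw [max_eq_left hz]
    refine le_trans ?_ (rpow_le_signed_rpow_add hq hz)
    gcongr
    exact min_le_left _ _
  · refine le_trans ?_ (flux_rpow_le_inner hp hp2 (g₁ z) (g₂ z))
    gcongr
    exact min_le_right _ _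
  · have hint : ∀ (u d : ℝ × EuclideanSpace ℝ (Fin n) → ℝ)
        (g : ℝ × EuclideanSpace ℝ (Fin n) → EuclideanSpace ℝ (Fin n)),
        LocallyIntegrableOn d (halfSpace n) →
        LocallyIntegrableOn (fun z => ‖g z‖ ^ (p - 2) • g z) (halfSpace n) →
        LocallyIntegrableOn (fun z => |u z| ^ (q - 1) * u z) (halfSpace n) →
        IntegrableOn (fun z => d z * φ z + ∑ i : Fin n, ‖g z‖ ^ (p - 2) * g z i * spaceDeriv i φ z
          - |u z| ^ (q - 1) * u z * φ z) (halfSpace n) := by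
      intro u d g hd hA hf
      refine ((integrableOn_mul_testFunction φ hd).add (integrable_finsetSum _ fun i _ => ?_)).sub
        (integrableOn_mul_testFunction φ hf)
      simp only [spaceDeriv_eq_fderiv (differentiable_testFunction φ)]
      exact integrableOn_mul_fderiv_testFunction φ (hA.euclidean_apply i) _
    have hsum := add_nonneg (hi₁ φ hφ) (hi₂ φ hφ)
    rw [← integral_add (hint u₁ d₁ g₁ ht₁.2.1 hA₁ hf₁) (hint u₂ d₂ g₂ ht₂.2.1 hA₂ hf₂)] at hsum
    refine hsum.trans_eq (integral_congr_ae (Eventually.of_forall fun z => ?_))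
    simp only [spaceDeriv_eq_fderiv (differentiable_testFunction φ), PiLp.add_apply,
      PiLp.smul_apply, smul_eq_mul, add_mul, Finset.sum_add_distrib]
    ring

end Reduction

theorem theorem2 (n : ℕ) (hn : 1 ≤ n) (p q : ℝ) (hp1 : 1 < p) (hp2 : p ≤ 2)
    (hq1 : 1 < q) (hq2 : q ≤ p - 1 + p / (n : ℝ))
    (u₀ v₀ : 𝓓'((⊤ : Opens (EuclideanSpace ℝ (Fin n))), ℝ))
    (u v : ℝ × EuclideanSpace ℝ (Fin n) → ℝ)
    (hu : IsEntireWeakSuperSolutionCauchy n p q u₀ u)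
    (hv : IsEntireWeakSubSolutionCauchy n p q v₀ v)
    (huv : ∀ᵐ z ∂(volume.restrict (halfSpace n : Set (ℝ × EuclideanSpace ℝ (Fin n)))),
      v z ≤ u z) :
    ∀ᵐ z ∂(volume.restrict (halfSpace n : Set (ℝ × EuclideanSpace ℝ (Fin n)))),
      u z = v z := by
  -- With -v as second super-solution, the sum is u - v, and the ordering of u and v is its
  -- non-negativity.
  have hsuper : IsEntireWeakSuperSolution n p q fun z => -v z := hv.1
  obtain ⟨wt, f, B, D, h⟩ := hu.1.exists_differenceInequality hp1 hp2 hq1 hsuper (by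
    filter_upwards [huv] with z hz
    linarith)
  filter_upwards [huv, h.ae_eq_zero hn hp1 hp2 hq1 hq2 (lt_min (by positivity) (by positivity))]
    with z hz hz0
  rw [max_eq_left (by linarith)] at hz0
  linarith
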